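/- Let $n\ge 1$, $\zeta=e^{\pi i/n}$, and $\zeta^{j}:=e^{\pi i j/n}$ for real $j$. Let $\mathcal T_n$ be the set of tuples $J=(j_1,\dots,j_n)$ of real numbers with $-\frac{n-1}{2}\le j_1<\cdots<j_n\le\frac{3n-1}{2}$ such that $\zeta^J:=(\zeta^{j_1},\dots,\zeta^{j_n})$ consists of distinct $2n$-th roots of $(-1)^{n+1}$ (that is, distinct solutions $x$ of $x^{2n}=(-1)^{n+1}$), and let $\mathcal I_n$ be the set of $J\in\mathcal T_n$ with $\zeta^{j_k}\ne-\zeta^{j_l}$ for all $k,l$. For $J\in\mathcal I_n$ let $\hat J\in\mathcal T_n$ be the unique tuple such that $\{\zeta^{j_k}\}\cup\{\zeta^{\hat j_k}\}$ is the set of all $2n$-th roots of $(-1)^{n+1}$, and let $J^*\in\mathcal I_n$ be the unique tuple such that $\{\zeta^{j_k}\}\cup\{\zeta^{n-j^*_k}\}$ is the set of all $2n$-th roots of $(-1)^{n+1}$. Put $\mathrm{Vand}(x)=\prod_{k<l}(x_k-x_l)$. Let $\mathcal R(n)$ be the set of partitions $n\ge\lambda_1\ge\cdots\ge\lambda_n\ge0$,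 and $\mathcal D(n)\subset\mathcal R(n)$ the set of those whose nonzero parts are distinct; for $\lambda\in\mathcal D(n)$ let $\hat\lambda\in\mathcal D(n)$ be the partition whose nonzero parts are the elements of $\{1,\dots,n\}$ that are not parts of $\lambda$. Let $l(\lambda)$ be the number of nonzero parts, and $\rho_n=(n,n-1,\dots,1)$. In the variables $x_1,\dots,x_n$, with $E_k$ and $H_k$ the elementary and complete symmetric polynomials ($H_k=0$ for $k<0$), put $$\widetilde Q_{i,j}=E_iE_j+2\sum_{k=1}^{j}(-1)^kE_{i+k}E_{j-k}\quad(i\ge j),\qquad \widetilde Q_\lambda=\mathrm{Pf}\big(\widetilde Q_{\lambda_i,\lambda_j}\big)_{1\le i<j\le 2\lfloor (l(\lambda)+1)/2\rfloor}$$ (with $\lambda_{n+1}:=0$), $\widetilde P_\lambda=2^{-l(\lambda)}\widetilde Q_\lambda$, $S_\lambda=\det(H_{\lambda_i-i+j})_{1\le i,j\le n}$, and let $P_\lambda$ be the Hall–Littlewood polynomial $P_\lambda(x_1,\dots,x_n;t)$ at $t=-1$, i.e. $$P_\lambda=\sum_{w\in S_n/S_n^\lambda}w\Big(x_1^{\lambda_1}\cdots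 x_n^{\lambda_n}\prod_{\lambda_i>\lambda_j}\frac{x_i+x_j}{x_i-x_j}\Big),$$ where $S_n^\lambda$ is the stabilizer of $\lambda$ in $S_n$. Let $\omega$ be the algebra involution of the ring of symmetric polynomials in $x_1,\dots,x_n$ over $\mathbb C$ that interchanges $E_k$ and $H_k$ for $1\le k\le n$ (it is determined by $\omega(E_k)=H_k$, $1\le k\le n$). Then for all $I,J\in\mathcal I_n$: 1. for all $z_1,\dots,z_n\in\mathbb C$, $\displaystyle\sum_{\lambda\in\mathcal R(n)}P_\lambda(\zeta^{J^*})\,\widetilde Q_\lambda(z_1,\dots,z_n)=\prod_{k=1}^n\prod_{l=1}^n\big(1-z_k\zeta^{-\hat j_l}\big)$; 2. $\displaystyle\sum_{\lambda\in\mathcal R(n)}P_\lambda(\zeta^{J^*})\,\widetilde Q_\lambda(\zeta^I)=\delta_{I,J}\frac{(2n)^n}{|\mathrm{Vand}(\zeta^I)|^2}$; 3. $\displaystyle\sum_{\lambda\in\mathcal R(n)}\overline{\omega(P_\lambda)(\zeta^J)}\,\widetilde Q_\lambda(\zeta^I)=\delta_{I,J}\frac{(2n)^n}{|\mathrm{Vand}(\zeta^I)|^2}$;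 4. $\displaystyle\sum_{\lambda\in\mathcal D(n)}\widetilde P_\lambda(\zeta^I)\,\widetilde P_{\hat\lambda}(\zeta^J)=\delta_{I,J}\,S_{\rho_n}(\zeta^I)$. -/

import Mathlib

namespace QPOrth

open MvPolynomial

/-! ### Roots of `(-1)^(n+1)` and tuples of exponents -/

/-- `ζ^j` for a real exponent `j`, where `ζ = exp (π i / n)`. -/
noncomputable def zetaPow (n : ℕ) (j : ℝ) : ℂ :=
  Complex.exp (Real.pi * Complex.I / n * j)

/-- The tuple `ζ^J = (ζ^{j_1}, …, ζ^{j_n})`. -/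
noncomputable def zetaTuple {n : ℕ} (J : Fin n → ℝ) : Fin n → ℂ :=
  fun k => zetaPow n (J k)

/-- The set of all `2n`-th roots of `(-1)^(n+1)`. -/
def rootSet (n : ℕ) : Set ℂ := {x | x ^ (2 * n) = (-1) ^ (n + 1)}

/-- The set `𝒯_n` of tuples `-(n-1)/2 ≤ j_1 < ⋯ < j_n ≤ (3n-1)/2` such that `ζ^J` is a tuple of
distinct `2n`-th roots of `(-1)^(n+1)`. -/
def tuples (n : ℕ) : Set (Fin n → ℝ) :=
  {J | StrictMono J ∧ (∀ k, -((n : ℝ) - 1) / 2 ≤ J k ∧ J k ≤ (3 * (n : ℝ) - 1) / 2) ∧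
    (∀ k, zetaTuple J k ∈ rootSet n) ∧ Function.Injective (zetaTuple J)}

/-- The set `ℐ_n` of exclusive tuples: `ζ^{j_k} ≠ -ζ^{j_l}` for all `k, l`. -/
def exclusiveTuples (n : ℕ) : Set (Fin n → ℝ) :=
  {J | J ∈ tuples n ∧ ∀ k l, zetaTuple J k ≠ -zetaTuple J l}

/-- `K` is the complementary tuple of `J`: the sets `{ζ^{j_k}}` and `{ζ^{k_l}}` together
enumerate all `2n`-th roots of `(-1)^(n+1)`. -/
def IsHat {n : ℕ} (J K : Fin n → ℝ) : Prop :=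
  K ∈ tuples n ∧ Set.range (zetaTuple J) ∪ Set.range (zetaTuple K) = rootSet n

/-- `K = J^*`: `K` is exclusive and the sets `{ζ^{j_k}}` and `{ζ^{n - k_l}}` together
enumerate all `2n`-th roots of `(-1)^(n+1)`. -/
def IsStar {n : ℕ} (J K : Fin n → ℝ) : Prop :=
  K ∈ exclusiveTuples n ∧
    Set.range (zetaTuple J) ∪ Set.range (fun l => zetaPow n ((n : ℝ) - K l)) = rootSet n

theorem zetaPow_add (n : ℕ) (a b : ℝ) : zetaPow n (a + b) = zetaPow n a * zetaPow n b := by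
  simp only [zetaPow, ← Complex.exp_add]
  push_cast
  ring_nf

theorem zetaPow_ne_zero (n : ℕ) (a : ℝ) : zetaPow n a ≠ 0 := Complex.exp_ne_zero _

theorem zetaPow_neg (n : ℕ) (a : ℝ) : zetaPow n (-a) = (zetaPow n a)⁻¹ := by
  simp only [zetaPow, ← Complex.exp_neg]
  push_cast
  ring_nf

theorem zetaPow_self {n : ℕ} (hn : 0 < n) : zetaPow n n = -1 := by
  have : (n : ℂ) ≠ 0 := by exact_mod_cast hn.ne'
  rw [zetaPow, ← Complex.exp_pi_mul_I]
  congr 1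
  push_cast
  field_simp

theorem zetaPow_sub {n : ℕ} (hn : 0 < n) (a : ℝ) :
    zetaPow n ((n : ℝ) - a) = -(zetaPow n a)⁻¹ := by
  rw [sub_eq_add_neg, zetaPow_add, zetaPow_self hn, zetaPow_neg]
  ring

theorem zetaPow_eq_iff {n : ℕ} (hn : 0 < n) (a b : ℝ) :
    zetaPow n a = zetaPow n b ↔ ∃ m : ℤ, a = b + 2 * n * m := by
  have h0 : (n : ℂ) ≠ 0 := by exact_mod_cast hn.ne'
  have hpi : (Real.pi : ℂ) ≠ 0 := by exact_mod_cast Real.pi_ne_zero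
  rw [zetaPow, zetaPow, Complex.exp_eq_exp_iff_exists_int]
  refine exists_congr fun m => ?_
  rw [← Complex.ofReal_inj]
  push_cast
  constructor
  · intro h
    field_simp at h
    linear_combination h
  · intro h
    rw [h]
    field_simp

/-- The exponents that may occur in a tuple. -/
theorem exists_exponent {n : ℕ} (hn : 0 < n) {x : ℂ} (hx : x ∈ rootSet n) :
    ∃ j : ℝ, -((n : ℝ) - 1) / 2 ≤ j ∧ j ≤ (3 * (n : ℝ) - 1) / 2 ∧ zetaPow n j = x := by
  have h0 : (n : ℂ) ≠ 0 := by exact_mod_cast hn.ne'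
  have hR : (0 : ℝ) < n := by exact_mod_cast hn
  have hpi : (Real.pi : ℂ) ≠ 0 := by exact_mod_cast Real.pi_ne_zero
  set c : ℝ := -((n : ℝ) - 1) / 2 with hc
  have hbase : zetaPow n c ^ (2 * n) = (-1) ^ (n + 1) := by
    rw [zetaPow, ← Complex.exp_nat_mul]
    have : ((2 * n : ℕ) : ℂ) * (Real.pi * Complex.I / n * (c : ℝ)) =
        ((n + 1 : ℕ) : ℂ) * (Real.pi * Complex.I) + ((-n : ℤ) : ℂ) * (2 * Real.pi * Complex.I) := by
      rw [hc]
      push_cast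
      field_simp
      ring
    rw [this, Complex.exp_add, Complex.exp_int_mul_two_pi_mul_I, mul_one, Complex.exp_nat_mul,
      Complex.exp_pi_mul_I]
  have hquot : (x / zetaPow n c) ^ (2 * n) = 1 := by
    rw [div_pow, hbase, show x ^ (2 * n) = _ from hx]
    exact div_self (pow_ne_zero _ (by norm_num))
  have : NeZero (2 * n) := ⟨by omega⟩
  obtain ⟨m, hm, hmx⟩ :=
    (Complex.isPrimitiveRoot_exp (2 * n) (by omega)).eq_pow_of_pow_eq_one hquot
  have hm' : (m : ℝ) + 1 ≤ 2 * n := by exact_mod_cast hm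
  refine ⟨c + m, ?_, ?_, ?_⟩
  · have : (0 : ℝ) ≤ m := Nat.cast_nonneg m
    linarith
  · rw [hc]
    linarith
  · rw [zetaPow_add, eq_div_iff (zetaPow_ne_zero n c)] at *
    rw [← hmx, mul_comm]
    congr 1
    rw [zetaPow, ← Complex.exp_nat_mul]
    congr 1
    push_cast
    field_simp

theorem exponent_unique {n : ℕ} (hn : 0 < n) {a b : ℝ}
    (ha : -((n : ℝ) - 1) / 2 ≤ a ∧ a ≤ (3 * (n : ℝ) - 1) / 2)
    (hb : -((n : ℝ) - 1) / 2 ≤ b ∧ b ≤ (3 * (n : ℝ) - 1) / 2)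
    (h : zetaPow n a = zetaPow n b) : a = b := by
  obtain ⟨m, hm⟩ := (zetaPow_eq_iff hn a b).1 h
  have hR : (0 : ℝ) < n := by exact_mod_cast hn
  have h1 : (m : ℝ) < 1 := by
    by_contra! hc
    nlinarith
  have h2 : (-1 : ℝ) < m := by
    by_contra! hc
    nlinarith
  have h3 : m = 0 := by
    have h1' : m < 1 := by exact_mod_cast h1
    have h2' : -1 < m := by exact_mod_cast h2
    omega
  simpa [h3] using hm

theorem existsUnique_tuple {n : ℕ} (hn : 0 < n) (C : Finset ℂ) (hC : C.card = n)
    (hCr : ∀ x ∈ C, x ∈ rootSet n) :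
    ∃! K : Fin n → ℝ, K ∈ tuples n ∧ Set.range (zetaTuple K) = (C : Set ℂ) := by
  classical
  choose! e he1 he2 he3 using fun x (hx : x ∈ C) => exists_exponent hn (hCr x hx)
  have hinj : Set.InjOn e (C : Set ℂ) := fun x hx y hy h => by
    rw [← he3 x hx, ← he3 y hy, h]
  have hS : (C.image e).card = n := by rw [Finset.card_image_of_injOn hinj, hC]
  have hmem : ∀ k, ∃ x ∈ C, e x = (C.image e).orderEmbOfFin hS k := fun k =>
    Finset.mem_image.1 ((C.image e).orderEmbOfFin_mem hS k)
  have hran : Set.range ((C.image e).orderEmbOfFin hS) = e '' (C : Set ℂ) := by simp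
  have hz : Set.range (zetaTuple ((C.image e).orderEmbOfFin hS)) = (C : Set ℂ) := by
    have : zetaTuple ((C.image e).orderEmbOfFin hS) =
        zetaPow n ∘ ((C.image e).orderEmbOfFin hS) := rfl
    rw [this, Set.range_comp, hran, ← Set.image_comp]
    ext x
    constructor
    · rintro ⟨y, hy, rfl⟩
      simpa [he3 y hy] using hy
    · intro hx
      exact ⟨x, hx, he3 x hx⟩
  have hwin : ∀ k, -((n : ℝ) - 1) / 2 ≤ (C.image e).orderEmbOfFin hS k ∧
      (C.image e).orderEmbOfFin hS k ≤ (3 * (n : ℝ) - 1) / 2 := fun k => by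
    obtain ⟨x, hx, hxk⟩ := hmem k
    rw [← hxk]
    exact ⟨he1 x hx, he2 x hx⟩
  refine ⟨(C.image e).orderEmbOfFin hS, ⟨⟨(OrderEmbedding.strictMono _), hwin, ?_, ?_⟩, hz⟩, ?_⟩
  · intro k
    apply hCr
    have : zetaTuple ((C.image e).orderEmbOfFin hS) k ∈ (C : Set ℂ) := hz ▸ ⟨k, rfl⟩
    exact this
  · intro k l hkl
    exact ((C.image e).orderEmbOfFin hS).injective (exponent_unique hn (hwin k) (hwin l) hkl)
  · rintro K ⟨⟨hK1, hK2, -, -⟩, hK⟩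
    apply Finset.orderEmbOfFin_unique hS _ hK1
    intro k
    have hk : zetaTuple K k ∈ (C : Set ℂ) := hK ▸ ⟨k, rfl⟩
    rw [Finset.mem_image]
    exact ⟨_, hk, exponent_unique hn ⟨he1 _ hk, he2 _ hk⟩ (hK2 k) (he3 _ hk)⟩

theorem exists_rootFinset {n : ℕ} (hn : 0 < n) :
    ∃ R : Finset ℂ, (R : Set ℂ) = rootSet n ∧ R.card = 2 * n := by
  classical
  have hp := Complex.isPrimitiveRoot_exp (2 * n) (by omega)
  have ha : ((-1 : ℂ)) ^ (n + 1) ≠ 0 := pow_ne_zero _ (by norm_num)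
  refine ⟨(Polynomial.nthRoots (2 * n) ((-1 : ℂ) ^ (n + 1))).toFinset, ?_, ?_⟩
  · ext x
    simp [rootSet, Polynomial.mem_nthRoots (show 0 < 2 * n by omega)]
  · rw [Multiset.toFinset_card_of_nodup (hp.nthRoots_nodup ha), hp.card_nthRoots, if_pos]
    exact IsAlgClosed.exists_pow_nat_eq _ (by omega)

theorem existsUnique_isHat {n : ℕ} (hn : 0 < n) {J : Fin n → ℝ} (hJ : J ∈ tuples n) :
    ∃! K, IsHat J K := by
  classical
  obtain ⟨R, hR, hRc⟩ := exists_rootFinset hn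
  have hAc : (Finset.univ.image (zetaTuple J)).card = n := by
    rw [Finset.card_image_of_injective _ hJ.2.2.2]
    simp
  have hA : Finset.univ.image (zetaTuple J) ⊆ R := by
    intro x hx
    obtain ⟨k, -, rfl⟩ := Finset.mem_image.1 hx
    have := hJ.2.2.1 k
    rw [← hR] at this
    exact this
  have key : ∀ K, IsHat J K ↔ (K ∈ tuples n ∧
      Set.range (zetaTuple K) = ((R \ Finset.univ.image (zetaTuple J) : Finset ℂ) : Set ℂ)) := by
    intro K
    refine and_congr_right fun hK => ?_
    have hBc : (Finset.univ.image (zetaTuple K)).card = n := by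
      rw [Finset.card_image_of_injective _ hK.2.2.2]
      simp
    rw [← hR]
    have e1 : Set.range (zetaTuple J) = ((Finset.univ.image (zetaTuple J) : Finset ℂ) : Set ℂ) := by
      simp
    have e2 : Set.range (zetaTuple K) = ((Finset.univ.image (zetaTuple K) : Finset ℂ) : Set ℂ) := by
      simp
    rw [e1, e2, ← Finset.coe_union, Finset.coe_inj, Finset.coe_inj]
    constructor
    · intro h
      symm
      apply Finset.eq_of_subset_of_card_le
      · rw [← h]
        intro x hx
        simp only [Finset.mem_sdiff, Finset.mem_union] at hx
        tauto
      · rw [Finset.card_sdiff_of_subset hA]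
        omega
    · intro h
      rw [h, Finset.union_sdiff_of_subset hA]
  obtain ⟨K, hK, hu⟩ := existsUnique_tuple hn (R \ Finset.univ.image (zetaTuple J))
    (by rw [Finset.card_sdiff_of_subset hA]; omega)
    (fun x hx => by
      rw [← hR]
      exact (Finset.mem_sdiff.1 hx).1)
  exact ⟨K, (key K).2 hK, fun K' hK' => hu K' ((key K').1 hK')⟩

theorem inv_mem_rootSet {n : ℕ} {x : ℂ} (hx : x ∈ rootSet n) : x⁻¹ ∈ rootSet n := by
  have hx' : x ^ (2 * n) = (-1) ^ (n + 1) := hx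
  change x⁻¹ ^ (2 * n) = (-1) ^ (n + 1)
  rw [inv_pow, hx', ← inv_pow]
  norm_num

theorem neg_mem_rootSet {n : ℕ} {x : ℂ} (hx : x ∈ rootSet n) : -x ∈ rootSet n := by
  have hx' : x ^ (2 * n) = (-1) ^ (n + 1) := hx
  change (-x) ^ (2 * n) = (-1) ^ (n + 1)
  rw [Even.neg_pow (even_two_mul n), hx']

/-- `J^*` is characterized by `{ζ^{j^*_k}} = {ζ^{-j_k}}`. -/
theorem isStar_iff {n : ℕ} (hn : 0 < n) {J : Fin n → ℝ} (hJ : J ∈ exclusiveTuples n)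
    (K : Fin n → ℝ) :
    IsStar J K ↔ (K ∈ tuples n ∧
      Set.range (zetaTuple K) =
        ((Finset.univ.image fun k => (zetaTuple J k)⁻¹ : Finset ℂ) : Set ℂ)) := by
  classical
  obtain ⟨R, hR, hRc⟩ := exists_rootFinset hn
  have hfun : (fun l => zetaPow n ((n : ℝ) - K l)) = fun l => -(zetaTuple K l)⁻¹ := by
    funext l
    exact zetaPow_sub hn _
  have e1 : Set.range (zetaTuple J) = ((Finset.univ.image (zetaTuple J) : Finset ℂ) : Set ℂ) := by
    simp
  have hdisj : Disjoint (Finset.univ.image (zetaTuple J))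
      (Finset.univ.image fun k => -zetaTuple J k) := by
    rw [Finset.disjoint_left]
    intro x hx hx'
    obtain ⟨k, -, rfl⟩ := Finset.mem_image.1 hx
    obtain ⟨l, -, h⟩ := Finset.mem_image.1 hx'
    exact hJ.2 k l h.symm
  have hcA : (Finset.univ.image (zetaTuple J)).card = n := by
    rw [Finset.card_image_of_injective _ hJ.1.2.2.2]
    simp
  have hcN : (Finset.univ.image fun k => -zetaTuple J k).card = n := by
    exact (Finset.card_image_of_injective _ (neg_injective.comp hJ.1.2.2.2)).trans (by simp)
  have hU : Finset.univ.image (zetaTuple J) ∪ (Finset.univ.image fun k => -zetaTuple J k) = R := by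
    apply Finset.eq_of_subset_of_card_le
    · intro x hx
      rw [← Finset.mem_coe, hR]
      rcases Finset.mem_union.1 hx with hx | hx
      · obtain ⟨k, -, rfl⟩ := Finset.mem_image.1 hx
        exact hJ.1.2.2.1 k
      · obtain ⟨k, -, rfl⟩ := Finset.mem_image.1 hx
        exact neg_mem_rootSet (hJ.1.2.2.1 k)
    · rw [Finset.card_union_of_disjoint hdisj]
      omega
  constructor
  · rintro ⟨hK, h⟩
    refine ⟨hK.1, ?_⟩
    rw [hfun, ← hR, e1] at h
    have e2 : Set.range (fun l => -(zetaTuple K l)⁻¹) =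
        ((Finset.univ.image (fun l => -(zetaTuple K l)⁻¹) : Finset ℂ) : Set ℂ) := by simp
    rw [e2, ← Finset.coe_union, Finset.coe_inj] at h
    have hsub : (Finset.univ.image fun k => -zetaTuple J k) ⊆
        Finset.univ.image (fun l => -(zetaTuple K l)⁻¹) := by
      intro x hx
      have hxR : x ∈ R := hU ▸ Finset.mem_union_right _ hx
      rw [← h] at hxR
      rcases Finset.mem_union.1 hxR with h' | h'
      · exact absurd hx (Finset.disjoint_left.1 hdisj h')
      · exact h'
    have heq := Finset.eq_of_subset_of_card_le hsub (by
      rw [hcN]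
      exact Finset.card_image_le.trans (by simp))
    ext x
    have hx := Finset.ext_iff.1 heq (-x⁻¹)
    simp only [Finset.mem_image, Finset.mem_univ, true_and, neg_inj, inv_inj] at hx
    simp only [Set.mem_range, Finset.coe_image, Finset.coe_univ, Set.image_univ]
    rw [← hx]
    simp only [inv_eq_iff_eq_inv]
  · rintro ⟨hK, h⟩
    have hinv : ∀ l, ∃ k, (zetaTuple J k)⁻¹ = zetaTuple K l := by
      intro l
      have : zetaTuple K l ∈ Set.range (zetaTuple K) := ⟨l, rfl⟩
      rw [h] at this
      simpa using this
    refine ⟨⟨hK, ?_⟩, ?_⟩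
    · intro k l hkl
      obtain ⟨a, ha⟩ := hinv k
      obtain ⟨b, hb⟩ := hinv l
      rw [← ha, ← hb, ← inv_neg, inv_inj] at hkl
      exact hJ.2 a b hkl
    · rw [hfun, ← hR, ← hU, e1, Finset.coe_union]
      congr 1
      have : (fun l => -(zetaTuple K l)⁻¹) = (fun x : ℂ => -x⁻¹) ∘ zetaTuple K := rfl
      rw [this, Set.range_comp, h]
      ext x
      simp

theorem existsUnique_isStar {n : ℕ} (hn : 0 < n) {J : Fin n → ℝ} (hJ : J ∈ exclusiveTuples n) :
    ∃! K, IsStar J K := by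
  classical
  obtain ⟨K, hK, hu⟩ := existsUnique_tuple hn (Finset.univ.image fun k => (zetaTuple J k)⁻¹)
    ((Finset.card_image_of_injective _ (inv_injective.comp hJ.1.2.2.2)).trans (by simp))
    (fun x hx => by
      obtain ⟨k, -, rfl⟩ := Finset.mem_image.1 hx
      exact inv_mem_rootSet (hJ.1.2.2.1 k))
  exact ⟨K, (isStar_iff hn hJ K).2 hK, fun K' hK' => hu K' ((isStar_iff hn hJ K').1 hK')⟩

/-- The complementary tuple `Ĵ` of `J`. -/
noncomputable def hatTuple {n : ℕ} (hn : 0 < n) (J : exclusiveTuples n) : Fin n → ℝ :=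
  (existsUnique_isHat hn J.2.1).choose

/-- The tuple `J^*`. -/
noncomputable def starTuple {n : ℕ} (hn : 0 < n) (J : exclusiveTuples n) : Fin n → ℝ :=
  (existsUnique_isStar hn J.2).choose

theorem hatTuple_spec {n : ℕ} (hn : 0 < n) (J : exclusiveTuples n) : IsHat J.1 (hatTuple hn J) :=
  (existsUnique_isHat hn J.2.1).choose_spec.1

theorem starTuple_spec {n : ℕ} (hn : 0 < n) (J : exclusiveTuples n) :
    IsStar J.1 (starTuple hn J) :=
  (existsUnique_isStar hn J.2).choose_spec.1

/-- `Vand(x) = ∏_{k<l} (x_k - x_l)`. -/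
def vand {n : ℕ} (x : Fin n → ℂ) : ℂ := ∏ k, ∏ l ∈ Finset.Ioi k, (x k - x l)

/-! ### Partitions -/

/-- `ℛ(n)`: partitions `n ≥ λ_1 ≥ ⋯ ≥ λ_n ≥ 0`. -/
def boxPartitions (n : ℕ) : Finset (Fin n → ℕ) :=
  {lam ∈ Fintype.piFinset (fun _ : Fin n => Finset.range (n + 1)) | ∀ i j, i < j → lam j ≤ lam i}

/-- `𝒟(n)`: the partitions in `ℛ(n)` whose nonzero parts are distinct. -/
def strictPartitions (n : ℕ) : Finset (Fin n → ℕ) :=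
  {lam ∈ boxPartitions n | ∀ i j, i < j → lam i ≠ 0 → lam j < lam i}

/-- The length: the number of nonzero parts. -/
def len {n : ℕ} (lam : Fin n → ℕ) : ℕ := (Finset.univ.filter fun i => lam i ≠ 0).card

/-- The sequence `λ_1, …, λ_n, 0, 0, …` (indexed from `0`). -/
def part {n : ℕ} (lam : Fin n → ℕ) (i : ℕ) : ℕ := if h : i < n then lam ⟨i, h⟩ else 0

/-- `λ̂`: the decreasing enumeration of `{1, …, n} ∖ {parts of λ}`, padded with zeros. -/
def hatPartition {n : ℕ} (lam : Fin n → ℕ) (i : Fin n) : ℕ :=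
  ((Finset.Icc 1 n \ Finset.univ.image lam).sort (· ≥ ·)).getD i 0

/-- `ρ_n = (n, n-1, …, 1)`. -/
def rho (n : ℕ) (i : Fin n) : ℕ := n - i

/-! ### `Q̃`-, `P̃`- and Schur polynomials -/

/-- The Pfaffian of a skew-symmetric `2m × 2m` matrix, by expansion along the first row:
`Pf A = ∑_{j ≥ 2} (-1)^j a_{1j} Pf A_{1j}`, where `A_{1j}` is `A` with rows and columns `1` and `j`
removed. -/
def pfaffian {R : Type*} [CommRing R] : (m : ℕ) → Matrix (Fin (2 * m)) (Fin (2 * m)) R → R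
  | 0, _ => 1
  | m + 1, A => ∑ j : Fin (2 * m + 1), (-1) ^ (j : ℕ) * A (0 : Fin (2 * m + 2)) j.succ *
      pfaffian m (Matrix.of fun a b => A (j.succAbove a).succ (j.succAbove b).succ)

/-- `Q̃_{i,j} = E_i E_j + 2 ∑_{k=1}^j (-1)^k E_{i+k} E_{j-k}`, used for `i ≥ j`. -/
noncomputable def Qtilde₂ (n i j : ℕ) : MvPolynomial (Fin n) ℂ :=
  esymm (Fin n) ℂ i * esymm (Fin n) ℂ j +
    2 * ∑ k ∈ Finset.Icc 1 j, (-1) ^ k * (esymm (Fin n) ℂ (i + k) * esymm (Fin n) ℂ (j - k))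

/-- `Q̃_λ(x_1, …, x_n)`: the Pfaffian of the skew-symmetric matrix of size `2⌊(l(λ)+1)/2⌋` with
entries `Q̃_{λ_i, λ_j}` above the diagonal. -/
noncomputable def Qtilde {n : ℕ} (lam : Fin n → ℕ) : MvPolynomial (Fin n) ℂ :=
  pfaffian ((len lam + 1) / 2) (Matrix.of fun i j =>
    if i < j then Qtilde₂ n (part lam i) (part lam j)
    else if j < i then -Qtilde₂ n (part lam j) (part lam i)
    else 0)

/-- `P̃_λ = 2^{-l(λ)} Q̃_λ`. -/
noncomputable def Ptilde {n : ℕ} (lam : Fin n → ℕ) : MvPolynomial (Fin n) ℂ :=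
  C ((2 : ℂ)⁻¹ ^ len lam) * Qtilde lam

/-- The complete symmetric polynomial `H_k`, with `H_k = 0` for `k < 0`. -/
noncomputable def completeSymm (n : ℕ) (k : ℤ) : MvPolynomial (Fin n) ℂ :=
  if 0 ≤ k then hsymm (Fin n) ℂ k.toNat else 0

/-- The Schur polynomial `S_λ = det (H_{λ_i - i + j})`. -/
noncomputable def schur {n : ℕ} (lam : Fin n → ℕ) : MvPolynomial (Fin n) ℂ :=
  (Matrix.of fun i j : Fin n => completeSymm n ((lam i : ℤ) - (i : ℤ) + (j : ℤ))).det

/-! ### Hall-Littlewood polynomials -/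

/-- The set of distinct rearrangements of `λ`, i.e. its orbit under the symmetric group. -/
def rearrangements {n : ℕ} (lam : Fin n → ℕ) : Finset (Fin n → ℕ) :=
  Finset.univ.image fun w : Equiv.Perm (Fin n) => lam ∘ w

/-- The rational function
`∑_{w ∈ S_n / S_n^λ} w (x_1^{λ_1} ⋯ x_n^{λ_n} ∏_{λ_i > λ_j} (x_i - t x_j) / (x_i - x_j))`.
The cosets `w S_n^λ` are indexed by the rearrangements `α = w λ` of `λ`. -/
noncomputable def hallLittlewoodFrac {n : ℕ} (t : ℂ) (lam : Fin n → ℕ) :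
    FractionRing (MvPolynomial (Fin n) ℂ) :=
  ∑ α ∈ rearrangements lam,
    algebraMap _ _ (∏ i, (X i : MvPolynomial (Fin n) ℂ) ^ α i) *
      ∏ i, ∏ j, if α j < α i then
        algebraMap (MvPolynomial (Fin n) ℂ) (FractionRing (MvPolynomial (Fin n) ℂ))
            (X i - C t * X j) /
          algebraMap (MvPolynomial (Fin n) ℂ) (FractionRing (MvPolynomial (Fin n) ℂ)) (X i - X j)
      else 1

/-- The product `∏_{i<j} (x_i - x_j)` as a polynomial. -/
noncomputable def vandPoly (n : ℕ) : MvPolynomial (Fin n) ℂ :=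
  ∏ i, ∏ j ∈ Finset.Ioi i, (X i - X j)

/-- Factor attached to the pair `(i, j)` after clearing denominators. -/
noncomputable def hlFactor {n : ℕ} (t : ℂ) (α : Fin n → ℕ) (i j : Fin n) :
    MvPolynomial (Fin n) ℂ :=
  if α j < α i then X i - C t * X j else if α i < α j then C t * X i - X j else X i - X j

/-- The Hall-Littlewood polynomial multiplied by `∏_{i<j} (x_i - x_j)`. -/
noncomputable def hlNumerator {n : ℕ} (t : ℂ) (lam : Fin n → ℕ) : MvPolynomial (Fin n) ℂ :=
  ∑ α ∈ rearrangements lam,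
    (∏ i, (X i : MvPolynomial (Fin n) ℂ) ^ α i) * ∏ i, ∏ j ∈ Finset.Ioi i, hlFactor t α i j

theorem hlFactor_antisymm {n : ℕ} (t : ℂ) (α : Fin n → ℕ) (i j : Fin n) :
    hlFactor t α i j = -hlFactor t α j i := by
  unfold hlFactor
  split_ifs <;> first | omega | ring

theorem rename_hlFactor {n : ℕ} (t : ℂ) (α : Fin n → ℕ) (σ : Equiv.Perm (Fin n)) (i j : Fin n) :
    rename σ (hlFactor t α i j) = hlFactor t (α ∘ σ.symm) (σ i) (σ j) := by
  unfold hlFactor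
  simp only [Function.comp, Equiv.symm_apply_apply]
  split_ifs <;> simp

theorem rename_hlNumerator {n : ℕ} (t : ℂ) (lam : Fin n → ℕ) (σ : Equiv.Perm (Fin n)) :
    rename σ (hlNumerator t lam) =
      ((Equiv.Perm.sign σ : ℤ) : MvPolynomial (Fin n) ℂ) * hlNumerator t lam := by
  unfold hlNumerator
  rw [map_sum, Finset.mul_sum]
  refine Finset.sum_bij (fun α _ => α ∘ σ.symm) ?_ ?_ ?_ ?_
  · intro α hα
    obtain ⟨w, -, rfl⟩ := Finset.mem_image.1 hα
    exact Finset.mem_image.2 ⟨w * σ⁻¹, Finset.mem_univ _, by funext k; simp [Equiv.Perm.inv_def]⟩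
  · intro α _ β _ h
    funext k
    simpa using congrFun h (σ k)
  · intro α hα
    obtain ⟨w, -, rfl⟩ := Finset.mem_image.1 hα
    refine ⟨lam ∘ (w * σ : Equiv.Perm (Fin n)), Finset.mem_image.2 ⟨w * σ, Finset.mem_univ _, rfl⟩, ?_⟩
    funext k
    simp
  · intro α _
    rw [map_mul, map_prod, map_prod]
    simp only [map_prod, map_pow, rename_X, rename_hlFactor]
    rw [Equiv.Perm.prod_Ioi_comp_eq_sign_mul_prod σ (hlFactor_antisymm t (α ∘ σ.symm)),
      ← Equiv.prod_comp σ fun i => (X i : MvPolynomial (Fin n) ℂ) ^ (α ∘ σ.symm) i]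
    simp only [Function.comp, Equiv.symm_apply_apply]
    ring

theorem rename_vandPoly {n : ℕ} (σ : Equiv.Perm (Fin n)) :
    rename σ (vandPoly n) =
      ((Equiv.Perm.sign σ : ℤ) : MvPolynomial (Fin n) ℂ) * vandPoly n := by
  unfold vandPoly
  simp only [map_prod, map_sub, rename_X]
  exact Equiv.Perm.prod_Ioi_comp_eq_sign_mul_prod σ
    (f := fun i j => (X i - X j : MvPolynomial (Fin n) ℂ)) (fun i j => by ring)

/-- Substitution `x_j ↦ x_i`. -/
noncomputable def identify {n : ℕ} (i j : Fin n) :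
    MvPolynomial (Fin n) ℂ →ₐ[ℂ] MvPolynomial (Fin n) ℂ :=
  aeval fun k => if k = j then X i else X k

theorem X_sub_X_dvd_iff {n : ℕ} (i j : Fin n) (p : MvPolynomial (Fin n) ℂ) :
    X i - X j ∣ p ↔ identify i j p = 0 := by
  constructor
  · rintro ⟨q, rfl⟩
    by_cases h : i = j <;> simp [identify, h]
  · intro h
    have hmk : (Ideal.Quotient.mkₐ ℂ (Ideal.span {(X i - X j : MvPolynomial (Fin n) ℂ)})).comp
        (identify i j) = Ideal.Quotient.mkₐ ℂ (Ideal.span {X i - X j}) := by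
      apply MvPolynomial.algHom_ext
      intro k
      by_cases hk : k = j
      · subst hk
        simp only [identify, AlgHom.comp_apply, aeval_X, if_true]
        exact Ideal.Quotient.eq.2 (Ideal.mem_span_singleton_self _)
      · simp [identify, hk]
    have := congrArg (fun f => f p) hmk
    simp only [AlgHom.comp_apply, h, map_zero] at this
    exact Ideal.mem_span_singleton.1 (Ideal.Quotient.eq_zero_iff_mem.1 this.symm)

theorem X_sub_X_ne_zero {n : ℕ} {i j : Fin n} (h : i ≠ j) :
    (X i - X j : MvPolynomial (Fin n) ℂ) ≠ 0 :=
  sub_ne_zero.2 fun h' => h (X_injective h')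

theorem prime_X_sub_X {n : ℕ} {i j : Fin n} (h : i ≠ j) :
    Prime (X i - X j : MvPolynomial (Fin n) ℂ) := by
  refine ⟨X_sub_X_ne_zero h, ?_, ?_⟩
  · intro hu
    have := (X_sub_X_dvd_iff i j 1).1 hu.dvd
    simp at this
  · intro a b hab
    rw [X_sub_X_dvd_iff, map_mul, mul_eq_zero] at hab
    rwa [X_sub_X_dvd_iff, X_sub_X_dvd_iff]

theorem vandPoly_dvd {n : ℕ} (p : MvPolynomial (Fin n) ℂ)
    (hp : ∀ σ : Equiv.Perm (Fin n),
      rename σ p = ((Equiv.Perm.sign σ : ℤ) : MvPolynomial (Fin n) ℂ) * p) :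
    vandPoly n ∣ p := by
  unfold vandPoly
  rw [Finset.prod_sigma']
  apply Finset.prod_dvd_of_isRelPrime
  · rintro ⟨i, j⟩ hij ⟨k, l⟩ hkl hne
    simp only [Finset.coe_sigma, Finset.coe_univ, Set.mem_sigma_iff, Set.mem_univ, true_and,
      Finset.coe_Ioi, Set.mem_Ioi] at hij hkl
    change IsRelPrime (X i - X j : MvPolynomial (Fin n) ℂ) (X k - X l)
    rw [(prime_X_sub_X hij.ne).irreducible.isRelPrime_iff_not_dvd, X_sub_X_dvd_iff]
    simp only [identify, map_sub, aeval_X, sub_eq_zero]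
    intro h
    apply hne
    split_ifs at h with h1 h2 h2
    · omega
    · have := X_injective h
      omega
    · have := X_injective h
      subst this h2
      rfl
    · have := X_injective h
      omega
  · rintro ⟨i, j⟩ hij
    simp only [Finset.mem_sigma, Finset.mem_univ, true_and, Finset.mem_Ioi] at hij
    rw [X_sub_X_dvd_iff]
    have h1 : identify i j (rename (Equiv.swap i j) p) = identify i j p := by
      have : (identify i j).comp (rename (Equiv.swap i j)) = identify i j := by
        apply MvPolynomial.algHom_ext
        intro k
        simp only [identify, AlgHom.comp_apply, rename_X, aeval_X, Equiv.swap_apply_def]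
        split_ifs <;> simp_all
      exact congrArg (fun f => f p) this
    rw [hp, Equiv.Perm.sign_swap hij.ne] at h1
    simp only [Units.val_neg, Units.val_one, Int.cast_neg, Int.cast_one, neg_mul, one_mul,
      map_neg] at h1
    exact self_eq_neg.1 h1.symm

theorem vandPoly_ne_zero (n : ℕ) : vandPoly n ≠ 0 :=
  Finset.prod_ne_zero_iff.2 fun _ _ => Finset.prod_ne_zero_iff.2 fun _ hj =>
    X_sub_X_ne_zero (Finset.mem_Ioi.1 hj).ne

theorem hallLittlewoodFrac_mul_vandPoly {n : ℕ} (t : ℂ) (lam : Fin n → ℕ) :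
    algebraMap _ _ (vandPoly n) * hallLittlewoodFrac t lam =
      algebraMap _ (FractionRing (MvPolynomial (Fin n) ℂ)) (hlNumerator t lam) := by
  have hne : ∀ {i j : Fin n}, i ≠ j →
      algebraMap (MvPolynomial (Fin n) ℂ) (FractionRing (MvPolynomial (Fin n) ℂ)) (X i) -
        algebraMap (MvPolynomial (Fin n) ℂ) (FractionRing (MvPolynomial (Fin n) ℂ)) (X j) ≠ 0 := by
    intro i j h
    rw [← map_sub, Ne, IsFractionRing.to_map_eq_zero_iff]
    exact X_sub_X_ne_zero h
  unfold hallLittlewoodFrac hlNumerator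
  rw [Finset.mul_sum, map_sum]
  refine Finset.sum_congr rfl fun α _ => ?_
  rw [map_mul, mul_left_comm]
  congr 1
  set f : Fin n → Fin n → FractionRing (MvPolynomial (Fin n) ℂ) := fun i j =>
    if α j < α i then
        algebraMap (MvPolynomial (Fin n) ℂ) (FractionRing (MvPolynomial (Fin n) ℂ))
            (X i - C t * X j) /
          algebraMap (MvPolynomial (Fin n) ℂ) (FractionRing (MvPolynomial (Fin n) ℂ)) (X i - X j)
      else 1 with hf
  have h1 : ∏ i, ∏ j, f i j = ∏ i, ∏ j ∈ Finset.Ioi i, f i j * f j i := by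
    rw [Finset.prod_prod_Ioi_mul_eq_prod_prod_off_diag (fun i j => f j i)]
    refine Finset.prod_congr rfl fun i _ => ?_
    rw [Fintype.prod_eq_mul_prod_compl i]
    simp [hf]
  change _ * ∏ i, ∏ j, f i j = _
  rw [h1, vandPoly, map_prod, map_prod, ← Finset.prod_mul_distrib]
  refine Finset.prod_congr rfl fun i _ => ?_
  rw [map_prod, map_prod, ← Finset.prod_mul_distrib]
  refine Finset.prod_congr rfl fun j hj => ?_
  have hij := hne (Finset.mem_Ioi.1 hj).ne
  have hji := hne (Finset.mem_Ioi.1 hj).ne'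
  simp only [hf, hlFactor]
  rcases lt_trichotomy (α i) (α j) with h | h | h
  · simp only [h, h.not_gt, if_true, if_false, map_sub, map_mul]
    field_simp
    ring
  · simp [h]
  · simp only [h, h.not_gt, if_true, if_false, map_sub, map_mul]
    field_simp

/-- The rational function defining `P_λ(x; t)` is a polynomial. -/
theorem exists_hallLittlewood {n : ℕ} (t : ℂ) (lam : Fin n → ℕ) :
    ∃ p : MvPolynomial (Fin n) ℂ, p.IsSymmetric ∧
      algebraMap _ (FractionRing (MvPolynomial (Fin n) ℂ)) p = hallLittlewoodFrac t lam := by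
  obtain ⟨p, hp⟩ := vandPoly_dvd (hlNumerator t lam) (rename_hlNumerator t lam)
  have hV : algebraMap _ (FractionRing (MvPolynomial (Fin n) ℂ)) (vandPoly n) ≠ 0 := by
    rw [Ne, IsFractionRing.to_map_eq_zero_iff]
    exact vandPoly_ne_zero n
  refine ⟨p, fun σ => ?_, ?_⟩
  · have h := congrArg (rename σ) hp
    rw [rename_hlNumerator, map_mul, rename_vandPoly, hp, mul_assoc] at h
    have hs : ((Equiv.Perm.sign σ : ℤ) : MvPolynomial (Fin n) ℂ) ≠ 0 := by
      rcases Int.units_eq_one_or (Equiv.Perm.sign σ) with h' | h' <;> simp [h']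
    exact (mul_left_cancel₀ (vandPoly_ne_zero n) (mul_left_cancel₀ hs h)).symm
  · apply mul_left_cancel₀ hV
    rw [hallLittlewoodFrac_mul_vandPoly, hp, map_mul]

/-- The Hall-Littlewood polynomial `P_λ(x_1, …, x_n; t)`, as an element of the ring of symmetric
polynomials: the polynomial equal to the rational function `hallLittlewoodFrac t λ`. -/
noncomputable def hallLittlewood {n : ℕ} (t : ℂ) (lam : Fin n → ℕ) :
    symmetricSubalgebra (Fin n) ℂ :=
  ⟨(exists_hallLittlewood t lam).choose, (exists_hallLittlewood t lam).choose_spec.1⟩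

theorem hallLittlewood_spec {n : ℕ} (t : ℂ) (lam : Fin n → ℕ) :
    algebraMap _ (FractionRing (MvPolynomial (Fin n) ℂ)) (hallLittlewood t lam).1 =
      hallLittlewoodFrac t lam :=
  (exists_hallLittlewood t lam).choose_spec.2

/-- The `P_λ` of the Schur `P`, `Q` theory: the Hall-Littlewood polynomial at `t = -1`. -/
noncomputable def HLP {n : ℕ} (lam : Fin n → ℕ) : symmetricSubalgebra (Fin n) ℂ :=
  hallLittlewood (-1) lam

/-! ### The involution `ω` -/

/-- The endomorphism `ω` of the ring of symmetric polynomials in `x_1, …, x_n` with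
`ω(E_k) = H_k` for `1 ≤ k ≤ n`. -/
noncomputable def omega (n : ℕ) :
    symmetricSubalgebra (Fin n) ℂ →ₐ[ℂ] symmetricSubalgebra (Fin n) ℂ :=
  (aeval fun i : Fin n =>
    (⟨hsymm (Fin n) ℂ (i + 1),
      (mem_symmetricSubalgebra _).2 (hsymm_isSymmetric _ _ _)⟩ : symmetricSubalgebra (Fin n) ℂ)).comp
    (esymmAlgEquiv (Fin n) ℂ (Fintype.card_fin n)).symm.toAlgHom

theorem omega_esymm {n : ℕ} (i : Fin n) :
    omega n ⟨esymm (Fin n) ℂ (i + 1),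
        (mem_symmetricSubalgebra _).2 (esymm_isSymmetric _ _ _)⟩ =
      ⟨hsymm (Fin n) ℂ (i + 1), (mem_symmetricSubalgebra _).2 (hsymm_isSymmetric _ _ _)⟩ := by
  have h := esymmAlgEquiv_symm_apply (σ := Fin n) (R := ℂ) (Fintype.card_fin n) i
  change aeval _ ((esymmAlgEquiv (Fin n) ℂ (Fintype.card_fin n)).symm _) = _
  exact (congrArg (aeval fun i : Fin n => (⟨hsymm (Fin n) ℂ (i + 1),
    (mem_symmetricSubalgebra _).2 (hsymm_isSymmetric _ _ _)⟩ :
      symmetricSubalgebra (Fin n) ℂ)) h).trans (aeval_X _ i)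

end QPOrth

/-! Everything is a computation with Pfaffians, carried by two devices. The functional `wick` on an
exterior algebra sends v_1 ∧ ⋯ ∧ v_k to Pf(B(v_i, v_j)) (`wick_wedge`), so a Pfaffian can be
expanded multilinearly, permuted up to sign, and split along orthogonal blocks. Schur's Pfaffian
(`listPf_schurT`) evaluates Pf((x_i - x_j)/(x_i + x_j)) as ∏_{i<j} (x_i - x_j)/(x_i + x_j). They
meet in `sum_skewEntry`: if E(s) = ∑ e_a s^a, D(u) = ∑ Q̃_{a,a} u^a, and A(s,t) is the generating
function of the skew matrix of the Q̃_{a,b}, then (s + t) A(s,t) = (s - t) (E(s) E(t) - D(st)).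

Identities 1-3 come from the Cauchy identity ∑ P_λ(x) Q̃_λ(z) = ∏ (1 + z_k x_l) (`cauchy_identity`).
A part a at the point s is a basis vector (a, s). Equal parts at s and t are paired with Q̃_{a,a} (s
- t)/(s + t), which adds the missing D(st), so the vectors ∑_a s^a (a, s) have Gram entries E(s)
E(t) (s - t)/(s + t). Schur's Pfaffian sums over all tuples of parts (`sum_placedPf`). On one tuple,
`wick_block` removes the points from each block of equal parts at the cost of Schur products; what
remains is Q̃_λ times the summand of P_λ (`placedPf_sorted`). At the roots of unity, Ĵ, J^* and
conjugation turn ζ^J into its negatives and inverses, and ω has no effect because H_k = E_k at ζ^J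
for k < 2n (`complete_eq_elem`). Finally ∏ (1 + ζ^{i_k}/ζ^{j_l}) vanishes for I ≠ J, since some
ζ^{i_k} = -ζ^{j_l}, and for I = J it is found by differentiating s^n - (-1)^{n+1}, whose roots are
the squares of the ζ^{j_k} (`prod_one_add_eq`).

For identity 4, ∑_S Pf_x(S) Pf_y(S^c) is one Pfaffian: expand ∏ (u_i + (-1)^i w_i) times a border
that supplies the padding zeros (`sum_powerset_listPf`). Changing basis by a Vandermonde matrix at
the points s_k = -1/x_k, the zeros of E_x, makes the Gram matrix a rescaled Schur matrix, because x
and y have the same squares and hence the same D (`dualForm_dualPoint`). The result contains ∏ (1 +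
y_l/x_k), which vanishes off the diagonal; for x = y it is ∏ x_k ∏_{k<l} (x_k + x_l), which is S_ρ
by the bialternant formula (`eval_schur_rho`). -/

namespace QPOrth

open CliffordAlgebra (contractLeft changeForm)
open ExteriorAlgebra (ι)

/-! ### Pfaffians of lists and the Wick functional -/

section Pfaffian

variable {R : Type*} [CommRing R]

/-- The Pfaffian of the entries `A a b` along a list, by expansion along the first row. -/
def listPf {α : Type*} (A : α → α → R) : List α → R
  | [] => 1
  | a :: l => ∑ j : Fin l.length, (-1) ^ (j : ℕ) * A a l[j] * listPf A (l.eraseIdx j)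
termination_by l => l.length
decreasing_by
  simp only [List.length_cons, List.length_eraseIdx]
  split_ifs <;> omega

theorem listPf_nil {α : Type*} (A : α → α → R) : listPf A [] = 1 := by
  rw [listPf]

theorem listPf_cons {α : Type*} (A : α → α → R) (a : α) (l : List α) :
    listPf A (a :: l) =
      ∑ j : Fin l.length, (-1) ^ (j : ℕ) * A a l[j] * listPf A (l.eraseIdx j) := by
  rw [listPf]

theorem length_eraseIdx_fin {α : Type*} (l : List α) (j : Fin l.length) :
    (l.eraseIdx j).length = l.length - 1 := by
  rw [List.length_eraseIdx_of_lt j.2]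

/-- The first-row expansion deletes an arbitrary entry of the tail, so structural induction is not
enough; this is induction on the length. -/
theorem list_induction_eraseIdx {α : Type*} {P : List α → Prop} (hnil : P [])
    (hcons : ∀ a l, P l → (∀ j : Fin l.length, P (l.eraseIdx j)) → P (a :: l)) :
    ∀ l, P l := by
  suffices h : ∀ k, ∀ l : List α, l.length = k → P l from fun l => h _ l rfl
  intro k
  induction k using Nat.strong_induction_on with
  | _ k ih =>
    rintro (_ | ⟨a, l⟩) hl
    · exact hnil
    · simp only [List.length_cons] at hl
      refine hcons a l (ih _ (by omega) l rfl) fun j => ?_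
      have := j.2
      exact ih (l.length - 1) (by omega) _ (length_eraseIdx_fin l j)

/-- Only entries above the diagonal enter the expansion. No skew-symmetry is assumed, so a matrix
may be replaced by any other that agrees with it there. -/
theorem listPf_congr {α : Type*} {A A' : α → α → R} (l : List α)
    (h : ∀ a b, [a, b].Sublist l → A a b = A' a b) : listPf A l = listPf A' l := by
  induction l using list_induction_eraseIdx with
  | hnil => rw [listPf_nil, listPf_nil]
  | hcons a l _ ih =>
    rw [listPf_cons, listPf_cons]
    refine Finset.sum_congr rfl fun j _ => ?_
    rw [h a l[j], ih j]
    · exact fun b c hbc => h b c ((hbc.trans (List.eraseIdx_sublist l j)).cons a)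
    · exact (List.singleton_sublist.2 (List.getElem_mem _)).cons_cons a

theorem listPf_map {α β : Type*} (A : β → β → R) (f : α → β) (l : List α) :
    listPf A (l.map f) = listPf (fun a b => A (f a) (f b)) l := by
  induction l using list_induction_eraseIdx with
  | hnil => simp [listPf_nil]
  | hcons a l _ ih =>
    rw [List.map_cons, listPf_cons, listPf_cons]
    refine Fintype.sum_equiv (finCongr (by simp)) _ _ fun j => ?_
    have := ih (Fin.cast (by simp) j)
    simp only [finCongr_apply, Fin.val_cast, Fin.getElem_fin] at this ⊢
    rw [← this, List.getElem_map, List.eraseIdx_map]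

theorem prod_map_eraseIdx {α : Type*} (c : α → R) (l : List α) (j : Fin l.length) :
    c l[j] * ((l.eraseIdx j).map c).prod = (l.map c).prod := by
  have h := List.getElem_cons_eraseIdx_perm j.2
  have := (h.map c).prod_eq
  simpa using this

/-- Each index occurs exactly once in every term of a Pfaffian. -/
theorem listPf_scale {α : Type*} (A : α → α → R) (c : α → R) (l : List α) :
    listPf (fun a b => c a * c b * A a b) l = (l.map c).prod * listPf A l := by
  induction l using list_induction_eraseIdx with
  | hnil => simp [listPf_nil]
  | hcons a l _ ih =>
    rw [listPf_cons, listPf_cons, List.map_cons, List.prod_cons, Finset.mul_sum]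
    refine Finset.sum_congr rfl fun j _ => ?_
    rw [ih j, ← prod_map_eraseIdx c l j]
    ring

theorem listPf_odd {α : Type*} (A : α → α → R) (l : List α) (hl : Odd l.length) :
    listPf A l = 0 := by
  induction l using list_induction_eraseIdx with
  | hnil => simp at hl
  | hcons a l _ ih =>
    rw [listPf_cons]
    refine Finset.sum_eq_zero fun j _ => ?_
    have := j.2
    rw [ih j, mul_zero]
    rw [length_eraseIdx_fin]
    rw [List.length_cons] at hl
    rw [Nat.odd_iff] at *
    omega

variable {M : Type*} [AddCommGroup M] [Module R M]

/-- The product `v₁ ∧ ⋯ ∧ v_k` of a list of vectors. -/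
noncomputable def wedge (l : List M) : ExteriorAlgebra R M := (l.map (ι R)).prod

@[simp] theorem wedge_nil : wedge (R := R) ([] : List M) = 1 := rfl

@[simp] theorem wedge_cons (a : M) (l : List M) :
    wedge (R := R) (a :: l) = ι R a * wedge l := by simp [wedge]

theorem wedge_append (l l' : List M) : wedge (R := R) (l ++ l') = wedge l * wedge l' := by
  simp [wedge]

theorem wedge_singleton (a : M) : wedge (R := R) [a] = ι R a := by simp

theorem ι_mul_ι_comm (a b : M) : ι R a * ι R b = -(ι R b * ι R a) :=
  eq_neg_of_add_eq_zero_left (by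
    simp)

theorem ι_mul_wedge (a : M) (l : List M) :
    ι R a * wedge l = (-1) ^ l.length * (wedge l * ι R a) := by
  induction l with
  | nil => simp
  | cons b l ih =>
    rw [wedge_cons, ← mul_assoc, ι_mul_ι_comm, neg_mul, mul_assoc, ih, List.length_cons, pow_succ]
    rw [← mul_assoc (ι R b), ← ((Commute.neg_one_left (ι R b)).pow_left l.length).eq]
    simp [mul_assoc]

theorem wedge_mul_comm (l l' : List M) :
    wedge (R := R) l * wedge l' = (-1) ^ (l.length * l'.length) * (wedge l' * wedge l) := by
  induction l with
  | nil => simp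
  | cons a l ih =>
    rw [wedge_cons, mul_assoc, ih, ← mul_assoc (ι R a),
      ← ((Commute.neg_one_left (ι R a)).pow_left _).eq, mul_assoc, ← mul_assoc (ι R a),
      ι_mul_wedge, List.length_cons, add_mul, one_mul, pow_add]
    simp [mul_assoc]

theorem contractLeft_wedge (d : Module.Dual R M) (l : List M) :
    contractLeft (Q := (0 : QuadraticForm R M)) d (wedge l) =
      ∑ j : Fin l.length, ((-1) ^ (j : ℕ) * d l[j]) • wedge (R := R) (l.eraseIdx j) := by
  induction l with
  | nil => simp
  | cons a l ih =>
    rw [wedge_cons]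
    refine (CliffordAlgebra.contractLeft_ι_mul d a _).trans ?_
    rw [ih]
    simp only [List.length_cons]
    rw [Fin.sum_univ_succ]
    simp only [Fin.val_zero, pow_zero, one_mul, Fin.getElem_fin, List.getElem_cons_zero,
      List.eraseIdx_cons_zero, Fin.val_succ, List.getElem_cons_succ, List.eraseIdx_cons_succ,
      wedge_cons, pow_succ, mul_neg, mul_one, neg_mul, neg_smul, Finset.sum_neg_distrib,
      Finset.mul_sum, mul_smul_comm]
    rw [sub_eq_add_neg]

theorem contractLeft_wedge_mul (d : Module.Dual R M) (l : List M) (z : ExteriorAlgebra R M) :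
    contractLeft (Q := (0 : QuadraticForm R M)) d (wedge l * z) =
      contractLeft (Q := (0 : QuadraticForm R M)) d (wedge l) * z +
        (-1) ^ l.length * (wedge l * contractLeft (Q := (0 : QuadraticForm R M)) d z) := by
  induction l with
  | nil => simp
  | cons a l ih =>
    rw [wedge_cons, mul_assoc]
    refine (CliffordAlgebra.contractLeft_ι_mul d a _).trans ?_
    rw [ih]
    have h2 : contractLeft (Q := (0 : QuadraticForm R M)) d (ι R a * wedge l) =
      d a • wedge l - ι R a * contractLeft (Q := (0 : QuadraticForm R M)) d (wedge l) :=
      CliffordAlgebra.contractLeft_ι_mul d a _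
    rw [h2]
    change d a • (wedge l * z) - ι R a * _ = _
    rw [mul_add, ← mul_assoc (ι R a) ((-1) ^ l.length),
      ← ((Commute.neg_one_left (ι R a)).pow_left l.length).eq, List.length_cons, pow_succ, sub_mul,
      smul_mul_assoc]
    simp only [mul_assoc, mul_neg, neg_mul, one_mul]
    abel

/-- An alternating form does not change the zero quadratic form, so `changeForm` maps the exterior
algebra to itself. The sign is chosen because `changeForm` subtracts the contraction. -/
theorem toQuadraticMap_neg_of_isAlt {B : LinearMap.BilinForm R M} (hB : B.IsAlt) :
    (-B).toQuadraticMap = (0 : QuadraticForm R M) - 0 := by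
  ext x
  simp [LinearMap.BilinMap.toQuadraticMap_apply, hB.self_eq_zero x]

/-- The linear functional on the exterior algebra whose value on `v₁ ∧ ⋯ ∧ v_k` is the Pfaffian
of the matrix `B v_i v_j`. -/
noncomputable def wick {B : LinearMap.BilinForm R M} (hB : B.IsAlt) :
    ExteriorAlgebra R M →ₗ[R] R :=
  ExteriorAlgebra.algebraMapInv.toLinearMap ∘ₗ
    changeForm (Q := (0 : QuadraticForm R M)) (Q' := 0) (toQuadraticMap_neg_of_isAlt hB)

theorem wick_one {B : LinearMap.BilinForm R M} (hB : B.IsAlt) : wick hB 1 = 1 := by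
  have := CliffordAlgebra.changeForm_one (toQuadraticMap_neg_of_isAlt hB)
  change ExteriorAlgebra.algebraMapInv (changeForm _ (1 : CliffordAlgebra _)) = 1
  rw [this]
  exact map_one _

/-- The change of form turns left multiplication by `a` into multiplication by `a` plus contraction
with `B a`, and the constant term only sees the latter. This is the first-row expansion without
coordinates. -/
theorem wick_ι_mul {B : LinearMap.BilinForm R M} (hB : B.IsAlt) (a : M)
    (x : ExteriorAlgebra R M) :
    wick hB (ι R a * x) = wick hB (contractLeft (Q := (0 : QuadraticForm R M)) (B a) x) := by
  have h1 := CliffordAlgebra.changeForm_ι_mul (toQuadraticMap_neg_of_isAlt hB) a x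
  have h2 := CliffordAlgebra.changeForm_contractLeft (toQuadraticMap_neg_of_isAlt hB) (B a) x
  change ExteriorAlgebra.algebraMapInv (changeForm _ (CliffordAlgebra.ι _ a * x)) =
    ExteriorAlgebra.algebraMapInv (changeForm _ (contractLeft (B a) x))
  rw [h1, h2]
  refine (map_sub ExteriorAlgebra.algebraMapInv _ _).trans ?_
  have h3 : ExteriorAlgebra.algebraMapInv (ι R a * changeForm (toQuadraticMap_neg_of_isAlt hB) x)
      = 0 := by
    rw [map_mul]
    simp [ExteriorAlgebra.algebraMapInv]
  refine (congrArg₂ (· - ·) h3 rfl).trans ?_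
  rw [zero_sub, ← map_neg]
  congr 1
  rw [LinearMap.neg_apply, map_neg, LinearMap.neg_apply, neg_neg]

theorem wick_wedge {B : LinearMap.BilinForm R M} (hB : B.IsAlt) (l : List M) :
    wick hB (wedge l) = listPf (fun a b => B a b) l := by
  induction l using list_induction_eraseIdx with
  | hnil => rw [listPf_nil, wedge_nil, wick_one]
  | hcons a l _ ih =>
    rw [wedge_cons, wick_ι_mul, contractLeft_wedge, listPf_cons]
    rw [map_sum]
    refine Finset.sum_congr rfl fun j _ => ?_
    rw [map_smul, ih j, smul_eq_mul]

end Pfaffian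

/-! ### Skew-symmetric forms on free modules -/

section Skew

variable {α : Type*}

/-- The bilinear form on the free module on `α` with entries `A a b`. -/
noncomputable def freeForm (A : α → α → ℂ) : LinearMap.BilinForm ℂ (α →₀ ℂ) :=
  Finsupp.linearCombination ℂ fun a => Finsupp.linearCombination ℂ (A a)

theorem freeForm_single (A : α → α → ℂ) (a b : α) :
    freeForm A (Finsupp.single a 1) (Finsupp.single b 1) = A a b := by
  simp [freeForm]

theorem freeForm_isAlt {A : α → α → ℂ} (hA : ∀ a b, A a b = -A b a) : (freeForm A).IsAlt := by
  have h : ∀ x y, freeForm A x y = -freeForm A y x := by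
    have : freeForm A = -(freeForm A).flip := by
      ext a b
      simp [freeForm, hA a b]
    intro x y
    conv_lhs => rw [this]
    simp
  intro x
  exact self_eq_neg.1 (h x x)

theorem wick_freeForm {A : α → α → ℂ} (hA : ∀ a b, A a b = -A b a) (l : List α) :
    wick (freeForm_isAlt hA) (wedge (l.map fun a => Finsupp.single a 1)) = listPf A l := by
  rw [wick_wedge, listPf_map]
  simp only [freeForm_single]

end Skew

end QPOrth

namespace QPOrth

open CliffordAlgebra (contractLeft changeForm)
open ExteriorAlgebra (ι)

/-! ### Schur's Pfaffian -/

section Schur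

/-- `∏_{i<j} T x_i x_j` along a list. -/
def pairProd {X : Type*} (T : X → X → ℂ) : List X → ℂ
  | [] => 1
  | x :: l => (l.map (T x)).prod * pairProd T l

/-- The first-row expansion of the Pfaffian of `T` on every sublist of `xs` is solved
by `pairProd T`. -/
def SchurList {X : Type*} (T : X → X → ℂ) (xs : List X) : Prop :=
  ∀ x l, (x :: l).Sublist xs →
    pairProd T (x :: l) =
      ∑ j : Fin l.length, (-1) ^ (j : ℕ) * T x l[j] * pairProd T (l.eraseIdx j) +
        if Even l.length then pairProd T l else 0

theorem SchurList.sublist {X : Type*} {T : X → X → ℂ} {xs ys : List X} (h : SchurList T xs)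
    (hs : ys.Sublist xs) : SchurList T ys :=
  fun x l hl => h x l (hl.trans hs)

/-- `(s - t) / (s + t)`. -/
noncomputable def schurT (s t : ℂ) : ℂ := (s - t) / (s + t)

theorem schurT_skew (s t : ℂ) : schurT s t = -schurT t s := by
  rw [schurT, schurT, add_comm t s, ← neg_div, neg_sub]

/-- Moving the `j`-th entry to the front reverses the `j` factors it forms with its predecessors. -/
theorem pairProd_eraseIdx {X : Type*} {T : X → X → ℂ} (hT : ∀ x y, T x y = -T y x) (l : List X)
    (j : Fin l.length) :
    (-1) ^ (j : ℕ) * pairProd T l = ((l.eraseIdx j).map (T l[j])).prod * pairProd T (l.eraseIdx j) := by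
  induction l with
  | nil => exact j.elim0
  | cons y l ih =>
    refine Fin.cases ?_ (fun i => ?_) j
    · simp [pairProd]
    · have := ih i
      simp only [Fin.val_succ, Fin.getElem_fin, List.getElem_cons_succ, List.eraseIdx_cons_succ,
        List.map_cons, List.prod_cons, pairProd] at this ⊢
      have h2 := prod_map_eraseIdx (T y) l i
      rw [Fin.getElem_fin] at h2
      rw [← h2, hT l[(i : ℕ)] y, pow_succ]
      linear_combination (-T y l[(i : ℕ)] * ((l.eraseIdx i).map (T y)).prod) * this

/-- Both products on the left are monic of degree `S.card`, so their difference is recovered by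
Lagrange interpolation at the nodes `-y`, where the second product vanishes. -/
theorem schur_partial_fraction (S : Finset ℂ) (z : ℂ) :
    ∏ k ∈ S, (z - k) - ∏ k ∈ S, (z + k) =
      ∑ y ∈ S, -2 * y * (∏ k ∈ S.erase y, (y + k) / (y - k)) * ∏ k ∈ S.erase y, (z + k) := by
  classical
  set p : Polynomial ℂ := ∏ k ∈ S, (Polynomial.X - Polynomial.C k) with hp
  set q : Polynomial ℂ := ∏ k ∈ S, (Polynomial.X - Polynomial.C (-k)) with hq
  have hpm : p.Monic := Polynomial.monic_prod_X_sub_C _ _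
  have hqm : q.Monic := Polynomial.monic_prod_X_sub_C _ _
  have hpd : p.natDegree = S.card := by
    rw [hp, Polynomial.natDegree_prod_of_monic _ _ fun k _ => Polynomial.monic_X_sub_C k]; simp
  have hqd : q.natDegree = S.card := by
    rw [hq, Polynomial.natDegree_prod_of_monic _ _ fun k _ => Polynomial.monic_X_sub_C (-k)]; simp
  have hdeg : (p - q).degree < S.card := by
    have := Polynomial.degree_sub_lt_left (p := p) (q := q) (by
      rw [Polynomial.degree_eq_natDegree hpm.ne_zero, Polynomial.degree_eq_natDegree hqm.ne_zero,
        hpd, hqd]) hpm.ne_zero (by rw [hpm.leadingCoeff, hqm.leadingCoeff])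
    rwa [Polynomial.degree_eq_natDegree hpm.ne_zero, hpd] at this
  have hint := Lagrange.eq_interpolate (s := S) (v := fun y : ℂ => -y)
    (fun a _ b _ h => neg_injective h) hdeg
  have he := congrArg (Polynomial.eval z) hint
  simp only [Lagrange.interpolate_apply, Lagrange.basis, Lagrange.basisDivisor,
    Polynomial.eval_finsetSum, Polynomial.eval_mul, Polynomial.eval_prod, Polynomial.eval_sub,
    Polynomial.eval_C, Polynomial.eval_X, hp, hq, sub_neg_eq_add] at he
  rw [he]
  refine Finset.sum_congr rfl fun y hy => ?_
  have h0 : ∏ k ∈ S, (-y + k) = 0 := Finset.prod_eq_zero hy (by ring)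
  rw [h0, sub_zero, Finset.prod_mul_distrib, ← Finset.mul_prod_erase S _ hy, ← mul_assoc,
    mul_assoc (-y - y), ← Finset.prod_mul_distrib]
  congr 2
  · ring
  · refine Finset.prod_congr rfl fun k _ => ?_
    rw [div_eq_mul_inv, show -y + k = -(y - k) by ring, inv_neg]
    ring

/-- This is `schur_partial_fraction` at `z = 0`, divided by `-2 ∏ k`. -/
theorem sum_schur_coeff (S : Finset ℂ) (h0 : ∀ y ∈ S, y ≠ 0) :
    ∑ y ∈ S, ∏ k ∈ S.erase y, (y + k) / (y - k) = if Even S.card then 0 else 1 := by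
  have h := schur_partial_fraction S 0
  have hP : ∏ k ∈ S, k ≠ 0 := Finset.prod_ne_zero_iff.2 h0
  have h1 : ∑ y ∈ S, -2 * y * (∏ k ∈ S.erase y, (y + k) / (y - k)) * ∏ k ∈ S.erase y, (0 + k) =
      -2 * (∏ k ∈ S, k) * ∑ y ∈ S, ∏ k ∈ S.erase y, (y + k) / (y - k) := by
    rw [Finset.mul_sum]
    refine Finset.sum_congr rfl fun y hy => ?_
    rw [← Finset.mul_prod_erase S _ hy]
    simp only [zero_add]
    ring
  rw [h1] at h
  have h2 : ∏ k ∈ S, -k = (-1) ^ S.card * ∏ k ∈ S, k := by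
    rw [← Finset.prod_const, ← Finset.prod_mul_distrib]
    simp
  simp only [zero_sub, zero_add] at h
  rw [h2] at h
  apply mul_left_cancel₀ (mul_ne_zero (show (-2 : ℂ) ≠ 0 by norm_num) hP)
  rw [← h]
  split_ifs with he
  · rw [he.neg_one_pow]; ring
  · rw [(Nat.not_even_iff_odd.1 he).neg_one_pow]; ring

/-- Dividing the partial fraction by ∏ (x + k) produces the terms -2y/(x + y) = `schurT x y - 1`;
the constants that this splits off are collected by `sum_schur_coeff` and leave the parity term. -/
theorem schur_expansion (S : Finset ℂ) (h0 : ∀ y ∈ S, y ≠ 0) (x : ℂ)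
    (hx : ∀ y ∈ S, x + y ≠ 0) :
    ∏ k ∈ S, schurT x k = ∑ y ∈ S, (∏ k ∈ S.erase y, (y + k) / (y - k)) * schurT x y +
      if Even S.card then 1 else 0 := by
  have h := schur_partial_fraction S x
  have hP : ∏ k ∈ S, (x + k) ≠ 0 := Finset.prod_ne_zero_iff.2 hx
  have h1 : ∏ k ∈ S, schurT x k = 1 +
      ∑ y ∈ S, (∏ k ∈ S.erase y, (y + k) / (y - k)) * (schurT x y - 1) := by
    simp only [schurT]
    rw [Finset.prod_div_distrib, div_eq_iff hP, add_mul, one_mul, ← sub_eq_iff_eq_add', h, Finset.sum_mul]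
    refine Finset.sum_congr rfl fun y hy => ?_
    rw [← Finset.mul_prod_erase S (fun k => x + k) hy]
    have := hx y hy
    generalize (∏ k ∈ S.erase y, (y + k) / (y - k)) = c
    field_simp
    ring
  rw [h1]
  simp only [mul_sub, mul_one, Finset.sum_sub_distrib]
  rw [sum_schur_coeff S h0]
  split_ifs <;> ring

/-- The coefficient of `schurT x y` in `schur_expansion` is the inverse of the factors of `pairProd
schurT l` that involve `y`. By `pairProd_eraseIdx`, multiplying by it deletes `y` with the sign of
the Pfaffian expansion. -/
theorem schurList_schurT {xs : List ℂ} (hnd : xs.Nodup) (h0 : ∀ x ∈ xs, x ≠ 0)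
    (hs : ∀ x ∈ xs, ∀ y ∈ xs, x + y ≠ 0) : SchurList schurT xs := by
  classical
  intro x l hl
  have hmem : ∀ y ∈ x :: l, y ∈ xs := fun y hy => hl.subset hy
  have hnd' := hnd.sublist hl
  rw [List.nodup_cons] at hnd'
  have hcard : l.toFinset.card = l.length := List.toFinset_card_of_nodup hnd'.2
  have hexp := schur_expansion l.toFinset (fun y hy => h0 y (hmem y (by simp_all))) x
    (fun y hy => hs x (hmem x (by simp)) y (hmem y (by simp_all)))
  rw [hcard, List.prod_toFinset _ hnd'.2, List.sum_toFinset _ hnd'.2] at hexp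
  rw [pairProd, hexp, add_mul, ← List.ofFn_getElem_eq_map, List.sum_ofFn, Finset.sum_mul]
  congr 1
  · refine Finset.sum_congr rfl fun j _ => ?_
    have hp := pairProd_eraseIdx schurT_skew l j
    have he : l.toFinset.erase l[j] = (l.eraseIdx j).toFinset := by
      ext y
      rw [← List.Nodup.erase_getElem hnd'.2 j j.2, Finset.mem_erase, List.mem_toFinset,
        List.mem_toFinset, hnd'.2.mem_erase_iff]
      rfl
    have hnd2 : (l.eraseIdx j).Nodup := hnd'.2.sublist (List.eraseIdx_sublist l j)
    have hnot : l[j] ∉ l.eraseIdx j := by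
      rw [← List.Nodup.erase_getElem hnd'.2 j j.2]
      exact hnd'.2.not_mem_erase
    have hinv : (∏ k ∈ l.toFinset.erase l[j], (l[j] + k) / (l[j] - k)) *
        ((l.eraseIdx j).map (schurT l[j])).prod = 1 := by
      rw [he, ← List.prod_toFinset _ hnd2, ← Finset.prod_mul_distrib]
      refine Finset.prod_eq_one fun k hk => ?_
      rw [List.mem_toFinset] at hk
      have h1 : l[j] - k ≠ 0 := sub_ne_zero.2 fun h => hnot (h ▸ hk)
      have h2 : l[j] + k ≠ 0 := hs _ (hmem _ (by simp)) _
        (hmem _ (List.mem_cons_of_mem _ ((List.eraseIdx_sublist l j).subset hk)))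
      rw [schurT]
      field_simp
    have hsq : ((-1 : ℂ) ^ (j : ℕ)) * (-1) ^ (j : ℕ) = 1 := by
      rw [← mul_pow]; simp
    change (∏ k ∈ l.toFinset.erase l[j], (l[j] + k) / (l[j] - k)) * schurT x l[j] * _ = _
    linear_combination ((-1 : ℂ) ^ (j : ℕ) * schurT x l[j] * pairProd schurT (l.eraseIdx j)) * hinv +
      (-(∏ k ∈ l.toFinset.erase l[j], (l[j] + k) / (l[j] - k)) * schurT x l[j] *
        pairProd schurT l) * hsq + ((∏ k ∈ l.toFinset.erase l[j], (l[j] + k) / (l[j] - k)) *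
        schurT x l[j] * (-1 : ℂ) ^ (j : ℕ)) * hp
  · split_ifs <;> simp

end Schur

/-! ### Blocks of equal parts -/

section Block

variable {M : Type*} [AddCommGroup M] [Module ℂ M]

/-- Lets the induction in `wick_block` be applied to a contraction of `z` as well as to `z`. -/
theorem contractLeft_mul_mem_adjoin (d : Module.Dual ℂ M) (N : Set M) {z : ExteriorAlgebra ℂ M}
    (hz : z ∈ Submodule.span ℂ (wedge '' {l : List M | ∀ w ∈ l, w ∈ N})) :
    contractLeft (Q := (0 : QuadraticForm ℂ M)) d z ∈
      Submodule.span ℂ (wedge '' {l : List M | ∀ w ∈ l, w ∈ N}) := by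
  induction hz using Submodule.span_induction with
  | mem z hz =>
    obtain ⟨l, hl, rfl⟩ := hz
    rw [contractLeft_wedge]
    refine Submodule.sum_mem _ fun j _ => Submodule.smul_mem _ _ (Submodule.subset_span ?_)
    exact ⟨_, fun w hw => hl w ((List.eraseIdx_sublist l j).subset hw), rfl⟩
  | zero => rw [map_zero]; exact Submodule.zero_mem _
  | add x y _ _ hx hy => rw [map_add]; exact Submodule.add_mem _ hx hy
  | smul a x _ hx => rw [map_smul]; exact Submodule.smul_mem _ _ hx

theorem contractLeft_congr_of_mem {d d' : Module.Dual ℂ M} {N : Set M} (hd : ∀ w ∈ N, d w = d' w)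
    {z : ExteriorAlgebra ℂ M}
    (hz : z ∈ Submodule.span ℂ (wedge '' {l : List M | ∀ w ∈ l, w ∈ N})) :
    contractLeft (Q := (0 : QuadraticForm ℂ M)) d z =
      contractLeft (Q := (0 : QuadraticForm ℂ M)) d' z := by
  induction hz using Submodule.span_induction with
  | mem z hz =>
    obtain ⟨l, hl, rfl⟩ := hz
    rw [contractLeft_wedge, contractLeft_wedge]
    refine Finset.sum_congr rfl fun j _ => ?_
    have := hd l[j] (hl _ (List.getElem_mem _))
    rw [this]
  | zero => simp
  | add x y _ _ hx hy => rw [map_add, map_add, hx, hy]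
  | smul a x _ hx => rw [map_smul, map_smul, hx]

/-- The Wick functional on a block of vectors that pair in the same way with everything else. -/
theorem wick_block {X : Type*} {T : X → X → ℂ} {B : LinearMap.BilinForm ℂ M} (hB : B.IsAlt)
    (q : ℂ) (f : X → M) (p : M) (N : Set M) (xs : List X) (hxs : SchurList T xs)
    (hq : ∀ x ∈ xs, ∀ y ∈ xs, [x, y].Sublist xs → B (f x) (f y) = q * T x y)
    (hN : ∀ x ∈ xs, ∀ w ∈ N, B (f x) w = B p w) (z : ExteriorAlgebra ℂ M)
    (hz : z ∈ Submodule.span ℂ (wedge '' {l : List M | ∀ w ∈ l, w ∈ N})) :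
    wick hB (wedge (xs.map f) * z) =
      q ^ (xs.length / 2) * pairProd T xs *
        if Even xs.length then wick hB z else wick hB (ι ℂ p * z) := by
  induction xs using list_induction_eraseIdx generalizing z with
  | hnil => simp [pairProd]
  | hcons x l ihl ih =>
    have hl : SchurList T l := hxs.sublist (List.sublist_cons_self x l)
    have ihl := ihl hl
      (fun a ha b hb hab => hq a (by simp [ha]) b (by simp [hb]) (hab.cons x))
      (fun a ha => hN a (by simp [ha]))
    have ih := fun j => ih j (hl.sublist (List.eraseIdx_sublist l j))
      (fun a ha b hb hab => hq a (List.mem_cons_of_mem _ ((List.eraseIdx_sublist l j).subset ha)) b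
        (List.mem_cons_of_mem _ ((List.eraseIdx_sublist l j).subset hb))
        ((hab.trans (List.eraseIdx_sublist l j)).cons x))
      (fun a ha => hN a (List.mem_cons_of_mem _ ((List.eraseIdx_sublist l j).subset ha)))
    have hdz := contractLeft_mul_mem_adjoin (B p) N hz
    -- Contraction with the first vector of the block meets either the rest of the block, where the
    -- entries are `q * T`, or `z`, where it acts like contraction with `p`.
    rw [List.map_cons, wedge_cons, mul_assoc, wick_ι_mul, contractLeft_wedge_mul, map_add,
      contractLeft_congr_of_mem (hN x (by simp)) hz, contractLeft_wedge]
    have h1 : wick hB ((∑ j : Fin (l.map f).length, ((-1) ^ (j : ℕ) * B (f x) (l.map f)[j]) •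
        wedge (R := ℂ) ((l.map f).eraseIdx j)) * z) =
        ∑ j : Fin l.length, (-1) ^ (j : ℕ) * (q * T x l[j]) *
          wick hB (wedge ((l.eraseIdx j).map f) * z) := by
      rw [Finset.sum_mul, map_sum]
      refine Fintype.sum_equiv (finCongr (by simp)) _ _ fun j => ?_
      simp only [smul_mul_assoc, map_smul, smul_eq_mul, finCongr_apply, Fin.val_cast,
        Fin.getElem_fin, List.getElem_map, List.eraseIdx_map]
      rw [hq x (by simp) _ (List.mem_cons_of_mem _ (List.getElem_mem _))
        (List.cons_sublist_cons.2 (List.singleton_sublist.2 (List.getElem_mem _)))]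
    rw [h1, hxs x l (List.Sublist.refl _)]
    have h2 : wick hB ((-1) ^ (l.map f).length *
        (wedge (l.map f) * contractLeft (Q := (0 : QuadraticForm ℂ M)) (B p) z)) =
        (-1) ^ l.length *
          wick hB (wedge (l.map f) * contractLeft (Q := (0 : QuadraticForm ℂ M)) (B p) z) := by
      rw [List.length_map]
      rcases Nat.even_or_odd l.length with h | h <;> simp [h.neg_one_pow]
    rw [h2, ihl _ hdz, ← wick_ι_mul]
    simp only [ih _ z hz, length_eraseIdx_fin]
    rcases Nat.even_or_odd l.length with h | h
    · have hodd : ¬ Even (l.length + 1) := by simpa [Nat.even_add_one] using h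
      have hd : (l.length + 1) / 2 = l.length / 2 := by
        obtain ⟨k, hk⟩ := h; omega
      simp only [List.length_cons, if_pos h, if_neg hodd, h.neg_one_pow, hd]
      rw [mul_add, add_mul, Finset.mul_sum, Finset.sum_mul]
      congr 1
      · refine Finset.sum_congr rfl fun j _ => ?_
        have hj := j.2
        have h3 : ¬ Even (l.length - 1) := by
          obtain ⟨k, hk⟩ := h
          rw [Nat.not_even_iff_odd]
          exact ⟨k - 1, by omega⟩
        have h4 : l.length / 2 = (l.length - 1) / 2 + 1 := by
          obtain ⟨k, hk⟩ := h; omega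
        rw [if_neg h3, h4, pow_succ]
        ring
      · ring
    · have hev : Even (l.length + 1) := by simpa [Nat.even_add_one] using h
      have hne : ¬ Even l.length := Nat.not_even_iff_odd.2 h
      have hd : (l.length + 1) / 2 = (l.length - 1) / 2 + 1 := by
        obtain ⟨k, hk⟩ := h; omega
      -- Contracting twice with the same functional gives zero, so for an odd tail the second kind
      -- of term disappears.
      have h5 : wick hB (ι ℂ p * contractLeft (Q := (0 : QuadraticForm ℂ M)) (B p) z) = 0 := by
        rw [wick_ι_mul]
        have := CliffordAlgebra.contractLeft_contractLeft (Q := (0 : QuadraticForm ℂ M)) (B p) z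
        rw [this, map_zero]
      simp only [List.length_cons, if_pos hev, if_neg hne, h5, hd]
      rw [mul_zero, mul_zero, add_zero, add_zero, Finset.mul_sum, Finset.sum_mul]
      refine Finset.sum_congr rfl fun j _ => ?_
      have h3 : Even (l.length - 1) := by
        obtain ⟨k, hk⟩ := h
        exact ⟨k, by omega⟩
      rw [if_pos h3, pow_succ]
      ring

end Block

end QPOrth

namespace QPOrth

open MvPolynomial
open CliffordAlgebra (contractLeft changeForm)
open ExteriorAlgebra (ι)

/-! ### The entries `Q̃_{a,b}` and their generating function -/

section Entries

/-- `e_a e_b + 2 ∑_{k=1}^b (-1)^k e_{a+k} e_{b-k}` for a sequence `e`. -/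
def qEntry (e : ℕ → ℂ) (a b : ℕ) : ℂ :=
  e a * e b + 2 * ∑ k ∈ Finset.Icc 1 b, (-1) ^ k * (e (a + k) * e (b - k))

theorem qEntry_zero (e : ℕ → ℂ) (a : ℕ) : qEntry e a 0 = e a * e 0 := by
  simp [qEntry]

/-- After a shift of the index by one, the two alternating sums cancel apart from the first term of
one of them. -/
theorem qEntry_succ (e : ℕ → ℂ) (a b : ℕ) :
    qEntry e a (b + 1) + qEntry e (a + 1) b = e a * e (b + 1) - e (a + 1) * e b := by
  have h : ∑ k ∈ Finset.Icc 1 (b + 1), (-1 : ℂ) ^ k * (e (a + k) * e (b + 1 - k)) =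
      -(e (a + 1) * e b) - ∑ k ∈ Finset.Icc 1 b, (-1) ^ k * (e (a + 1 + k) * e (b - k)) := by
    rw [← Finset.add_sum_Ioc_eq_sum_Icc (by omega : 1 ≤ b + 1), sub_eq_add_neg,
      ← Finset.sum_neg_distrib]
    congr 1
    · simp
    · rw [show Finset.Ioc 1 (b + 1) = (Finset.Icc 1 b).map (addRightEmbedding 1) by
        ext k
        simp [Finset.mem_Ioc]
        omega]
      rw [Finset.sum_map]
      refine Finset.sum_congr rfl fun k _ => ?_
      simp only [addRightEmbedding_apply, Nat.add_sub_add_right, pow_succ]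
      rw [show a + (k + 1) = a + 1 + k by omega]
      ring
  simp only [qEntry, h]
  ring

theorem qEntry_eq_zero {e : ℕ → ℂ} {n : ℕ} (he : ∀ k, n < k → e k = 0) {a : ℕ} (ha : n < a)
    (b : ℕ) : qEntry e a b = 0 := by
  rw [qEntry, he a ha, Finset.sum_eq_zero]
  · simp
  · intro k _
    rw [he (a + k) (by omega)]
    simp

/-- The skew-symmetric matrix with entries `Q̃_{a,b}` for `a > b`. -/
def skewEntry (e : ℕ → ℂ) (a b : ℕ) : ℂ :=
  if b < a then qEntry e a b else if a < b then -qEntry e b a else 0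

theorem skewEntry_skew (e : ℕ → ℂ) (a b : ℕ) : skewEntry e a b = -skewEntry e b a := by
  unfold skewEntry
  split_ifs <;> first | omega | simp

theorem sum_shift (N : ℕ) (s : ℂ) (f : ℕ → ℂ) :
    ∑ a ∈ Finset.range (N + 1), s ^ a * (if a = 0 then 0 else f (a - 1)) =
      s * ∑ a ∈ Finset.range N, s ^ a * f a := by
  rw [Finset.sum_range_succ', Finset.mul_sum]
  simp only [Nat.add_sub_cancel, Nat.succ_ne_zero, if_false, if_true, mul_zero, add_zero, pow_succ]
  exact Finset.sum_congr rfl fun a _ => by ring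

/-- The recursion `qEntry_succ` in generating-function form. With `Y` the diagonal part, the arrays
`U` = skew + `Y` - ee and `V` = skew - `Y` + ee satisfy U(a-1, b) + V(a, b-1) = 0, so s ∑U + t ∑V =
0. -/
theorem sum_skewEntry {e : ℕ → ℂ} {n : ℕ} (he : ∀ k, n < k → e k = 0) (s t : ℂ) :
    (s + t) * ∑ a ∈ Finset.range (n + 1), ∑ b ∈ Finset.range (n + 1),
        s ^ a * t ^ b * skewEntry e a b +
      (s - t) * ∑ a ∈ Finset.range (n + 1), (s * t) ^ a * qEntry e a a =
    (s - t) * ((∑ a ∈ Finset.range (n + 1), e a * s ^ a) *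
      ∑ a ∈ Finset.range (n + 1), e a * t ^ a) := by
  set Y : ℕ → ℕ → ℂ := fun a b => if a = b then qEntry e a a else 0 with hY
  set U : ℕ → ℕ → ℂ := fun a b => skewEntry e a b + Y a b - e a * e b with hU
  set V : ℕ → ℕ → ℂ := fun a b => skewEntry e a b - Y a b + e a * e b with hV
  -- Vanishing just outside the range is what lets the shifted sums be cut off at `n` without
  -- boundary terms.
  have hU0 : ∀ a, U a (n + 1) = 0 := by
    intro a
    simp only [hU, hY, skewEntry, he (n + 1) (by omega)]
    split_ifs with h1 h2 h2 h3 <;> first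
      | omega
      | simp [qEntry_eq_zero he (show n < a by omega)]
      | simp [qEntry_eq_zero he (show n < n + 1 by omega)]
  have hV0 : ∀ b, V (n + 1) b = 0 := by
    intro b
    simp only [hV, hY, skewEntry, he (n + 1) (by omega)]
    split_ifs with h1 h2 h2 h3 <;> first
      | omega
      | simp [qEntry_eq_zero he (show n < b by omega),
          qEntry_eq_zero he (show n < n + 1 by omega)]
      | simp [qEntry_eq_zero he (show n < n + 1 by omega)]
  have key : ∀ a b, (if a = 0 then 0 else U (a - 1) b) + (if b = 0 then 0 else V a (b - 1)) = 0 := by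
    rintro (_ | a) (_ | b)
    · simp
    · simp only [if_true, Nat.succ_ne_zero, if_false, Nat.add_sub_cancel, hV, hY, skewEntry]
      rcases Nat.eq_zero_or_pos b with rfl | h
      · simp [qEntry_zero]
      · simp [h, h.ne, qEntry_zero, mul_comm]
    · simp only [if_true, Nat.succ_ne_zero, if_false, Nat.add_sub_cancel, hU, hY, skewEntry]
      rcases Nat.eq_zero_or_pos a with rfl | h
      · simp [qEntry_zero]
      · simp [h, h.ne', qEntry_zero]
    · simp only [Nat.succ_ne_zero, if_false, Nat.add_sub_cancel, hU, hV, hY, skewEntry]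
      have h1 := qEntry_succ e a b
      have h2 := qEntry_succ e b a
      rcases lt_trichotomy a b with h | rfl | h
      · rcases Nat.lt_or_ge (a + 1) b with h' | h'
        · simp [show ¬ (b + 1 < a) by omega, show a < b + 1 by omega, show a ≠ b + 1 by omega,
            show ¬ (b < a + 1) by omega, h', h'.ne]
          linear_combination -h2
        · obtain rfl : b = a + 1 := by omega
          simp [show ¬ (a + 1 + 1 < a) by omega, show a < a + 1 + 1 by omega,
            show a ≠ a + 1 + 1 by omega]
          linear_combination -h2
      · simp [show ¬ (a + 1 < a) by omega]
        ring
      · rcases Nat.lt_or_ge (b + 1) a with h' | h'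
        · simp [h', h'.ne', show b < a + 1 by omega, show a + 1 ≠ b by omega]
          linear_combination h1
        · obtain rfl : a = b + 1 := by omega
          simp [show b < b + 1 + 1 by omega, show b + 1 + 1 ≠ b by omega]
          linear_combination h1
  have hsU : ∑ a ∈ Finset.range (n + 1 + 1), ∑ b ∈ Finset.range (n + 1 + 1),
      s ^ a * t ^ b * (if a = 0 then 0 else U (a - 1) b) =
      s * ∑ a ∈ Finset.range (n + 1), ∑ b ∈ Finset.range (n + 1), s ^ a * t ^ b * U a b := by
    have h := sum_shift (n + 1) s fun a => ∑ b ∈ Finset.range (n + 1), t ^ b * U a b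
    simp only [Finset.mul_sum, ← mul_assoc] at h ⊢
    rw [← h]
    refine Finset.sum_congr rfl fun a _ => ?_
    rw [Finset.sum_range_succ, hU0]
    split_ifs
    · simp
    · simp [Finset.mul_sum, mul_assoc]
  have hsV : ∑ a ∈ Finset.range (n + 1 + 1), ∑ b ∈ Finset.range (n + 1 + 1),
      s ^ a * t ^ b * (if b = 0 then 0 else V a (b - 1)) =
      t * ∑ a ∈ Finset.range (n + 1), ∑ b ∈ Finset.range (n + 1), s ^ a * t ^ b * V a b := by
    rw [Finset.sum_range_succ, Finset.mul_sum]
    have h0 : ∑ b ∈ Finset.range (n + 1 + 1), s ^ (n + 1) * t ^ b *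
        (if b = 0 then 0 else V (n + 1) (b - 1)) = 0 :=
      Finset.sum_eq_zero fun b _ => by rw [hV0]; simp
    rw [h0, add_zero]
    refine Finset.sum_congr rfl fun a _ => ?_
    have h := sum_shift (n + 1) t fun b => V a b
    simp only [mul_assoc]
    rw [← Finset.mul_sum, h, ← Finset.mul_sum]
    ring
  have hsum : s * (∑ a ∈ Finset.range (n + 1), ∑ b ∈ Finset.range (n + 1), s ^ a * t ^ b * U a b) +
      t * (∑ a ∈ Finset.range (n + 1), ∑ b ∈ Finset.range (n + 1), s ^ a * t ^ b * V a b) = 0 := by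
    rw [← hsU, ← hsV, ← Finset.sum_add_distrib]
    refine Finset.sum_eq_zero fun a _ => ?_
    rw [← Finset.sum_add_distrib]
    refine Finset.sum_eq_zero fun b _ => ?_
    rw [← mul_add, key, mul_zero]
  have hYs : ∑ a ∈ Finset.range (n + 1), ∑ b ∈ Finset.range (n + 1), s ^ a * t ^ b * Y a b =
      ∑ a ∈ Finset.range (n + 1), (s * t) ^ a * qEntry e a a := by
    refine Finset.sum_congr rfl fun a ha => ?_
    simp only [hY, mul_ite, mul_zero]
    rw [Finset.sum_ite_eq, if_pos ha, mul_pow]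
  have hE : ∑ a ∈ Finset.range (n + 1), ∑ b ∈ Finset.range (n + 1), s ^ a * t ^ b * (e a * e b) =
      (∑ a ∈ Finset.range (n + 1), e a * s ^ a) * ∑ a ∈ Finset.range (n + 1), e a * t ^ a := by
    rw [Finset.sum_mul_sum]
    exact Finset.sum_congr rfl fun a _ => Finset.sum_congr rfl fun b _ => by ring
  simp only [hU, hV, mul_add, mul_sub, Finset.sum_add_distrib, Finset.sum_sub_distrib] at hsum
  rw [hYs, hE] at hsum
  linear_combination hsum

/-- Setting `t = -s` in `sum_skewEntry` removes the skew part. Hence the diagonal entries depend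
only on E(s)E(-s), that is, on the squares of the variables. -/
theorem sum_qEntry_diag {e : ℕ → ℂ} {n : ℕ} (he : ∀ k, n < k → e k = 0) (s : ℂ) :
    ∑ a ∈ Finset.range (n + 1), (-(s * s)) ^ a * qEntry e a a =
      (∑ a ∈ Finset.range (n + 1), e a * s ^ a) *
        ∑ a ∈ Finset.range (n + 1), e a * (-s) ^ a := by
  rcases eq_or_ne s 0 with rfl | hs
  · simp [Finset.sum_range_succ', qEntry_zero]
  · have h := sum_skewEntry he s (-s)
    rw [add_neg_cancel, zero_mul, zero_add, sub_neg_eq_add, mul_neg] at h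
    exact mul_left_cancel₀ (by simpa [← two_mul] using hs) h

/-- The elementary symmetric polynomials at a point. -/
noncomputable def elem {n : ℕ} (z : Fin n → ℂ) (k : ℕ) : ℂ := eval z (esymm (Fin n) ℂ k)

theorem elem_eq_sum {n : ℕ} (z : Fin n → ℂ) (k : ℕ) :
    elem z k = ∑ t ∈ Finset.powersetCard k Finset.univ, ∏ i ∈ t, z i := by
  simp [elem, esymm]

theorem elem_zero {n : ℕ} (z : Fin n → ℂ) : elem z 0 = 1 := by
  simp [elem]

theorem elem_of_lt {n : ℕ} (z : Fin n → ℂ) (k : ℕ) (hk : n < k) : elem z k = 0 := by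
  rw [elem_eq_sum, Finset.powersetCard_eq_empty.2 (by simpa using hk), Finset.sum_empty]

theorem sum_elem {n : ℕ} (z : Fin n → ℂ) (s : ℂ) :
    ∑ a ∈ Finset.range (n + 1), elem z a * s ^ a = ∏ i, (1 + z i * s) := by
  rw [Finset.prod_one_add, Finset.sum_powerset]
  simp only [Finset.card_univ, Fintype.card_fin]
  refine Finset.sum_congr rfl fun a _ => ?_
  rw [elem_eq_sum, Finset.sum_mul]
  refine Finset.sum_congr rfl fun t ht => ?_
  rw [Finset.prod_mul_distrib, Finset.prod_const, (Finset.mem_powersetCard.1 ht).2]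

theorem eval_Qtilde₂ {n : ℕ} (z : Fin n → ℂ) (i j : ℕ) :
    eval z (Qtilde₂ n i j) = qEntry (elem z) i j := by
  simp [Qtilde₂, qEntry, elem]

end Entries

/-! ### `Q̃_λ` as the Pfaffian of a list -/

section Link

theorem map_pfaffian {R S : Type*} [CommRing R] [CommRing S] (φ : R →+* S) (m : ℕ)
    (A : Matrix (Fin (2 * m)) (Fin (2 * m)) R) :
    φ (pfaffian m A) = pfaffian m (A.map φ) := by
  induction m with
  | zero => simp [pfaffian]
  | succ m ih =>
    simp only [pfaffian, map_sum, map_mul, ih, map_pow, map_neg, map_one]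
    rfl

theorem pfaffian_eq_listPf {R α : Type*} [CommRing R] (A : α → α → R) (m : ℕ)
    (f : Fin (2 * m) → α) (P : Matrix (Fin (2 * m)) (Fin (2 * m)) R)
    (hP : ∀ i j, i < j → P i j = A (f i) (f j)) :
    pfaffian m P = listPf A (List.ofFn f) := by
  induction m with
  | zero => simp [pfaffian, listPf_nil]
  | succ m ih =>
    have hf : List.ofFn f = f (0 : Fin (2 * m + 2)) ::
        List.ofFn (fun i : Fin (2 * m + 1) => f (i.succ : Fin (2 * m + 2))) :=
      List.ofFn_succ (n := 2 * m + 1) (f := f)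
    rw [hf, listPf_cons, pfaffian]
    refine Fintype.sum_equiv (finCongr (by simp)) _ _ fun j => ?_
    simp only [finCongr_apply, Fin.val_cast, Fin.getElem_fin, List.getElem_ofFn]
    rw [hP (0 : Fin (2 * m + 2)) j.succ (Fin.succ_pos j)]
    congr 1
    rw [ih (fun a => f ((j.succAbove a).succ : Fin (2 * m + 2)))]
    · congr 1
      apply List.ext_getElem
      · simp [List.length_eraseIdx]
        omega
      · intro i h1 h2
        rw [List.getElem_eraseIdx]
        simp only [List.getElem_ofFn]
        split_ifs with h
        · congr 1
          ext
          simp [Fin.succAbove, Fin.lt_def, h]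
        · congr 1
          ext
          simp [Fin.succAbove, Fin.lt_def, h]
    · intro a b hab
      rw [Matrix.of_apply, hP]
      exact Fin.succ_lt_succ_iff.2 ((Fin.strictMono_succAbove j) hab)

/-- Two consecutive entries with equal rows and entry `1` between them may be dropped. -/
theorem listPf_append_pair {α : Type*} {A : α → α → ℂ} (hA : ∀ a b, A a b = -A b a) (l : List α)
    (a b : α) (hab : A a b = 1) (h : ∀ x ∈ l, A x a = A x b) :
    listPf A (l ++ [a, b]) = listPf A l := by
  set B := freeForm A
  set g : α → α →₀ ℂ := fun a => Finsupp.single a 1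
  rw [← wick_freeForm hA, ← wick_freeForm hA, List.map_append, wedge_append]
  change wick _ (wedge (l.map g) * wedge [g a, g b]) = wick _ (wedge (l.map g))
  -- The difference `g a - g b` is orthogonal to everything in `l` and pairs to 1 with `g b`, so
  -- contracting with it removes exactly this pair.
  have h1 : wedge (R := ℂ) [g a, g b] = ι ℂ (g a - g b) * ι ℂ (g b) := by
    rw [map_sub, sub_mul]
    simp
  have h2 : wedge (l.map g) * ι ℂ (g a - g b) =
      (-1) ^ l.length * (ι ℂ (g a - g b) * wedge (l.map g)) := by
    rw [ι_mul_wedge, List.length_map, ← mul_assoc, ← pow_add, ← two_mul, pow_mul]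
    simp
  have h3 : contractLeft (Q := (0 : QuadraticForm ℂ (α →₀ ℂ))) (B (g a - g b))
      (wedge (l.map g)) = 0 := by
    rw [contractLeft_wedge]
    refine Finset.sum_eq_zero fun j _ => ?_
    have hj : (l.map g)[j] ∈ l.map g := List.getElem_mem _
    obtain ⟨x, hx, hxj⟩ := List.mem_map.1 hj
    have : B (g a - g b) (l.map g)[j] = 0 := by
      rw [← hxj, map_sub, LinearMap.sub_apply]
      simp only [B, g, freeForm_single]
      rw [hA a x, hA b x, h x hx, sub_self]
    rw [this]
    simp
  have h4 : B (g a - g b) (g b) = 1 := by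
    rw [map_sub, LinearMap.sub_apply]
    simp only [B, g, freeForm_single]
    rw [hab, self_eq_neg.1 (hA b b), sub_zero]
  have h5 : contractLeft (Q := (0 : QuadraticForm ℂ (α →₀ ℂ))) (B (g a - g b))
      (ι ℂ (g b)) = 1 := by
    refine (CliffordAlgebra.contractLeft_ι _ _ _).trans ?_
    rw [h4, map_one]
  have h6 : ((-1 : ExteriorAlgebra ℂ (α →₀ ℂ)) ^ l.length) * (ι ℂ (g a - g b) * wedge (l.map g)) *
      ι ℂ (g b) = ((-1 : ℂ) ^ l.length) • (ι ℂ (g a - g b) * (wedge (l.map g) * ι ℂ (g b))) := by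
    rcases Nat.even_or_odd l.length with h | h <;> simp [h.neg_one_pow, mul_assoc]
  rw [h1, ← mul_assoc, h2, h6, map_smul, wick_ι_mul, contractLeft_wedge_mul, h3, h5, zero_mul,
    zero_add, List.length_map, mul_one]
  rcases Nat.even_or_odd l.length with h | h <;> simp [h.neg_one_pow]

theorem mem_boxPartitions {n : ℕ} {lam : Fin n → ℕ} :
    lam ∈ boxPartitions n ↔ (∀ i, lam i ≤ n) ∧ ∀ i j, i < j → lam j ≤ lam i := by
  simp [boxPartitions, Fintype.mem_piFinset]

theorem part_eq_zero_iff {n : ℕ} {lam : Fin n → ℕ} (h : ∀ i j, i < j → lam j ≤ lam i) (i : ℕ) :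
    part lam i = 0 ↔ len lam ≤ i := by
  unfold part len
  split_ifs with hi
  · constructor
    · intro h0
      calc _ ≤ (Finset.Iio (⟨i, hi⟩ : Fin n)).card := by
            refine Finset.card_le_card fun j hj => ?_
            rw [Finset.mem_Iio]
            by_contra hc
            rcases (not_lt.1 hc).eq_or_lt with h1 | h1
            · simp [← h1, h0] at hj
            · have := h _ _ h1
              simp at hj
              omega
        _ = i := by simp
    · intro hle
      by_contra h0
      have : (Finset.Iic (⟨i, hi⟩ : Fin n)).card ≤
          (Finset.univ.filter fun i => lam i ≠ 0).card := by
        refine Finset.card_le_card fun j hj => ?_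
        rw [Finset.mem_Iic] at hj
        simp only [Finset.mem_filter, Finset.mem_univ, true_and]
        rcases hj.eq_or_lt with h1 | h1
        · rwa [h1]
        · have := h _ _ h1
          omega
      simp at this
      simp at hle
      omega
  · simp only [true_iff]
    refine (Finset.card_le_univ _).trans ?_
    simp
    omega

/-- Two trailing zero parts can be dropped: their columns agree on every earlier part, and Q̃_{0,0}
= 1. -/
theorem listPf_range_part {n : ℕ} (e : ℕ → ℂ) (he : e 0 = 1) {lam : Fin n → ℕ}
    (h : ∀ i j, i < j → lam j ≤ lam i) (k : ℕ) :
    ∀ d, len lam ≤ k → listPf (qEntry e) ((List.range (k + 2 * d)).map (part lam)) =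
      listPf (qEntry e) ((List.range k).map (part lam)) := by
  intro d hk
  -- The matrix is indexed by positions: parts may repeat and Q̃_{a,a} need not vanish, so a skew
  -- matrix cannot be a function of the parts alone.
  set A : ℕ → ℕ → ℂ := fun i j => if i < j then qEntry e (part lam i) (part lam j)
    else if j < i then -qEntry e (part lam j) (part lam i) else 0 with hAdef
  have hA : ∀ i j, A i j = -A j i := by
    intro i j
    simp only [hAdef]
    split_ifs <;> first | omega | simp
  have hr : ∀ m, listPf (qEntry e) ((List.range m).map (part lam)) = listPf A (List.range m) := by
    intro m
    rw [listPf_map]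
    refine listPf_congr _ fun a b hab => ?_
    have : a < b := by
      have := (List.pairwise_lt_range (n := m)).sublist hab
      simpa using this
    simp [hAdef, this]
  induction d with
  | zero => rfl
  | succ d ih =>
    rw [← ih, hr, hr, show k + 2 * (d + 1) = k + 2 * d + 1 + 1 by ring, List.range_succ,
      List.range_succ, List.append_assoc]
    have h0 := (part_eq_zero_iff h (k + 2 * d)).2 (by omega)
    have h1 := (part_eq_zero_iff h (k + 2 * d + 1)).2 (by omega)
    refine listPf_append_pair hA _ _ _ ?_ ?_
    · simp [hAdef, h0, h1, qEntry_zero, he]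
    · intro x hx
      rw [List.mem_range] at hx
      simp [hAdef, h0, h1, hx, show x < k + 2 * d + 1 by omega]

theorem eval_Qtilde {n : ℕ} (z : Fin n → ℂ) {lam : Fin n → ℕ}
    (h : ∀ i j, i < j → lam j ≤ lam i) {m : ℕ} (hm : len lam ≤ 2 * m) :
    eval z (Qtilde lam) = listPf (qEntry (elem z)) ((List.range (2 * m)).map (part lam)) := by
  rw [Qtilde, map_pfaffian, pfaffian_eq_listPf (qEntry (elem z)) _ fun i => part lam i]
  · have h1 : List.ofFn (fun i : Fin (2 * ((len lam + 1) / 2)) => part lam i) =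
        (List.range (2 * ((len lam + 1) / 2))).map (part lam) := by
      apply List.ext_getElem <;> simp
    rw [h1]
    have := listPf_range_part (elem z) (elem_zero z) h (2 * ((len lam + 1) / 2))
      (m - (len lam + 1) / 2) (by omega)
    rw [← this]
    congr 3
    omega
  · intro i j hij
    simp [hij, eval_Qtilde₂]

end Link

end QPOrth

namespace QPOrth

open MvPolynomial
open CliffordAlgebra (contractLeft changeForm)
open ExteriorAlgebra (ι)

/-! ### Sorting and ties -/

section Ties

theorem pairProd_map {X Y : Type*} (T : Y → Y → ℂ) (f : X → Y) (l : List X) :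
    pairProd T (l.map f) = pairProd (fun a b => T (f a) (f b)) l := by
  induction l with
  | nil => rfl
  | cons a l ih =>
    rw [List.map_cons, pairProd, pairProd, ih, List.map_map]
    rfl

theorem pairProd_append {X : Type*} (T : X → X → ℂ) (l l' : List X)
    (h : ∀ a ∈ l, ∀ b ∈ l', T a b = 1) : pairProd T (l ++ l') = pairProd T l * pairProd T l' := by
  induction l with
  | nil => simp [pairProd]
  | cons a l ih =>
    have h1 : (l'.map (T a)).prod = 1 :=
      List.prod_eq_one fun y hy => by
        obtain ⟨b, hb, rfl⟩ := List.mem_map.1 hy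
        exact h a (by simp) b hb
    rw [List.cons_append, pairProd, pairProd, ih fun x hx => h x (by simp [hx]), List.map_append,
      List.prod_append, h1]
    ring

theorem pairProd_congr {X : Type*} {T T' : X → X → ℂ} (l : List X)
    (h : ∀ a b, a ∈ l → b ∈ l → T a b = T' a b) : pairProd T l = pairProd T' l := by
  induction l with
  | nil => rfl
  | cons a l ih =>
    rw [pairProd, pairProd, ih fun x y hx hy => h x y (by simp [hx]) (by simp [hy])]
    congr 2
    exact List.map_congr_left fun b hb => h a b (by simp) (by simp [hb])

theorem pairProd_one {X : Type*} (l : List X) : pairProd (fun _ _ => 1) l = 1 := by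
  induction l with
  | nil => rfl
  | cons a l ih => simp [pairProd, ih]

theorem pairProd_ofFn {X : Type*} (T : X → X → ℂ) {n : ℕ} (x : Fin n → X) :
    pairProd T (List.ofFn x) = ∏ i, ∏ j ∈ Finset.Ioi i, T (x i) (x j) := by
  induction n with
  | zero => simp [pairProd]
  | succ n ih =>
    rw [List.ofFn_succ, pairProd, ih, Fin.prod_univ_succ, Fin.prod_Ioi_zero, List.map_ofFn,
      List.prod_ofFn]
    congr 1
    refine Finset.prod_congr rfl fun i _ => ?_
    rw [Fin.prod_Ioi_succ]

theorem SchurList.of_map {X Y : Type*} {T : Y → Y → ℂ} {f : X → Y} {l : List X}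
    (h : SchurList T (l.map f)) : SchurList (fun a b => T (f a) (f b)) l := by
  intro x m hm
  have := h (f x) (m.map f) (by simpa using hm.map f)
  rw [← List.map_cons, pairProd_map, pairProd_map] at this
  rw [this]
  refine congrArg₂ (· + ·) ?_ (by rw [List.length_map])
  refine Fintype.sum_equiv (finCongr (by simp)) _ _ fun j => ?_
  simp only [finCongr_apply, Fin.val_cast, Fin.getElem_fin, List.getElem_map, List.eraseIdx_map,
    pairProd_map]

/-- The Pfaffian with ones above the diagonal is 1, because the alternating sum of signs is 0 or 1
according to parity. This is the kernel of labelled parts. -/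
theorem schurList_one {X : Type*} (l : List X) : SchurList (fun _ _ : X => (1 : ℂ)) l := by
  intro x m _
  simp only [pairProd_one, mul_one]
  rw [Fin.sum_neg_one_pow]
  split_ifs <;> simp

/-- The Pfaffian of `(x_i - x_j) / (x_i + x_j)`, bordered by ones when the size is odd. -/
theorem listPf_schurT {xs : List ℂ} (hxs : SchurList schurT xs) (h0 : ∀ x ∈ xs, x ≠ 0) :
    listPf schurT (xs ++ if Even xs.length then [] else [0]) = pairProd schurT xs := by
  rw [← wick_freeForm schurT_skew, List.map_append, wedge_append]
  have hq : ∀ x ∈ xs, ∀ y ∈ xs, [x, y].Sublist xs →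
      freeForm schurT (Finsupp.single x 1) (Finsupp.single y 1) = 1 * schurT x y := by
    intro x _ y _ _
    rw [freeForm_single, one_mul]
  -- The border of ones is the point 0. Every nonzero point pairs with it alike, so the point 1 can
  -- represent the whole list in `wick_block`.
  have h1 : ∀ x : ℂ, x ≠ 0 → schurT x 0 = 1 := fun x hx => by simp [schurT, hx]
  split_ifs with he
  · rw [wick_block (freeForm_isAlt schurT_skew) 1 _ (Finsupp.single (1 : ℂ) (1 : ℂ)) ∅ xs hxs hq
      (by simp) _ (Submodule.subset_span ⟨[], by simp, by simp⟩), if_pos he]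
    simp [wick_one]
  · rw [wick_block (freeForm_isAlt schurT_skew) 1 _ (Finsupp.single (1 : ℂ) (1 : ℂ))
      {Finsupp.single 0 1} xs hxs hq ?_ _ (Submodule.subset_span ⟨[Finsupp.single 0 1], by simp,
        by simp⟩), if_neg he]
    · have : wick (freeForm_isAlt schurT_skew) (ι ℂ (Finsupp.single (1 : ℂ) (1 : ℂ)) *
          wedge (([0] : List ℂ).map fun a => Finsupp.single a 1)) = 1 := by
        rw [← wedge_cons, ← List.map_cons (f := fun a : ℂ => Finsupp.single a (1 : ℂ)),
          wick_freeForm schurT_skew, listPf_cons]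
        simp [listPf_nil, schurT]
      rw [this]
      simp
    · intro x hx w hw
      rw [Set.mem_singleton_iff] at hw
      rw [hw, freeForm_single, freeForm_single, h1 x (h0 x hx), h1 1 one_ne_zero]

/-- The skew kernel used to order equal parts: `(x - y) / (x + y)` on numbers, the sign of the
order on labels. -/
noncomputable def tieKernel : ℂ ⊕ ℕ → ℂ ⊕ ℕ → ℂ
  | Sum.inl x, Sum.inl y => schurT x y
  | Sum.inr i, Sum.inr j => if i < j then 1 else if j < i then -1 else 0
  | Sum.inl _, Sum.inr _ => -1
  | Sum.inr _, Sum.inl _ => 1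

theorem tieKernel_skew (a b : ℂ ⊕ ℕ) : tieKernel a b = -tieKernel b a := by
  rcases a with x | i <;> rcases b with y | j <;> simp only [tieKernel, neg_neg]
  · exact schurT_skew x y
  · split_ifs <;> first | omega | simp

/-- The entries `±Q̃_{a,b}`, with ties `a = b` resolved by `tieKernel`. -/
noncomputable def tieEntry (e : ℕ → ℂ) (p q : ℕ × (ℂ ⊕ ℕ)) : ℂ :=
  skewEntry e p.1 q.1 + if p.1 = q.1 then qEntry e p.1 p.1 * tieKernel p.2 q.2 else 0

theorem tieEntry_skew (e : ℕ → ℂ) (p q : ℕ × (ℂ ⊕ ℕ)) : tieEntry e p q = -tieEntry e q p := by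
  unfold tieEntry
  rw [skewEntry_skew e p.1 q.1, tieKernel_skew p.2 q.2]
  split_ifs with h1 h2 h2
  · rw [h1]; ring
  · exact absurd h1.symm h2
  · exact absurd h2.symm h1
  · simp

theorem tieEntry_of_ne (e : ℕ → ℂ) {p q : ℕ × (ℂ ⊕ ℕ)} (h : p.1 ≠ q.1) :
    tieEntry e p q = skewEntry e p.1 q.1 := by
  simp [tieEntry, h]

/-- A part `a` placed at the point `x`. -/
def atPoint (t : ℕ × ℂ × ℕ) : ℕ × (ℂ ⊕ ℕ) := (t.1, Sum.inl t.2.1)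

/-- A part `a` with the label `i`. -/
def atLabel (t : ℕ × ℂ × ℕ) : ℕ × (ℂ ⊕ ℕ) := (t.1, Sum.inr t.2.2)

/-- With points or with labels, the block pairs in the same way with the rest of the list. Two
applications of `wick_block` therefore differ only in `pairProd`, which is a Schur product for
points and 1 for labels. -/
theorem listPf_block (e : ℕ → ℂ) (a : ℕ) (pre post : List (ℕ × (ℂ ⊕ ℕ)))
    (b : List (ℕ × ℂ × ℕ)) (hb : ∀ t ∈ b, t.1 = a) (hb0 : ∀ t ∈ b, t.2.1 ≠ 0)
    (hS : SchurList schurT (b.map fun t => t.2.1)) (hi : b.Pairwise fun s t => s.2.2 < t.2.2)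
    (hpre : ∀ w ∈ pre, w.1 ≠ a) (hpost : ∀ w ∈ post, w.1 ≠ a ∨ w = (0, Sum.inl 0)) :
    listPf (tieEntry e) (pre ++ (b.map atPoint ++ post)) =
      pairProd (fun s t => schurT s.2.1 t.2.1) b *
        listPf (tieEntry e) (pre ++ (b.map atLabel ++ post)) := by
  set g : ℕ × (ℂ ⊕ ℕ) → (ℕ × (ℂ ⊕ ℕ) →₀ ℂ) := fun a => Finsupp.single a 1 with hg
  set N : Set (ℕ × (ℂ ⊕ ℕ) →₀ ℂ) := g '' {w | w.1 ≠ a ∨ w = (0, Sum.inl 0)} with hNdef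
  set z : ExteriorAlgebra ℂ (ℕ × (ℂ ⊕ ℕ) →₀ ℂ) := wedge (pre.map g) * wedge (post.map g) with hz
  have hzN : z ∈ Submodule.span ℂ (wedge '' {l | ∀ w ∈ l, w ∈ N}) := by
    refine Submodule.subset_span ⟨pre.map g ++ post.map g, ?_, wedge_append _ _⟩
    intro w hw
    rcases List.mem_append.1 hw with h | h
    · obtain ⟨v, hv, rfl⟩ := List.mem_map.1 h
      exact ⟨v, Or.inl (hpre v hv), rfl⟩
    · obtain ⟨v, hv, rfl⟩ := List.mem_map.1 h
      exact ⟨v, hpost v hv, rfl⟩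
  have hpt := wick_block (T := fun s t : ℕ × ℂ × ℕ => schurT s.2.1 t.2.1)
    (freeForm_isAlt (tieEntry_skew e)) (qEntry e a a) (fun t => g (atPoint t)) (g (a, Sum.inr 0)) N b
    hS.of_map (by
      intro s hs t ht _
      simp only [hg, freeForm_single, tieEntry, atPoint, hb s hs, hb t ht, skewEntry, lt_irrefl,
        if_false, if_true, zero_add, tieKernel]) (by
      rintro s hs _ ⟨w, hw, rfl⟩
      simp only [hg, freeForm_single]
      -- The only outside entry that can share the part `a` is the border (0, point 0), when `a =
      -- 0`. It pairs to the same value with nonzero points and with labels.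
      by_cases h : w.1 = a
      · rcases hw with h' | rfl
        · exact absurd h h'
        · have := hb0 s hs
          simp only at h
          simp [tieEntry, atPoint, hb s hs, ← h, tieKernel, schurT, this]
      · rw [tieEntry_of_ne e (by simpa [atPoint, hb s hs] using Ne.symm h),
          tieEntry_of_ne e (by simpa using Ne.symm h)]
        simp [atPoint, hb s hs]) z hzN
  have hlb := wick_block (T := fun _ _ : ℕ × ℂ × ℕ => 1)
    (freeForm_isAlt (tieEntry_skew e)) (qEntry e a a) (fun t => g (atLabel t)) (g (a, Sum.inr 0)) N b
    (schurList_one b) (by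
      intro s hs t ht hst
      have : s.2.2 < t.2.2 := by simpa using hi.sublist hst
      simp only [hg, freeForm_single, tieEntry, atLabel, hb s hs, hb t ht, skewEntry, lt_irrefl,
        if_false, if_true, zero_add, tieKernel, this]) (by
      rintro s hs _ ⟨w, hw, rfl⟩
      simp only [hg, freeForm_single]
      by_cases h : w.1 = a
      · rcases hw with h' | rfl
        · exact absurd h h'
        · simp only at h
          simp [tieEntry, atLabel, hb s hs, ← h, tieKernel]
      · rw [tieEntry_of_ne e (by simpa [atLabel, hb s hs] using Ne.symm h),
          tieEntry_of_ne e (by simpa using Ne.symm h)]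
        simp [atLabel, hb s hs]) z hzN
  -- Bringing the block to the front costs a sign independent of `f`, so it cancels in the
  -- comparison.
  have hmove : ∀ f : ℕ × ℂ × ℕ → ℕ × (ℂ ⊕ ℕ), listPf (tieEntry e) (pre ++ (b.map f ++ post)) =
      (-1) ^ (pre.length * b.length) *
        wick (freeForm_isAlt (tieEntry_skew e)) (wedge (b.map fun t => g (f t)) * z) := by
    intro f
    rw [← wick_freeForm (tieEntry_skew e), List.map_append, List.map_append, wedge_append,
      wedge_append, ← mul_assoc, wedge_mul_comm, List.map_map, hz, List.length_map,
      List.length_map]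
    rcases Nat.even_or_odd (pre.length * b.length) with h | h <;>
      simp [h.neg_one_pow, mul_assoc, hg, Function.comp_def]
  rw [hmove, hmove, hpt, hlb, pairProd_one]
  ring

theorem lt_of_mem_dropWhile {l : List (ℕ × ℂ × ℕ)} (h : l.Pairwise fun s t => t.1 ≤ s.1) {a : ℕ}
    (ha : ∀ t ∈ l, t.1 ≤ a) : ∀ t ∈ l.dropWhile (fun t => t.1 = a), t.1 < a := by
  induction l with
  | nil => simp
  | cons s l ih =>
    rw [List.pairwise_cons] at h
    rw [List.dropWhile_cons]
    split_ifs with hs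
    · exact ih h.2 fun t ht => ha t (by simp [ht])
    · have hsa : s.1 < a := lt_of_le_of_ne (ha s (by simp)) (by simpa using hs)
      intro t ht
      rcases List.mem_cons.1 ht with rfl | ht
      · exact hsa
      · exact (h.1 t ht).trans_lt hsa

/-- In decreasing order equal parts are consecutive, so `listPf_block` treats one maximal block at a
time; blocks already labelled are kept in `pre`, where all parts are larger. -/
theorem listPf_sorted (e : ℕ → ℂ) (en : List (ℕ × (ℂ ⊕ ℕ))) (hen : ∀ w ∈ en, w = (0, Sum.inl 0)) :
    ∀ (k : ℕ) (l : List (ℕ × ℂ × ℕ)) (pre : List (ℕ × (ℂ ⊕ ℕ))), l.length ≤ k →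
      (l.Pairwise fun s t => t.1 ≤ s.1) → (l.Pairwise fun s t => s.2.2 < t.2.2) →
      (∀ t ∈ l, t.2.1 ≠ 0) → SchurList schurT (l.map fun t => t.2.1) →
      (∀ w ∈ pre, ∀ t ∈ l, t.1 < w.1) →
      listPf (tieEntry e) (pre ++ (l.map atPoint ++ en)) =
        pairProd (fun s t => if s.1 = t.1 then schurT s.2.1 t.2.1 else 1) l *
          listPf (tieEntry e) (pre ++ (l.map atLabel ++ en)) := by
  intro k
  induction k with
  | zero =>
    intro l pre hk _ _ _ _ _
    obtain rfl : l = [] := List.length_eq_zero_iff.1 (by omega)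
    simp [pairProd]
  | succ k ih =>
    rintro (_ | ⟨s, l⟩) pre hk hs hi h0 hS hpre
    · simp [pairProd]
    set L := s :: l with hL
    set b := L.takeWhile (fun t => t.1 = s.1) with hb
    set l' := L.dropWhile (fun t => t.1 = s.1) with hl'
    have hbl : b ++ l' = L := List.takeWhile_append_dropWhile
    have hba : ∀ t ∈ b, t.1 = s.1 := fun t ht => by simpa using List.mem_takeWhile_imp ht
    have hla : ∀ t ∈ l', t.1 < s.1 := by
      refine lt_of_mem_dropWhile hs fun t ht => ?_
      rcases List.mem_cons.1 ht with rfl | ht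
      · exact le_rfl
      · exact (List.pairwise_cons.1 hs).1 t ht
    have hbs : b.Sublist L := List.takeWhile_sublist _
    have hls : l'.Sublist L := List.dropWhile_sublist _
    have hlen : l'.length ≤ k := by
      have h1 : b ≠ [] := by simp [hb, hL]
      have h2 := congrArg List.length hbl
      rw [List.length_append] at h2
      have := List.length_pos_iff.2 h1
      omega
    have h1 := listPf_block e s.1 pre (l'.map atPoint ++ en) b hba (fun t ht => h0 t (hbs.subset ht))
      (hS.sublist (hbs.map _)) (hi.sublist hbs)
      (fun w hw => (hpre w hw s (by simp [hL])).ne') (by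
        intro w hw
        rcases List.mem_append.1 hw with h | h
        · obtain ⟨t, ht, rfl⟩ := List.mem_map.1 h
          exact Or.inl (hla t ht).ne
        · exact Or.inr (hen w h))
    have h2 := ih l' (pre ++ b.map atLabel) hlen (hs.sublist hls) (hi.sublist hls)
      (fun t ht => h0 t (hls.subset ht)) (hS.sublist (hls.map _)) (by
        intro w hw t ht
        rcases List.mem_append.1 hw with h | h
        · exact hpre w h t (hls.subset ht)
        · obtain ⟨r, hr, rfl⟩ := List.mem_map.1 h
          have := hba r hr
          simp only [atLabel]
          rw [this]
          exact hla t ht)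
    rw [← hbl, List.map_append, List.map_append, List.append_assoc, List.append_assoc, h1]
    rw [List.append_assoc, List.append_assoc] at h2
    rw [h2, pairProd_append _ b l' (fun t ht r hr => by
      have := hla r hr
      rw [if_neg]
      rw [hba t ht]
      exact this.ne'), ← mul_assoc]
    congr 2
    exact pairProd_congr _ fun r t hr ht => by rw [if_pos ((hba r hr).trans (hba t ht).symm)]

end Ties

end QPOrth

namespace QPOrth

open MvPolynomial
open CliffordAlgebra (contractLeft changeForm)
open ExteriorAlgebra (ι)

/-! ### The Cauchy identity -/

section Cauchy

/-- Points with distinct coordinates, no two of which (equal or not) add up to zero. -/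
structure GoodPoint {n : ℕ} (x : Fin n → ℂ) : Prop where
  inj : Function.Injective x
  add_ne : ∀ i j, x i + x j ≠ 0

theorem GoodPoint.ne_zero {n : ℕ} {x : Fin n → ℂ} (h : GoodPoint x) (i : Fin n) : x i ≠ 0 :=
  fun h0 => h.add_ne i i (by simp [h0])

theorem GoodPoint.comp {n : ℕ} {x : Fin n → ℂ} (h : GoodPoint x) (σ : Equiv.Perm (Fin n)) :
    GoodPoint (x ∘ σ) :=
  ⟨h.inj.comp σ.injective, fun _ _ => h.add_ne _ _⟩

theorem GoodPoint.schurList {n : ℕ} {x : Fin n → ℂ} (h : GoodPoint x) :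
    SchurList schurT (List.ofFn x) := by
  refine schurList_schurT (List.nodup_ofFn.2 h.inj) ?_ ?_
  · simp only [List.mem_ofFn]
    rintro _ ⟨i, rfl⟩
    exact h.ne_zero i
  · simp only [List.mem_ofFn]
    rintro _ ⟨i, rfl⟩ _ ⟨j, rfl⟩
    exact h.add_ne i j

/-- `∏_{i<j} (x_i - x_j) / (x_i + x_j)`. -/
noncomputable def schurProd {n : ℕ} (x : Fin n → ℂ) : ℂ :=
  ∏ i, ∏ j ∈ Finset.Ioi i, schurT (x i) (x j)

theorem GoodPoint.schurProd_ne_zero {n : ℕ} {x : Fin n → ℂ} (h : GoodPoint x) :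
    schurProd x ≠ 0 := by
  refine Finset.prod_ne_zero_iff.2 fun i _ => Finset.prod_ne_zero_iff.2 fun j hj => ?_
  refine div_ne_zero (sub_ne_zero.2 fun h' => ?_) (h.add_ne i j)
  exact (Finset.mem_Ioi.1 hj).ne (h.inj h')

theorem wedge_ofFn {M : Type*} [AddCommGroup M] [Module ℂ M] {n : ℕ} (v : Fin n → M) :
    wedge (R := ℂ) (List.ofFn v) = ExteriorAlgebra.ιMulti ℂ n v := by
  rw [ExteriorAlgebra.ιMulti_apply, wedge, List.map_ofFn]
  rfl

/-- `∑_a s^a e_{(a, s)}`. -/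
noncomputable def genPoint (n : ℕ) (s : ℂ) : ℕ × (ℂ ⊕ ℕ) →₀ ℂ :=
  ∑ a ∈ Finset.range (n + 1), s ^ a • Finsupp.single (a, Sum.inl s) 1

theorem genPoint_zero (n : ℕ) : genPoint n 0 = Finsupp.single (0, Sum.inl 0) 1 := by
  simp [genPoint, Finset.sum_range_succ']

/-- The tied parts contribute `schurT s t` times the diagonal series, which is precisely the
correction in `sum_skewEntry`. This is why `tieKernel` has the Schur kernel on points. -/
theorem freeForm_genPoint {e : ℕ → ℂ} {n : ℕ} (he : ∀ k, n < k → e k = 0) {s t : ℂ}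
    (hst : s + t ≠ 0) :
    freeForm (tieEntry e) (genPoint n s) (genPoint n t) =
      (∑ a ∈ Finset.range (n + 1), e a * s ^ a) * (∑ a ∈ Finset.range (n + 1), e a * t ^ a) *
        schurT s t := by
  have h := sum_skewEntry he s t
  have h1 : freeForm (tieEntry e) (genPoint n s) (genPoint n t) =
      ∑ a ∈ Finset.range (n + 1), ∑ b ∈ Finset.range (n + 1), s ^ a * t ^ b * skewEntry e a b +
        schurT s t * ∑ a ∈ Finset.range (n + 1), (s * t) ^ a * qEntry e a a := by
    simp only [genPoint, map_sum, LinearMap.sum_apply, map_smul, LinearMap.smul_apply,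
      freeForm_single, smul_eq_mul, tieEntry, tieKernel]
    rw [Finset.sum_comm, Finset.mul_sum, ← Finset.sum_add_distrib]
    refine Finset.sum_congr rfl fun a ha => ?_
    simp only [mul_add, Finset.sum_add_distrib, mul_ite, mul_zero]
    rw [Finset.sum_ite_eq', if_pos ha, Finset.mul_sum]
    congr 1
    · exact Finset.sum_congr rfl fun b _ => by ring
    · rw [mul_pow]; ring
  rw [h1, schurT, eq_comm, mul_div_assoc', div_eq_iff hst]
  field_simp
  linear_combination -h

/-- The end of a list of odd length. -/
noncomputable def border (n : ℕ) : List (ℕ × (ℂ ⊕ ℕ)) :=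
  if Even n then [] else [(0, Sum.inl 0)]

/-- The Pfaffian attached to the parts `α_i` placed at the points `x_i`. -/
noncomputable def placedPf (e : ℕ → ℂ) {n : ℕ} (x : Fin n → ℂ) (α : Fin n → ℕ) : ℂ :=
  listPf (tieEntry e) (List.ofFn (fun i => (α i, Sum.inl (x i))) ++ border n)

theorem placedPf_eq_wick (e : ℕ → ℂ) {n : ℕ} (x : Fin n → ℂ) (α : Fin n → ℕ) :
    placedPf e x α = wick (freeForm_isAlt (tieEntry_skew e))
      (ExteriorAlgebra.ιMulti ℂ n (fun i => Finsupp.single (α i, Sum.inl (x i)) 1) *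
        wedge ((border n).map fun a => Finsupp.single a 1)) := by
  rw [placedPf, ← wick_freeForm (tieEntry_skew e), List.map_append, wedge_append, List.map_ofFn,
    wedge_ofFn]
  rfl

theorem placedPf_comp (e : ℕ → ℂ) {n : ℕ} (x : Fin n → ℂ) (α : Fin n → ℕ)
    (σ : Equiv.Perm (Fin n)) :
    placedPf e (x ∘ σ) (α ∘ σ) = (Equiv.Perm.sign σ : ℤ) * placedPf e x α := by
  rw [placedPf_eq_wick, placedPf_eq_wick]
  have h := (ExteriorAlgebra.ιMulti ℂ n).map_perm
    (fun i => (Finsupp.single (α i, Sum.inl (x i)) 1 : ℕ × (ℂ ⊕ ℕ) →₀ ℂ)) σ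
  have h2 : (fun i => (Finsupp.single ((α ∘ σ) i, Sum.inl ((x ∘ σ) i)) 1 : ℕ × (ℂ ⊕ ℕ) →₀ ℂ)) =
    (fun i => (Finsupp.single (α i, Sum.inl (x i)) 1 : ℕ × (ℂ ⊕ ℕ) →₀ ℂ)) ∘ σ := rfl
  rw [h2, h]
  rcases Int.units_eq_one_or (Equiv.Perm.sign σ) with h' | h' <;> simp [h']

/-- By multilinearity the sum is the Pfaffian of the vectors `genPoint n (x i)`. Their Gram matrix
is a Schur matrix with row and column `i` scaled by E(x_i). -/
theorem sum_placedPf {e : ℕ → ℂ} {n : ℕ} (he : ∀ k, n < k → e k = 0) (he0 : e 0 = 1)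
    {x : Fin n → ℂ} (hx : GoodPoint x) :
    ∑ α ∈ Fintype.piFinset (fun _ : Fin n => Finset.range (n + 1)),
        (∏ i, x i ^ α i) * placedPf e x α =
      (∏ i, ∑ a ∈ Finset.range (n + 1), e a * x i ^ a) * schurProd x := by
  have h1 : ∑ α ∈ Fintype.piFinset (fun _ : Fin n => Finset.range (n + 1)),
        (∏ i, x i ^ α i) * placedPf e x α =
      wick (freeForm_isAlt (tieEntry_skew e))
        (ExteriorAlgebra.ιMulti ℂ n (fun i => genPoint n (x i)) *
          wedge ((border n).map fun a => Finsupp.single a 1)) := by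
    simp only [genPoint]
    have := (ExteriorAlgebra.ιMulti ℂ n (M := ℕ × (ℂ ⊕ ℕ) →₀ ℂ)).toMultilinearMap.map_sum_finset
      (fun i a => x i ^ a • Finsupp.single (a, Sum.inl (x i)) 1) fun _ => Finset.range (n + 1)
    simp only [AlternatingMap.coe_multilinearMap] at this
    rw [this, Finset.sum_mul, map_sum]
    refine Finset.sum_congr rfl fun α _ => ?_
    have := (ExteriorAlgebra.ιMulti ℂ n (M := ℕ × (ℂ ⊕ ℕ) →₀ ℂ)).toMultilinearMap.map_smul_univ
      (fun i => x i ^ α i) fun i => Finsupp.single (α i, Sum.inl (x i)) 1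
    simp only [AlternatingMap.coe_multilinearMap] at this
    rw [this, smul_mul_assoc, map_smul, smul_eq_mul, placedPf_eq_wick]
  -- The border vector is `genPoint n 0`, a further point with weight E(0) = 1, so it needs no
  -- separate treatment.
  set bd : List ℂ := if Even (List.ofFn x).length then [] else [0] with hbd
  have h2 : wedge (R := ℂ) ((border n).map fun a => Finsupp.single a 1) =
      wedge (bd.map (genPoint n)) := by
    rw [hbd, border, List.length_ofFn]
    split_ifs <;> simp [genPoint_zero]
  have h3 : ExteriorAlgebra.ιMulti ℂ n (fun i => genPoint n (x i)) =
      wedge ((List.ofFn x).map (genPoint n)) := by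
    rw [List.map_ofFn, wedge_ofFn]
    rfl
  rw [h1, h2, h3, ← wedge_append, ← List.map_append, wick_wedge, listPf_map]
  have hmem : ∀ s ∈ List.ofFn x ++ bd, s = 0 ∨ ∃ i, x i = s := by
    intro s hs
    rcases List.mem_append.1 hs with h | h
    · exact Or.inr (by simpa [List.mem_ofFn] using h)
    · left
      rw [hbd] at h
      split_ifs at h <;> simp_all
  have hgram : listPf (fun s t => freeForm (tieEntry e) (genPoint n s) (genPoint n t))
      (List.ofFn x ++ bd) = listPf (fun s t => (∑ a ∈ Finset.range (n + 1), e a * s ^ a) *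
        (∑ a ∈ Finset.range (n + 1), e a * t ^ a) * schurT s t) (List.ofFn x ++ bd) := by
    refine listPf_congr _ fun s t hst => freeForm_genPoint he ?_
    have hp : (List.ofFn x ++ bd).Pairwise fun s t => s + t ≠ 0 := by
      rw [List.pairwise_append]
      refine ⟨?_, ?_, ?_⟩
      · rw [List.pairwise_ofFn]
        exact fun i j _ => hx.add_ne i j
      · rw [hbd]; split_ifs <;> simp
      · intro a ha b hb
        rw [hbd] at hb
        rw [List.mem_ofFn] at ha
        obtain ⟨i, rfl⟩ := ha
        split_ifs at hb
        · simp at hb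
        · simp at hb
          simpa [hb] using hx.ne_zero i
    simpa using hp.sublist hst
  rw [hgram, listPf_scale, listPf_schurT hx.schurList, pairProd_ofFn, List.map_append,
    List.prod_append, List.map_ofFn, List.prod_ofFn]
  · have : (bd.map fun s => ∑ a ∈ Finset.range (n + 1), e a * s ^ a).prod = 1 := by
      rw [hbd]
      split_ifs
      · simp
      · simp [Finset.sum_range_succ', he0]
    rw [this, mul_one]
    rfl
  · intro y hy
    obtain ⟨i, rfl⟩ := (List.mem_ofFn).1 hy
    exact hx.ne_zero i

/-- The factor of the Hall-Littlewood polynomial attached to `α`. -/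
noncomputable def hlWeight {n : ℕ} (x : Fin n → ℂ) (α : Fin n → ℕ) : ℂ :=
  ∏ i, ∏ j, if α j < α i then (x i + x j) / (x i - x j) else 1

theorem prod_prod_eq_prod_Ioi {n : ℕ} (f : Fin n → Fin n → ℂ) (hf : ∀ i, f i i = 1) :
    ∏ i, ∏ j, f i j = ∏ i, ∏ j ∈ Finset.Ioi i, f i j * f j i := by
  rw [Finset.prod_prod_Ioi_mul_eq_prod_prod_off_diag (fun i j => f j i)]
  refine Finset.prod_congr rfl fun i _ => ?_
  rw [Fintype.prod_eq_mul_prod_compl i, hf, one_mul]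

theorem schurProd_comp {n : ℕ} (x : Fin n → ℂ) (σ : Equiv.Perm (Fin n)) :
    schurProd (x ∘ σ) = (Equiv.Perm.sign σ : ℤ) * schurProd x :=
  Equiv.Perm.prod_Ioi_comp_eq_sign_mul_prod σ (f := fun i j => schurT (x i) (x j))
    fun _ _ => schurT_skew _ _

theorem hlWeight_comp {n : ℕ} (x : Fin n → ℂ) (α : Fin n → ℕ) (σ : Equiv.Perm (Fin n)) :
    hlWeight (x ∘ σ) (α ∘ σ) = hlWeight x α := by
  unfold hlWeight
  rw [← Equiv.prod_comp σ (fun i => ∏ j, if α j < α i then (x i + x j) / (x i - x j) else 1)]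
  refine Finset.prod_congr rfl fun i _ => ?_
  rw [← Equiv.prod_comp σ (fun j => if α j < α (σ i) then _ else 1)]
  rfl

/-- Increasing labels make every tie count as Q̃_{a,a} above the diagonal, as in the definition of
Q̃_λ; the border is one more part equal to zero. -/
theorem listPf_labels {n : ℕ} (z x : Fin n → ℂ) {lam : Fin n → ℕ}
    (h : ∀ i j, i < j → lam j ≤ lam i) :
    listPf (tieEntry (elem z))
        ((List.ofFn fun i : Fin n => (lam i, x i, (i : ℕ))).map atLabel ++ border n) =
      eval z (Qtilde lam) := by
  have hlen : len lam ≤ n := (Finset.card_le_univ _).trans (by simp)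
  rw [eval_Qtilde z h (m := (n + 1) / 2) (by omega)]
  have hfst : (List.range (2 * ((n + 1) / 2))).map (part lam) =
      (((List.ofFn fun i : Fin n => (lam i, x i, (i : ℕ))).map atLabel ++ border n).map
        fun p => p.1) := by
    rw [border, List.map_append, List.map_ofFn, List.map_ofFn]
    have h0 : (List.range n).map (part lam) =
        List.ofFn ((fun p : ℕ × (ℂ ⊕ ℕ) => p.1) ∘ atLabel ∘
          fun i : Fin n => (lam i, x i, (i : ℕ))) := by
      apply List.ext_getElem
      · simp
      · intro i h1 h2
        simp only [List.length_map, List.length_range] at h1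
        simp [part, atLabel, h1]
    split_ifs with hn
    · obtain ⟨k, hk⟩ := hn
      rw [show 2 * ((n + 1) / 2) = n by omega, h0]
      simp
    · obtain ⟨k, hk⟩ := Nat.not_even_iff_odd.1 hn
      rw [show 2 * ((n + 1) / 2) = n + 1 by omega, List.range_succ, List.map_append, h0]
      simp [part]
  rw [hfst, listPf_map]
  refine listPf_congr _ fun p q hpq => ?_
  have hp : ((List.ofFn fun i : Fin n => (lam i, x i, (i : ℕ))).map atLabel ++ border n).Pairwise
      fun p q => tieEntry (elem z) p q = qEntry (elem z) p.1 q.1 := by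
    rw [List.pairwise_append]
    refine ⟨?_, ?_, ?_⟩
    · rw [List.map_ofFn, List.pairwise_ofFn]
      intro i j hij
      have h1 := h i j hij
      simp only [Function.comp, atLabel, tieEntry, tieKernel, skewEntry, Fin.val_fin_lt, hij,
        if_true]
      rcases h1.eq_or_lt with h2 | h2
      · simp [h2]
      · simp [h2, h2.ne']
    · unfold border; split_ifs <;> simp
    · intro p hp q hq
      obtain ⟨t, ht, rfl⟩ := List.mem_map.1 hp
      unfold border at hq
      split_ifs at hq
      · simp at hq
      · rw [List.mem_singleton] at hq
        subst hq
        simp only [atLabel, tieEntry, tieKernel, skewEntry]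
        rcases Nat.eq_zero_or_pos t.1 with h2 | h2
        · simp [h2]
        · simp [h2, h2.ne']
  simpa using hp.sublist hpq

/-- The Schur product over pairs of equal parts is the full product `schurProd x` divided by the
factors with unequal parts, and `hlWeight` consists of the inverses of those factors. -/
theorem placedPf_sorted {n : ℕ} (z : Fin n → ℂ) {x : Fin n → ℂ} (hx : GoodPoint x)
    {lam : Fin n → ℕ} (h : ∀ i j, i < j → lam j ≤ lam i) :
    placedPf (elem z) x lam = eval z (Qtilde lam) * (schurProd x * hlWeight x lam) := by
  set l : List (ℕ × ℂ × ℕ) := List.ofFn fun i : Fin n => (lam i, x i, (i : ℕ)) with hl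
  have hxl : l.map (fun t => t.2.1) = List.ofFn x := by
    rw [hl, List.map_ofFn]; rfl
  have h1 := listPf_sorted (elem z) (border n) (by unfold border; split_ifs <;> simp) l.length l []
    le_rfl (by rw [hl, List.pairwise_ofFn]; exact fun i j hij => h i j hij)
    (by rw [hl, List.pairwise_ofFn]; exact fun i j hij => hij)
    (by rw [hl]; intro t ht; obtain ⟨i, rfl⟩ := List.mem_ofFn.1 ht; exact hx.ne_zero i)
    (by rw [hxl]; exact hx.schurList) (by simp)
  rw [List.nil_append, List.nil_append, hl, listPf_labels z x h, pairProd_ofFn, List.map_ofFn] at h1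
  have h2 : placedPf (elem z) x lam = listPf (tieEntry (elem z))
    (List.ofFn (atPoint ∘ fun i : Fin n => (lam i, x i, (i : ℕ))) ++ border n) := rfl
  rw [h2, h1, mul_comm]
  congr 1
  rw [hlWeight, prod_prod_eq_prod_Ioi _ (by simp), schurProd, ← Finset.prod_mul_distrib]
  refine Finset.prod_congr rfl fun i _ => ?_
  rw [← Finset.prod_mul_distrib]
  refine Finset.prod_congr rfl fun j hj => ?_
  rw [Finset.mem_Ioi] at hj
  have hle := h i j hj
  have ha := hx.add_ne i j
  have hs : x i - x j ≠ 0 := sub_ne_zero.2 fun h' => hj.ne (hx.inj h')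
  rcases hle.eq_or_lt with he | hlt
  · simp [he]
  · simp only [hlt, hlt.ne', hlt.not_gt, if_true, if_false, schurT]
    field_simp

theorem placedPf_rearrangement {n : ℕ} (z : Fin n → ℂ) {x : Fin n → ℂ} (hx : GoodPoint x)
    {lam : Fin n → ℕ} (h : ∀ i j, i < j → lam j ≤ lam i) {α : Fin n → ℕ}
    (hα : α ∈ rearrangements lam) :
    placedPf (elem z) x α = eval z (Qtilde lam) * (schurProd x * hlWeight x α) := by
  obtain ⟨w, -, rfl⟩ := Finset.mem_image.1 hα
  have hxw : x = (x ∘ w.symm) ∘ w := by funext i; simp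
  have hg := hx.comp w.symm
  rw [hxw, placedPf_comp, schurProd_comp, hlWeight_comp, placedPf_sorted z hg h]
  ring

theorem eval_HLP {n : ℕ} {x : Fin n → ℂ} (hx : Function.Injective x) (lam : Fin n → ℕ) :
    eval x (HLP lam).1 = ∑ α ∈ rearrangements lam, (∏ i, x i ^ α i) * hlWeight x α := by
  have hpoly : vandPoly n * (HLP lam).1 = hlNumerator (-1) lam := by
    apply IsFractionRing.injective (MvPolynomial (Fin n) ℂ)
      (FractionRing (MvPolynomial (Fin n) ℂ))
    rw [map_mul, HLP, hallLittlewood_spec, hallLittlewoodFrac_mul_vandPoly]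
  have hev := congrArg (eval x) hpoly
  have hne : ∀ {i j : Fin n}, i ≠ j → x i - x j ≠ 0 := fun h => sub_ne_zero.2 fun h' => h (hx h')
  have hv : eval x (vandPoly n) = ∏ i, ∏ j ∈ Finset.Ioi i, (x i - x j) := by
    simp [vandPoly, map_prod]
  have hv0 : eval x (vandPoly n) ≠ 0 := by
    rw [hv]
    exact Finset.prod_ne_zero_iff.2 fun i _ => Finset.prod_ne_zero_iff.2 fun j hj =>
      hne (Finset.mem_Ioi.1 hj).ne
  apply mul_left_cancel₀ hv0
  rw [← map_mul, hpoly, hv, hlNumerator, map_sum, Finset.mul_sum]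
  refine Finset.sum_congr rfl fun α _ => ?_
  rw [map_mul, mul_left_comm]
  congr 1
  · simp [map_prod]
  rw [hlWeight, prod_prod_eq_prod_Ioi _ (by simp), ← Finset.prod_mul_distrib, map_prod]
  refine Finset.prod_congr rfl fun i _ => ?_
  rw [← Finset.prod_mul_distrib, map_prod]
  refine Finset.prod_congr rfl fun j hj => ?_
  have hij := hne (Finset.mem_Ioi.1 hj).ne
  have hji := hne (Finset.mem_Ioi.1 hj).ne'
  simp only [hlFactor]
  rcases lt_trichotomy (α i) (α j) with h | h | h
  · simp only [h, h.not_gt, if_true, if_false, map_sub, map_mul, eval_X, eval_C]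
    field_simp
    ring
  · simp [h]
  · simp only [h, h.not_gt, if_true, if_false, map_sub, map_mul, eval_X, eval_C]
    field_simp
    ring

/-- Each tuple with entries at most `n` has exactly one decreasing rearrangement. -/
theorem sum_boxPartitions {n : ℕ} (f : (Fin n → ℕ) → ℂ) :
    ∑ lam ∈ boxPartitions n, ∑ α ∈ rearrangements lam, f α =
      ∑ α ∈ Fintype.piFinset (fun _ : Fin n => Finset.range (n + 1)), f α := by
  classical
  have hmono : ∀ lam ∈ boxPartitions n, Monotone (OrderDual.toDual ∘ lam) := by
    intro lam hl i j hij
    rcases hij.eq_or_lt with rfl | h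
    · exact le_rfl
    · exact OrderDual.toDual_le_toDual.2 ((mem_boxPartitions.1 hl).2 i j h)
  rw [← Finset.sum_biUnion]
  · congr 1
    ext α
    simp only [Finset.mem_biUnion, Fintype.mem_piFinset, Finset.mem_range, rearrangements,
      Finset.mem_image, Finset.mem_univ, true_and]
    constructor
    · rintro ⟨lam, hl, w, rfl⟩ i
      exact Nat.lt_succ_of_le ((mem_boxPartitions.1 hl).1 _)
    · intro h
      have hs := Tuple.monotone_sort (OrderDual.toDual ∘ α)
      refine ⟨α ∘ Tuple.sort (OrderDual.toDual ∘ α), mem_boxPartitions.2 ⟨fun i => ?_, ?_⟩,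
        (Tuple.sort (OrderDual.toDual ∘ α))⁻¹, ?_⟩
      · exact Nat.le_of_lt_succ (h _)
      · intro i j hij
        exact OrderDual.toDual_le_toDual.1 (hs hij.le)
      · funext i
        simp
  · intro lam hl mu hm hne
    rw [Function.onFun, Finset.disjoint_left]
    intro α h1 h2
    obtain ⟨w, -, rfl⟩ := Finset.mem_image.1 h1
    obtain ⟨v, -, hv⟩ := Finset.mem_image.1 h2
    apply hne
    have hmu : mu = lam ∘ (w * v⁻¹ : Equiv.Perm (Fin n)) := by
      funext i
      have := congrFun hv (v⁻¹ i)
      simpa using this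
    have h3 := Tuple.unique_monotone (f := OrderDual.toDual ∘ lam) (σ := 1) (τ := w * v⁻¹)
      (by simpa using hmono lam hl) (by
        have := hmono mu hm
        rw [hmu] at this
        exact this)
    funext i
    have := congrFun h3 i
    simp only [Function.comp, Equiv.Perm.coe_one, id] at this
    rw [hmu]
    exact OrderDual.toDual.injective this

/-- The Cauchy identity for Hall-Littlewood polynomials at `t = -1` and `Q̃`-polynomials. -/
theorem cauchy_identity {n : ℕ} {x : Fin n → ℂ} (hx : GoodPoint x) (z : Fin n → ℂ) :
    ∑ lam ∈ boxPartitions n, eval x (HLP lam).1 * eval z (Qtilde lam) =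
      ∏ k, ∏ l, (1 + z k * x l) := by
  -- After multiplication by `schurProd x`, both sides equal the sum over all tuples of parts of the
  -- placed Pfaffians weighted by monomials.
  apply mul_right_cancel₀ hx.schurProd_ne_zero
  have h1 := sum_placedPf (elem_of_lt z) (elem_zero z) hx
  simp only [sum_elem] at h1
  rw [Finset.prod_comm, ← h1, ← sum_boxPartitions, Finset.sum_mul]
  refine Finset.sum_congr rfl fun lam hl => ?_
  rw [eval_HLP hx.inj, Finset.sum_mul, Finset.sum_mul]
  refine Finset.sum_congr rfl fun α hα => ?_
  rw [placedPf_rearrangement z hx (mem_boxPartitions.1 hl).2 hα]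
  ring

end Cauchy

end QPOrth

namespace QPOrth

open MvPolynomial

/-! ### Complete symmetric polynomials -/

section Complete

/-- The complete symmetric polynomials at a point. -/
noncomputable def complete {n : ℕ} (x : Fin n → ℂ) (k : ℕ) : ℂ := eval x (hsymm (Fin n) ℂ k)

theorem mk_complete {n : ℕ} (x : Fin n → ℂ) :
    PowerSeries.mk (complete x) = ∏ i, PowerSeries.mk fun j => x i ^ j := by
  ext k
  rw [PowerSeries.coeff_prod, PowerSeries.coeff_mk, complete, hsymm, map_sum]
  refine Finset.sum_bij' (fun s _ => Multiset.toFinsupp s.1)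
    (fun f hf => ⟨Finsupp.toMultiset f, ?_⟩) ?_ ?_ ?_ ?_ ?_
  · have := (Finset.mem_finsuppAntidiag'.1 hf).1
    exact (Finsupp.card_toMultiset f).trans this
  · intro s _
    rw [Finset.mem_finsuppAntidiag']
    refine ⟨?_, Finset.subset_univ _⟩
    exact (Multiset.toFinsupp_sum_eq s.1).trans s.2
  · intro f hf
    exact Finset.mem_univ _
  · intro s _
    apply Subtype.ext
    simp
  · intro f hf
    simp
  · intro s _
    simp only [PowerSeries.coeff_mk, Multiset.toFinsupp_apply]
    rw [map_multiset_prod, Multiset.map_map, Finset.prod_multiset_map_count]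
    simp only [Function.comp, eval_X]
    refine Finset.prod_subset (Finset.subset_univ _) fun i _ hi => ?_
    rw [Multiset.mem_toFinset] at hi
    rw [Multiset.count_eq_zero_of_notMem hi, pow_zero]

theorem mk_complete_mul {n : ℕ} (x : Fin n → ℂ) :
    PowerSeries.mk (complete x) *
      ((∏ i, (1 - Polynomial.C (x i) * Polynomial.X) : Polynomial ℂ) : PowerSeries ℂ) = 1 := by
  have h1 : ((∏ i, (1 - Polynomial.C (x i) * Polynomial.X) : Polynomial ℂ) : PowerSeries ℂ) =
      ∏ i, (1 - PowerSeries.C (x i) * PowerSeries.X) := by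
    have := map_prod (Polynomial.coeToPowerSeries.ringHom (R := ℂ))
      (fun i => (1 - Polynomial.C (x i) * Polynomial.X)) Finset.univ
    refine this.trans (Finset.prod_congr rfl fun i _ => ?_)
    simp
  rw [h1, mk_complete, ← Finset.prod_mul_distrib]
  refine Finset.prod_eq_one fun i _ => ?_
  ext k
  rw [mul_sub, mul_one, map_sub, mul_left_comm, PowerSeries.coeff_C_mul]
  rcases k with _ | k
  · simp
  · rw [PowerSeries.coeff_succ_mul_X]
    simp [PowerSeries.coeff_one, pow_succ, mul_comm]

theorem prod_one_add_C_mul_X {n : ℕ} (x : Fin n → ℂ) :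
    (∏ i, (1 + Polynomial.C (x i) * Polynomial.X) : Polynomial ℂ) =
      ∑ a ∈ Finset.range (n + 1), Polynomial.C (elem x a) * Polynomial.X ^ a := by
  apply Polynomial.funext
  intro s
  have := sum_elem x s
  simp [Polynomial.eval_prod, Polynomial.eval_finsetSum, this]

theorem coeff_prod_one_add {n : ℕ} (x : Fin n → ℂ) (k : ℕ) :
    (∏ i, (1 + Polynomial.C (x i) * Polynomial.X) : Polynomial ℂ).coeff k = elem x k := by
  rw [prod_one_add_C_mul_X, Polynomial.finsetSum_coeff]
  simp only [Polynomial.coeff_C_mul, Polynomial.coeff_X_pow, mul_ite, mul_one, mul_zero]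
  rw [Finset.sum_ite_eq]
  split_ifs with h
  · rfl
  · rw [elem_of_lt x k (by simpa using h)]

/-- If the squares of the coordinates are the `n`-th roots of `c`, complete and elementary symmetric
polynomials agree in degrees below `2n`. -/
theorem complete_eq_elem {n : ℕ} {x : Fin n → ℂ} {c : ℂ}
    (hc : ∀ s : ℂ, ∏ i, (1 - x i ^ 2 * s) = 1 - c * s ^ n) {k : ℕ} (hk : k < 2 * n) :
    complete x k = elem x k := by
  -- Since the first factor is inverse to the series of the H_k, this gives H(s)(1 - c s^{2n}) =
  -- E(s).
  have h1 : (∏ i, (1 - Polynomial.C (x i) * Polynomial.X) : Polynomial ℂ) *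
      ∏ i, (1 + Polynomial.C (x i) * Polynomial.X) =
      1 - Polynomial.C c * Polynomial.X ^ (2 * n) := by
    apply Polynomial.funext
    intro s
    have := hc (s ^ 2)
    simp only [Polynomial.eval_mul, Polynomial.eval_prod, Polynomial.eval_sub, Polynomial.eval_add,
      Polynomial.eval_one, Polynomial.eval_C, Polynomial.eval_X, Polynomial.eval_pow]
    rw [pow_mul, ← this, ← Finset.prod_mul_distrib]
    exact Finset.prod_congr rfl fun i _ => by ring
  have h2 := mk_complete_mul x
  have h3 : PowerSeries.mk (complete x) * ((1 - Polynomial.C c * Polynomial.X ^ (2 * n) :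
      Polynomial ℂ) : PowerSeries ℂ) =
      ((∏ i, (1 + Polynomial.C (x i) * Polynomial.X) : Polynomial ℂ) : PowerSeries ℂ) := by
    rw [← h1, Polynomial.coe_mul, ← mul_assoc, h2, one_mul]
  have h4 := congrArg (PowerSeries.coeff k) h3
  rw [Polynomial.coeff_coe, coeff_prod_one_add] at h4
  rw [← h4]
  simp [mul_sub, ← mul_assoc, PowerSeries.coeff_mul_X_pow', not_le.2 hk]

/-- Evaluation before and after ω are algebra maps that agree on the generators E_1, …, E_n. -/
theorem eval_omega {n : ℕ} {x : Fin n → ℂ} (h : ∀ i : Fin n, complete x (i + 1) = elem x (i + 1))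
    (f : symmetricSubalgebra (Fin n) ℂ) : eval x (omega n f).1 = eval x f.1 := by
  set ev : symmetricSubalgebra (Fin n) ℂ →ₐ[ℂ] ℂ :=
    (aeval x).comp (symmetricSubalgebra (Fin n) ℂ).val with hev
  have hval : ∀ g : symmetricSubalgebra (Fin n) ℂ, ev g = eval x g.1 := fun g => by
    simp [hev]
  have key : ((ev.comp (omega n)).comp (esymmAlgEquiv (Fin n) ℂ (Fintype.card_fin n)).toAlgHom) =
      ev.comp (esymmAlgEquiv (Fin n) ℂ (Fintype.card_fin n)).toAlgHom := by
    apply MvPolynomial.algHom_ext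
    intro i
    have hX : esymmAlgEquiv (Fin n) ℂ (Fintype.card_fin n) (X i) =
        ⟨esymm (Fin n) ℂ (i + 1), (mem_symmetricSubalgebra _).2 (esymm_isSymmetric _ _ _)⟩ := by
      have := esymmAlgEquiv_symm_apply (σ := Fin n) (R := ℂ) (Fintype.card_fin n) i
      rw [AlgEquiv.symm_apply_eq] at this
      exact this.symm
    change ev (omega n (esymmAlgEquiv (Fin n) ℂ (Fintype.card_fin n) (X i))) =
      ev (esymmAlgEquiv (Fin n) ℂ (Fintype.card_fin n) (X i))
    rw [hX, omega_esymm, hval, hval]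
    exact h i
  obtain ⟨g, rfl⟩ := (esymmAlgEquiv (Fin n) ℂ (Fintype.card_fin n)).surjective f
  rw [← hval, ← hval]
  exact congrArg (fun φ => φ g) key

end Complete

/-! ### Exclusive tuples -/

section Roots

theorem prod_eq_of_range_eq {n : ℕ} {f g : Fin n → ℂ} (hf : Function.Injective f)
    (hg : Function.Injective g) (h : Set.range f = Set.range g) (F : ℂ → ℂ) :
    ∏ k, F (f k) = ∏ k, F (g k) := by
  classical
  have hi : Finset.univ.image f = Finset.univ.image g := by
    rw [← Finset.coe_inj]
    simpa using h
  rw [← Finset.prod_image (f := F) (fun a _ b _ h => hf h),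
    ← Finset.prod_image (f := F) (fun a _ b _ h => hg h), hi]

theorem range_eq_of_subset {n : ℕ} {f g : Fin n → ℂ} (hf : Function.Injective f)
    (h : Set.range f ⊆ Set.range g) : Set.range f = Set.range g := by
  classical
  have h1 : Finset.univ.image f ⊆ Finset.univ.image g := by
    rw [← Finset.coe_subset]
    simpa using h
  have h2 := Finset.eq_of_subset_of_card_le h1 (by
    rw [Finset.card_image_of_injective _ hf]
    exact Finset.card_image_le)
  rw [← Finset.coe_inj] at h2
  simpa using h2

variable {n : ℕ}

theorem goodPoint_zetaTuple (J : exclusiveTuples n) : GoodPoint (zetaTuple J.1) :=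
  ⟨J.2.1.2.2.2, fun i j h => J.2.2 i j (eq_neg_of_add_eq_zero_left h)⟩

theorem zetaTuple_pow (J : exclusiveTuples n) (k : Fin n) :
    zetaTuple J.1 k ^ (2 * n) = (-1) ^ (n + 1) := J.2.1.2.2.1 k

theorem rootSet_eq (hn : 0 < n) (J : exclusiveTuples n) :
    rootSet n = Set.range (zetaTuple J.1) ∪ Set.range fun k => -zetaTuple J.1 k := by
  classical
  obtain ⟨R, hR, hRc⟩ := exists_rootFinset hn
  have hx := goodPoint_zetaTuple J
  have hU : Finset.univ.image (zetaTuple J.1) ∪ (Finset.univ.image fun k => -zetaTuple J.1 k) =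
      R := by
    apply Finset.eq_of_subset_of_card_le
    · intro x hx
      rw [← Finset.mem_coe, hR]
      rcases Finset.mem_union.1 hx with hx | hx
      · obtain ⟨k, -, rfl⟩ := Finset.mem_image.1 hx
        exact zetaTuple_pow J k
      · obtain ⟨k, -, rfl⟩ := Finset.mem_image.1 hx
        exact neg_mem_rootSet (zetaTuple_pow J k)
    · rw [Finset.card_union_of_disjoint, Finset.card_image_of_injective _ hx.inj,
        Finset.card_image_of_injective _ (f := fun k => -zetaTuple J.1 k)
          (neg_injective.comp hx.inj), hRc]
      · simp [two_mul]
      · rw [Finset.disjoint_left]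
        intro x h1 h2
        obtain ⟨k, -, rfl⟩ := Finset.mem_image.1 h1
        obtain ⟨l, -, h⟩ := Finset.mem_image.1 h2
        exact J.2.2 k l h.symm
  rw [← hR, ← hU]
  simp

/-- A root `-ζ^{j_k}` is not among the ζ^{j_l}, so it must come from the complementary tuple;
counting gives equality. -/
theorem range_hatTuple (hn : 0 < n) (J : exclusiveTuples n) :
    Function.Injective (zetaTuple (hatTuple hn J)) ∧
      Set.range (zetaTuple (hatTuple hn J)) = Set.range fun k => -zetaTuple J.1 k := by
  have h := hatTuple_spec hn J
  refine ⟨h.1.2.2.2, (range_eq_of_subset (neg_injective.comp J.2.1.2.2.2) ?_).symm⟩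
  rintro _ ⟨k, rfl⟩
  have hk : -zetaTuple J.1 k ∈ rootSet n := neg_mem_rootSet (zetaTuple_pow J k)
  rw [← h.2] at hk
  rcases hk with ⟨l, hl⟩ | hk
  · exact absurd hl (J.2.2 l k)
  · exact hk

theorem range_starTuple (hn : 0 < n) (J : exclusiveTuples n) :
    Set.range (zetaTuple (starTuple hn J)) = Set.range fun k => (zetaTuple J.1 k)⁻¹ := by
  have h := ((isStar_iff hn J.2 _).1 (starTuple_spec hn J)).2
  rw [h]
  simp

theorem goodPoint_starTuple (hn : 0 < n) (J : exclusiveTuples n) :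
    GoodPoint (zetaTuple (starTuple hn J)) :=
  goodPoint_zetaTuple ⟨_, (starTuple_spec hn J).1⟩

/-- The roots are the ζ^{j_l} and their negatives. If no ζ^{i_k} is such a negative, both tuples
have the same set of roots, and a tuple is determined by that set. -/
theorem eq_of_forall_add_ne (hn : 0 < n) {I J : exclusiveTuples n}
    (h : ∀ k l, zetaTuple I.1 k + zetaTuple J.1 l ≠ 0) : I = J := by
  classical
  have hsub : Set.range (zetaTuple I.1) ⊆ Set.range (zetaTuple J.1) := by
    rintro _ ⟨k, rfl⟩
    have hk : zetaTuple I.1 k ∈ rootSet n := zetaTuple_pow I k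
    rw [rootSet_eq hn J] at hk
    rcases hk with hk | ⟨l, hl⟩
    · exact hk
    · exact absurd (by rw [← hl]; ring) (h k l)
  have heq := range_eq_of_subset I.2.1.2.2.2 hsub
  obtain ⟨K, -, hu⟩ := existsUnique_tuple hn (Finset.univ.image (zetaTuple J.1))
    (by rw [Finset.card_image_of_injective _ J.2.1.2.2.2]; simp)
    (fun x hx => by
      obtain ⟨k, -, rfl⟩ := Finset.mem_image.1 hx
      exact zetaTuple_pow J k)
  apply Subtype.ext
  rw [hu I.1 ⟨I.2.1, by simpa using heq⟩, hu J.1 ⟨J.2.1, by simp⟩]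

/-! ### Conjugation, squares of the roots, and the norm of the Vandermonde product -/

theorem conj_zetaPow (j : ℝ) : (starRingEnd ℂ) (zetaPow n j) = (zetaPow n j)⁻¹ := by
  rw [zetaPow, ← Complex.exp_conj, ← Complex.exp_neg]
  congr 1
  simp
  ring

theorem conj_zetaTuple (J : Fin n → ℝ) (k : Fin n) :
    (starRingEnd ℂ) (zetaTuple J k) = (zetaTuple J k)⁻¹ := conj_zetaPow _

/-- Exclusivity makes squaring injective on ζ^J, so the squares are all `n` roots of the right-hand
side. -/
theorem prod_sub_sq (hn : 0 < n) (J : exclusiveTuples n) (s : ℂ) :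
    ∏ k, (s - zetaTuple J.1 k ^ 2) = s ^ n - (-1) ^ (n + 1) := by
  classical
  have hx := goodPoint_zetaTuple J
  set w : Fin n → ℂ := fun k => zetaTuple J.1 k ^ 2 with hw
  have hwi : Function.Injective w := by
    intro k l h
    rcases sq_eq_sq_iff_eq_or_eq_neg.1 h with h | h
    · exact hx.inj h
    · exact absurd h (J.2.2 k l)
  have hpm : (∏ k, (Polynomial.X - Polynomial.C (w k))).Monic := Polynomial.monic_prod_X_sub_C _ _
  have hpd : (∏ k, (Polynomial.X - Polynomial.C (w k))).natDegree = n := by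
    rw [Polynomial.natDegree_prod_of_monic _ _ fun k _ => Polynomial.monic_X_sub_C _]; simp
  have hqm := Polynomial.monic_X_pow_sub_C ((-1 : ℂ) ^ (n + 1)) hn.ne'
  have hqd := Polynomial.natDegree_X_pow_sub_C (n := n) (r := (-1 : ℂ) ^ (n + 1))
  have hpq : ∏ k, (Polynomial.X - Polynomial.C (w k)) =
      Polynomial.X ^ n - Polynomial.C ((-1 : ℂ) ^ (n + 1)) := by
    refine Polynomial.eq_of_degree_sub_lt_of_eval_finset_eq (Finset.univ.image w) ?_ ?_
    · rw [Finset.card_image_of_injective _ hwi, Finset.card_univ, Fintype.card_fin]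
      have := Polynomial.degree_sub_lt_left
        (p := ∏ k, (Polynomial.X - Polynomial.C (w k)))
        (q := Polynomial.X ^ n - Polynomial.C ((-1 : ℂ) ^ (n + 1))) (by
        rw [Polynomial.degree_eq_natDegree hpm.ne_zero, Polynomial.degree_eq_natDegree hqm.ne_zero,
          hpd, hqd]) hpm.ne_zero (by rw [hpm.leadingCoeff, hqm.leadingCoeff])
      rwa [Polynomial.degree_eq_natDegree hpm.ne_zero, hpd] at this
    · intro y hy
      obtain ⟨k, -, rfl⟩ := Finset.mem_image.1 hy
      have h1 : ∏ l, (w k - w l) = 0 := Finset.prod_eq_zero (Finset.mem_univ k) (sub_self _)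
      have h2 := zetaTuple_pow J k
      rw [pow_mul] at h2
      have h3 : w k ^ n = (-1) ^ (n + 1) := h2
      simp only [Polynomial.eval_prod, Polynomial.eval_sub, Polynomial.eval_X, Polynomial.eval_C,
        Polynomial.eval_pow, h1, h3, sub_self]
  have := congrArg (Polynomial.eval s) hpq
  simpa [Polynomial.eval_prod, hw] using this

theorem prod_one_sub_sq_mul (hn : 0 < n) (J : exclusiveTuples n) (s : ℂ) :
    ∏ k, (1 - zetaTuple J.1 k ^ 2 * s) = 1 - (-1) ^ (n + 1) * s ^ n := by
  rcases eq_or_ne s 0 with rfl | hs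
  · simp [hn.ne']
  · have h := prod_sub_sq hn J s⁻¹
    have h1 : ∏ k, (1 - zetaTuple J.1 k ^ 2 * s) = ∏ k, s * (s⁻¹ - zetaTuple J.1 k ^ 2) :=
      Finset.prod_congr rfl fun k _ => by field_simp
    rw [h1, Finset.prod_mul_distrib, h, Finset.prod_const, Finset.card_univ, Fintype.card_fin,
      mul_sub, inv_pow, mul_inv_cancel₀ (pow_ne_zero _ hs), mul_comm]

/-- Both sides are the derivative of the polynomial of `prod_sub_sq` at one of its roots. -/
theorem prod_erase_sub_sq (hn : 0 < n) (J : exclusiveTuples n) (k : Fin n) :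
    ∏ l ∈ Finset.univ.erase k, (zetaTuple J.1 k ^ 2 - zetaTuple J.1 l ^ 2) =
      n * (zetaTuple J.1 k ^ 2) ^ (n - 1) := by
  have h : (∏ l, (Polynomial.X - Polynomial.C (zetaTuple J.1 l ^ 2))) =
      Polynomial.X ^ n - Polynomial.C ((-1 : ℂ) ^ (n + 1)) := by
    apply Polynomial.funext
    intro s
    have := prod_sub_sq hn J s
    simp only [Polynomial.eval_prod, Polynomial.eval_sub, Polynomial.eval_X, Polynomial.eval_C,
      Polynomial.eval_pow]
    exact this
  have hd := congrArg (fun p => Polynomial.eval (zetaTuple J.1 k ^ 2) (Polynomial.derivative p)) h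
  simp only [Polynomial.derivative_sub, Polynomial.derivative_X_pow, Polynomial.derivative_C,
    sub_zero, Polynomial.eval_mul, Polynomial.eval_pow, Polynomial.eval_X, Polynomial.eval_C] at hd
  rw [← hd, Polynomial.derivative_prod_finset, Polynomial.eval_finsetSum, Finset.sum_eq_single k]
  · simp only [Polynomial.derivative_X_sub_C, mul_one, Polynomial.eval_prod, Polynomial.eval_sub,
      Polynomial.eval_X, Polynomial.eval_C]
  · intro l _ hl
    rw [Polynomial.eval_mul, Polynomial.eval_prod,
      Finset.prod_eq_zero (i := k) (by simp [hl.symm]) (by simp), zero_mul]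
  · simp

theorem prod_sq (hn : 0 < n) (J : exclusiveTuples n) : ∏ k, zetaTuple J.1 k ^ 2 = 1 := by
  have h := prod_sub_sq hn J 0
  simp only [zero_sub, zero_pow hn.ne'] at h
  have h1 : ∏ k, -zetaTuple J.1 k ^ 2 = (-1) ^ n * ∏ k, zetaTuple J.1 k ^ 2 := by
    simp [Finset.prod_neg]
  rw [h1, pow_succ] at h
  rcases Nat.even_or_odd n with h' | h' <;> simpa [h'.neg_one_pow] using h

theorem norm_vand_sq (J : Fin n → ℝ) : ((‖vand (zetaTuple J)‖ : ℂ)) ^ 2 =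
    ∏ k, ∏ l, if k = l then 1 else (zetaTuple J k - zetaTuple J l) / zetaTuple J l := by
  rw [prod_prod_eq_prod_Ioi _ (by simp), ← Complex.mul_conj', vand, map_prod,
    ← Finset.prod_mul_distrib]
  refine Finset.prod_congr rfl fun k _ => ?_
  rw [map_prod, ← Finset.prod_mul_distrib]
  refine Finset.prod_congr rfl fun l hl => ?_
  have hkl : k ≠ l := (Finset.mem_Ioi.1 hl).ne
  have h1 : zetaTuple J k ≠ 0 := zetaPow_ne_zero _ _
  have h2 : zetaTuple J l ≠ 0 := zetaPow_ne_zero _ _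
  rw [if_neg hkl, if_neg hkl.symm, map_sub, conj_zetaTuple, conj_zetaTuple]
  field_simp

/-- Writing x_k = ζ^{j_k}, an off-diagonal factor becomes (x_k² - x_l²)/x_l² and a diagonal one is
2. Since ∏ x_l² = 1, each row has product 2n (-1)^{n+1}, and the signs cancel because n(n+1) is
even. -/
theorem prod_one_add_mul_norm_vand (hn : 0 < n) (J : exclusiveTuples n) :
    (∏ k, ∏ l, (1 + zetaTuple J.1 k * (zetaTuple J.1 l)⁻¹)) *
      ((‖vand (zetaTuple J.1)‖ : ℂ)) ^ 2 = (2 * n) ^ n := by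
  classical
  rw [norm_vand_sq, ← Finset.prod_mul_distrib]
  have h0 : ∀ k, zetaTuple J.1 k ≠ 0 := fun k => zetaPow_ne_zero _ _
  have hrow : ∀ k, (∏ l, (1 + zetaTuple J.1 k * (zetaTuple J.1 l)⁻¹)) *
      (∏ l, if k = l then 1 else (zetaTuple J.1 k - zetaTuple J.1 l) / zetaTuple J.1 l) =
      2 * n * (-1) ^ (n + 1) := by
    intro k
    rw [← Finset.prod_mul_distrib, ← Finset.mul_prod_erase _ _ (Finset.mem_univ k)]
    have h1 : ∏ l ∈ Finset.univ.erase k, ((1 + zetaTuple J.1 k * (zetaTuple J.1 l)⁻¹) *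
        if k = l then 1 else (zetaTuple J.1 k - zetaTuple J.1 l) / zetaTuple J.1 l) =
        (∏ l ∈ Finset.univ.erase k, (zetaTuple J.1 k ^ 2 - zetaTuple J.1 l ^ 2)) /
          ∏ l ∈ Finset.univ.erase k, zetaTuple J.1 l ^ 2 := by
      rw [← Finset.prod_div_distrib]
      refine Finset.prod_congr rfl fun l hl => ?_
      rw [if_neg (Finset.ne_of_mem_erase hl).symm]
      have := h0 l
      field_simp
      ring
    have h2 : zetaTuple J.1 k ^ 2 * ∏ l ∈ Finset.univ.erase k, zetaTuple J.1 l ^ 2 = 1 := by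
      rw [Finset.mul_prod_erase _ (fun l => zetaTuple J.1 l ^ 2) (Finset.mem_univ k), prod_sq hn J]
    have h3 : ∏ l ∈ Finset.univ.erase k, zetaTuple J.1 l ^ 2 ≠ 0 :=
      right_ne_zero_of_mul (h2.symm ▸ one_ne_zero)
    have h4 := zetaTuple_pow J k
    have h5 : (zetaTuple J.1 k ^ 2) ^ (n - 1) * zetaTuple J.1 k ^ 2 = (-1) ^ (n + 1) := by
      rw [← pow_succ, Nat.sub_add_cancel hn, ← pow_mul, h4]
    rw [h1, prod_erase_sub_sq hn J k, if_pos rfl, mul_inv_cancel₀ (h0 k), mul_one,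
      mul_div_assoc', div_eq_iff h3]
    linear_combination (2 * (n : ℂ) * (zetaTuple J.1 k ^ 2) ^ (n - 1)) * (-h2) +
      (2 * (n : ℂ) * ∏ l ∈ Finset.univ.erase k, zetaTuple J.1 l ^ 2) * h5
  rw [Finset.prod_congr rfl fun k _ => hrow k, Finset.prod_const, Finset.card_univ,
    Fintype.card_fin, mul_pow, ← pow_mul, mul_comm (n + 1) n, (Nat.even_mul_succ_self n).neg_one_pow,
    mul_one]

theorem vand_ne_zero {x : Fin n → ℂ} (hx : Function.Injective x) : vand x ≠ 0 :=
  Finset.prod_ne_zero_iff.2 fun _ _ => Finset.prod_ne_zero_iff.2 fun _ hj =>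
    sub_ne_zero.2 fun h => (Finset.mem_Ioi.1 hj).ne (hx h)

theorem prod_one_add_eq (hn : 0 < n) (I J : exclusiveTuples n) :
    ∏ k, ∏ l, (1 + zetaTuple I.1 k * (zetaTuple J.1 l)⁻¹) =
      if I = J then (2 * (n : ℂ)) ^ n / (‖vand (zetaTuple I.1)‖ : ℂ) ^ 2 else 0 := by
  split_ifs with h
  · subst h
    rw [eq_div_iff, prod_one_add_mul_norm_vand hn]
    simp [vand_ne_zero I.2.1.2.2.2]
  · have : ∃ k l, zetaTuple I.1 k + zetaTuple J.1 l = 0 := by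
      by_contra! hc
      exact h (eq_of_forall_add_ne hn hc)
    obtain ⟨k, l, hkl⟩ := this
    refine Finset.prod_eq_zero (Finset.mem_univ k) (Finset.prod_eq_zero (Finset.mem_univ l) ?_)
    have : zetaTuple J.1 l ≠ 0 := zetaPow_ne_zero _ _
    field_simp
    linear_combination hkl

theorem sum_star_eq (hn : 0 < n) (J : exclusiveTuples n) (z : Fin n → ℂ) :
    ∑ lam ∈ boxPartitions n,
        eval (zetaTuple (starTuple hn J)) (HLP lam).1 * eval z (Qtilde lam) =
      ∏ k, ∏ l, (1 + z k * (zetaTuple J.1 l)⁻¹) := by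
  rw [cauchy_identity (goodPoint_starTuple hn J)]
  exact Finset.prod_congr rfl fun k _ => prod_eq_of_range_eq (goodPoint_starTuple hn J).inj
    (inv_injective.comp J.2.1.2.2.2) (range_starTuple hn J) fun y => 1 + z k * y

theorem prod_hat_eq (hn : 0 < n) (J : exclusiveTuples n) (z : Fin n → ℂ) :
    ∏ k, ∏ l, (1 - z k * zetaPow n (-(hatTuple hn J l))) =
      ∏ k, ∏ l, (1 + z k * (zetaTuple J.1 l)⁻¹) := by
  refine Finset.prod_congr rfl fun k _ => ?_
  have h := prod_eq_of_range_eq (range_hatTuple hn J).1 (neg_injective.comp J.2.1.2.2.2)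
    (range_hatTuple hn J).2 fun y => 1 - z k * y⁻¹
  simp only [zetaPow_neg]
  refine h.trans (Finset.prod_congr rfl fun l _ => ?_)
  simp [inv_neg]

/-- At ζ^J the involution ω has no effect, and P_λ has real coefficients in its defining sum, so
conjugation only inverts the coordinates, as J^* does. -/
theorem conj_omega_HLP (hn : 0 < n) (J : exclusiveTuples n) (lam : Fin n → ℕ) :
    (starRingEnd ℂ) (eval (zetaTuple J.1) (omega n (HLP lam)).1) =
      eval (fun k => (zetaTuple J.1 k)⁻¹) (HLP lam).1 := by
  have hx := goodPoint_zetaTuple J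
  have hinj : Function.Injective fun k => (zetaTuple J.1 k)⁻¹ := inv_injective.comp hx.inj
  rw [eval_omega fun i => complete_eq_elem (prod_one_sub_sq_mul hn J) (by have := i.2; omega),
    eval_HLP hx.inj, eval_HLP hinj, map_sum]
  refine Finset.sum_congr rfl fun α _ => ?_
  simp only [map_mul, map_prod, map_pow, hlWeight, apply_ite (starRingEnd ℂ), map_div₀, map_add,
    map_sub, map_one, conj_zetaTuple]

theorem sum_conj_omega_eq (hn : 0 < n) (J : exclusiveTuples n) (z : Fin n → ℂ) :
    ∑ lam ∈ boxPartitions n,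
        (starRingEnd ℂ) (eval (zetaTuple J.1) (omega n (HLP lam)).1) * eval z (Qtilde lam) =
      ∏ k, ∏ l, (1 + z k * (zetaTuple J.1 l)⁻¹) := by
  simp only [conj_omega_HLP hn J]
  have hx := goodPoint_zetaTuple J
  refine cauchy_identity ⟨inv_injective.comp hx.inj, fun i j h => ?_⟩ z
  have h1 := hx.ne_zero i
  have h2 := hx.ne_zero j
  have := hx.add_ne j i
  change (zetaTuple J.1 i)⁻¹ + (zetaTuple J.1 j)⁻¹ = 0 at h
  field_simp at h
  exact this (by simpa using h)

end Roots

end QPOrth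

namespace QPOrth

open MvPolynomial
open CliffordAlgebra (contractLeft changeForm)
open ExteriorAlgebra (ι)

/-! ### Pfaffians of orthogonal blocks -/

section Orthogonal

variable {M : Type*} [AddCommGroup M] [Module ℂ M]

/-- The Pfaffian of a block-diagonal matrix is the product of the Pfaffians of the blocks. -/
theorem wick_mul_of_orthogonal {B : LinearMap.BilinForm ℂ M} (hB : B.IsAlt) (l l' : List M)
    (h : ∀ a ∈ l, ∀ b ∈ l', B a b = 0) :
    wick hB (wedge l * wedge l') = wick hB (wedge l) * wick hB (wedge l') := by
  induction l using list_induction_eraseIdx with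
  | hnil => simp [wick_one]
  | hcons a l _ ih =>
    have h0 : contractLeft (Q := (0 : QuadraticForm ℂ M)) (B a) (wedge l') = 0 := by
      rw [contractLeft_wedge]
      refine Finset.sum_eq_zero fun j _ => ?_
      have := h a (by simp) l'[j] (List.getElem_mem _)
      rw [this]
      simp
    rw [wedge_cons, mul_assoc, wick_ι_mul, wick_ι_mul, contractLeft_wedge_mul, h0, mul_zero,
      mul_zero, add_zero, contractLeft_wedge, Finset.sum_mul, map_sum, map_sum, Finset.sum_mul]
    refine Finset.sum_congr rfl fun j _ => ?_
    rw [smul_mul_assoc, map_smul, map_smul, ih j fun b hb => h b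
      (List.mem_cons_of_mem _ ((List.eraseIdx_sublist l j).subset hb)), smul_eq_mul, smul_eq_mul]
    ring

/-- Factors may be changed modulo vectors that annihilate what follows. -/
theorem wedge_map_mul_congr {α : Type*} (f f' : α → M) (l : List α) (z : ExteriorAlgebra ℂ M)
    (h : ∀ a ∈ l, ι ℂ (f' a - f a) * z = 0) :
    wedge (l.map f') * z = wedge (l.map f) * z := by
  induction l with
  | nil => rfl
  | cons a l ih =>
    have h1 : ι ℂ (f' a - f a) * (wedge (l.map f) * z) = 0 := by
      rw [← mul_assoc, ι_mul_wedge, mul_assoc, mul_assoc, h a (by simp), mul_zero, mul_zero]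
    rw [map_sub, sub_mul, sub_eq_zero] at h1
    rw [List.map_cons, List.map_cons, wedge_cons, wedge_cons, mul_assoc,
      ih fun b hb => h b (List.mem_cons_of_mem _ hb), h1, mul_assoc]

end Orthogonal

/-! ### Strict partitions as sets of parts -/

section Strict

/-- A list, followed by a zero when its length is odd. -/
def padZero (l : List ℕ) : List ℕ := l ++ if Even l.length then [] else [0]

/-- The decreasing enumeration of a finite set. -/
def descList (S : Finset ℕ) : List ℕ := S.sort (· ≥ ·)

/-- The set of nonzero parts. -/
def partSet {n : ℕ} (lam : Fin n → ℕ) : Finset ℕ := (Finset.univ.image lam).erase 0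

/-- The partition with a given set of parts. -/
def ofParts (n : ℕ) (S : Finset ℕ) (i : Fin n) : ℕ := (descList S).getD i 0

theorem mem_strictPartitions {n : ℕ} {lam : Fin n → ℕ} : lam ∈ strictPartitions n ↔
    (∀ i, lam i ≤ n) ∧ (∀ i j, i < j → lam j ≤ lam i) ∧
      ∀ i j, i < j → lam i ≠ 0 → lam j < lam i := by
  rw [strictPartitions, Finset.mem_filter, mem_boxPartitions, and_assoc]

theorem mem_descList {S : Finset ℕ} {a : ℕ} : a ∈ descList S ↔ a ∈ S := Finset.mem_sort _

theorem length_descList (S : Finset ℕ) : (descList S).length = S.card := Finset.length_sort _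

theorem pairwise_descList (S : Finset ℕ) : (descList S).Pairwise (· > ·) :=
  S.sortedGT_sort.pairwise

theorem eq_descList {l : List ℕ} {S : Finset ℕ} (hl : l.Pairwise (· > ·))
    (h : ∀ a, a ∈ l ↔ a ∈ S) : l = descList S := by
  refine List.Perm.eq_of_pairwise' (r := (· > ·)) hl (pairwise_descList S) ?_
  rw [List.perm_ext_iff_of_nodup (hl.imp fun h => h.ne') ((pairwise_descList S).imp fun h => h.ne')]
  intro a
  rw [h, mem_descList]

theorem part_lt {n : ℕ} {lam : Fin n → ℕ} (h : lam ∈ strictPartitions n) {i j : ℕ} (hij : i < j)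
    (h0 : part lam i ≠ 0) : part lam j < part lam i := by
  unfold part at *
  split_ifs at * with h1 h2 h2
  · exact (mem_strictPartitions.1 h).2.2 _ _ hij h0
  · omega
  · omega
  · omega

theorem descList_partSet {n : ℕ} {lam : Fin n → ℕ} (h : lam ∈ strictPartitions n) :
    descList (partSet lam) = (List.range (len lam)).map (part lam) := by
  have hz := part_eq_zero_iff (mem_strictPartitions.1 h).2.1
  symm
  apply eq_descList
  · rw [List.pairwise_map]
    refine (List.pairwise_lt_range (n := len lam)).imp_of_mem fun {i j} hi _ hij => ?_
    refine part_lt h hij ?_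
    rw [Ne, hz]
    simpa using hi
  · intro a
    simp only [List.mem_map, List.mem_range, partSet, Finset.mem_erase, Finset.mem_image,
      Finset.mem_univ, true_and]
    constructor
    · rintro ⟨i, hi, rfl⟩
      have h0 : part lam i ≠ 0 := by rw [Ne, hz]; omega
      refine ⟨h0, ?_⟩
      unfold part at h0 ⊢
      split_ifs at h0 ⊢ with h1
      · exact ⟨_, rfl⟩
      · exact absurd rfl h0
    · rintro ⟨h0, i, rfl⟩
      have hp : part lam i = lam i := by simp [part]
      refine ⟨i, ?_, hp⟩
      by_contra hc
      exact h0 (hp ▸ (hz i).2 (by omega))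

theorem card_partSet {n : ℕ} {lam : Fin n → ℕ} (h : lam ∈ strictPartitions n) :
    (partSet lam).card = len lam := by
  rw [← length_descList, descList_partSet h]
  simp

theorem ofParts_partSet {n : ℕ} {lam : Fin n → ℕ} (h : lam ∈ strictPartitions n) :
    ofParts n (partSet lam) = lam := by
  funext i
  have hz := part_eq_zero_iff (mem_strictPartitions.1 h).2.1 i
  have hp : part lam i = lam i := by simp [part]
  rw [ofParts, descList_partSet h, ← hp]
  by_cases hi : (i : ℕ) < len lam
  · simp [List.getD_eq_getElem?_getD, hi]
  · rw [hz.2 (by omega), List.getD_eq_default]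
    simpa using hi

theorem ofParts_mem {n : ℕ} {S : Finset ℕ} (hS : S ⊆ Finset.Icc 1 n) :
    ofParts n S ∈ strictPartitions n := by
  have hmem : ∀ i (hi : i < (descList S).length), 1 ≤ (descList S)[i] ∧ (descList S)[i] ≤ n :=
    fun i hi => Finset.mem_Icc.1 (hS (mem_descList.1 (List.getElem_mem hi)))
  have hlt : ∀ i j (hj : j < (descList S).length) (hij : i < j),
      (descList S)[j] < (descList S)[i] := fun i j hj hij =>
    List.pairwise_iff_getElem.1 (pairwise_descList S) i j (by omega) hj hij
  have hval : ∀ i : Fin n, ofParts n S i = if hi : (i : ℕ) < (descList S).length then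
      (descList S)[(i : ℕ)] else 0 := by
    intro i
    rw [ofParts]
    split_ifs with hi
    · simp [List.getD_eq_getElem?_getD, hi]
    · rw [List.getD_eq_default _ _ (by omega)]
  have key : ∀ i j, i < j → ofParts n S i ≠ 0 → ofParts n S j < ofParts n S i := by
    intro i j hij h0
    rw [hval] at h0
    rw [hval, hval]
    by_cases h1 : (i : ℕ) < (descList S).length
    · rw [dif_pos h1]
      split_ifs with h2
      · exact hlt _ _ h2 hij
      · exact (hmem _ h1).1
    · exact absurd (dif_neg h1) h0
  refine mem_strictPartitions.2 ⟨fun i => ?_, fun i j hij => ?_, key⟩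
  · rw [hval]
    split_ifs with hi
    · exact (hmem _ hi).2
    · omega
  · by_cases h0 : ofParts n S i = 0
    · rw [hval] at h0
      rw [hval, hval]
      have hij' : (i : ℕ) < j := hij
      by_cases h1 : (i : ℕ) < (descList S).length
      · rw [dif_pos h1] at h0
        have := (hmem _ h1).1
        omega
      · rw [dif_neg (show ¬ (j : ℕ) < (descList S).length by omega)]
        exact Nat.zero_le _
    · exact (key i j hij h0).le

theorem partSet_ofParts {n : ℕ} {S : Finset ℕ} (hS : S ⊆ Finset.Icc 1 n) :
    partSet (ofParts n S) = S := by
  have hcard : S.card ≤ n := (Finset.card_le_card hS).trans (by simp)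
  ext a
  simp only [partSet, Finset.mem_erase, Finset.mem_image, Finset.mem_univ, true_and, ofParts]
  constructor
  · rintro ⟨h0, i, rfl⟩
    by_cases hi : (i : ℕ) < (descList S).length
    · rw [List.getD_eq_getElem _ _ hi]
      exact mem_descList.1 (List.getElem_mem hi)
    · rw [List.getD_eq_default _ _ (by omega)] at h0
      exact absurd rfl h0
  · intro ha
    obtain ⟨i, hi, rfl⟩ := List.getElem_of_mem (mem_descList.2 ha)
    have := (Finset.mem_Icc.1 (hS ha)).1
    refine ⟨by omega, ⟨i, by rw [length_descList] at hi; omega⟩, List.getD_eq_getElem _ _ hi⟩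

theorem hatPartition_eq {n : ℕ} (lam : Fin n → ℕ) :
    hatPartition lam = ofParts n (Finset.Icc 1 n \ partSet lam) := by
  funext i
  rw [hatPartition, ofParts, descList]
  congr 2
  ext a
  simp only [partSet, Finset.mem_sdiff, Finset.mem_Icc, Finset.mem_erase]
  refine and_congr_right fun h => not_congr ⟨fun h' => ⟨by omega, h'⟩, And.right⟩

/-- The parts are distinct, even with the one padding zero, so no ties occur and the skew matrix is
a function of the parts. -/
theorem eval_Qtilde_of_strict {n : ℕ} (z : Fin n → ℂ) {lam : Fin n → ℕ}
    (h : lam ∈ strictPartitions n) :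
    eval z (Qtilde lam) = listPf (skewEntry (elem z)) (padZero (descList (partSet lam))) := by
  have hz := part_eq_zero_iff (mem_strictPartitions.1 h).2.1
  have hpad : padZero (descList (partSet lam)) =
      (List.range (2 * ((len lam + 1) / 2))).map (part lam) := by
    rw [padZero, length_descList, card_partSet h, descList_partSet h]
    split_ifs with he
    · obtain ⟨k, hk⟩ := he
      rw [List.append_nil, show 2 * ((len lam + 1) / 2) = len lam by omega]
    · obtain ⟨k, hk⟩ := Nat.not_even_iff_odd.1 he
      rw [show 2 * ((len lam + 1) / 2) = len lam + 1 by omega, List.range_succ, List.map_append,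
        List.map_singleton, (hz (len lam)).2 le_rfl]
  have hm : len lam ≤ 2 * ((len lam + 1) / 2) := by omega
  rw [eval_Qtilde z (mem_strictPartitions.1 h).2.1 hm, hpad, listPf_map, listPf_map]
  refine listPf_congr _ fun a b hab => ?_
  have hab' : a < b := by
    have := (List.pairwise_lt_range (n := 2 * ((len lam + 1) / 2))).sublist hab
    simpa using this
  have hb : b < 2 * ((len lam + 1) / 2) := by
    have := hab.subset (show b ∈ [a, b] by simp)
    simpa using this
  have hlt := part_lt h hab' (by rw [Ne, hz]; omega)
  rw [skewEntry, if_pos hlt]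

/-- Complementary partitions have lengths adding up to `n`, so `2 ^ n` clears the powers of two in
both P̃ factors of every summand. -/
theorem sum_strictPartitions {n : ℕ} (x y : Fin n → ℂ) :
    2 ^ n * ∑ lam ∈ strictPartitions n,
        eval x (Ptilde lam) * eval y (Ptilde (hatPartition lam)) =
      ∑ S ∈ (Finset.Icc 1 n).powerset,
        listPf (skewEntry (elem x)) (padZero (descList S)) *
          listPf (skewEntry (elem y)) (padZero (descList (Finset.Icc 1 n \ S))) := by
  rw [Finset.mul_sum]
  refine Finset.sum_nbij' partSet (ofParts n) ?_ ?_ ?_ ?_ ?_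
  · intro lam h
    rw [Finset.mem_powerset]
    intro a ha
    simp only [partSet, Finset.mem_erase, Finset.mem_image, Finset.mem_univ, true_and] at ha
    obtain ⟨h0, i, rfl⟩ := ha
    have := (mem_strictPartitions.1 h).1 i
    rw [Finset.mem_Icc]
    omega
  · exact fun S hS => ofParts_mem (Finset.mem_powerset.1 hS)
  · exact fun lam h => ofParts_partSet h
  · exact fun S hS => partSet_ofParts (Finset.mem_powerset.1 hS)
  · intro lam h
    have hsub : partSet lam ⊆ Finset.Icc 1 n := by
      intro a ha
      simp only [partSet, Finset.mem_erase, Finset.mem_image, Finset.mem_univ, true_and] at ha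
      obtain ⟨h0, i, rfl⟩ := ha
      have := (mem_strictPartitions.1 h).1 i
      rw [Finset.mem_Icc]
      omega
    have hs : Finset.Icc 1 n \ partSet lam ⊆ Finset.Icc 1 n := Finset.sdiff_subset
    have hm := ofParts_mem hs
    have hl : len lam + len (ofParts n (Finset.Icc 1 n \ partSet lam)) = n := by
      rw [← card_partSet h, ← card_partSet hm, partSet_ofParts hs, Finset.card_sdiff_of_subset hsub]
      have := Finset.card_le_card hsub
      simp only [Nat.card_Icc] at *
      omega
    rw [hatPartition_eq, Ptilde, Ptilde, map_mul, map_mul, eval_C, eval_C,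
      eval_Qtilde_of_strict x h, eval_Qtilde_of_strict y hm, partSet_ofParts hs]
    have h2 : (2 : ℂ) ^ n * ((2 : ℂ)⁻¹ ^ len lam *
        2⁻¹ ^ len (ofParts n (Finset.Icc 1 n \ partSet lam))) = 1 := by
      rw [← pow_add, hl, ← mul_pow]
      simp
    linear_combination (listPf (skewEntry (elem x)) (padZero (descList (partSet lam))) *
      listPf (skewEntry (elem y)) (padZero (descList (Finset.Icc 1 n \ partSet lam)))) * h2

end Strict

end QPOrth

namespace QPOrth

open MvPolynomial
open CliffordAlgebra (contractLeft changeForm)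
open ExteriorAlgebra (ι)

/-! ### Sums over complementary subsets as a single Pfaffian -/

section Dual

variable {M : Type*} [AddCommGroup M] [Module ℂ M]

theorem wedge_mul_ι (l : List M) (a : M) :
    wedge l * ι ℂ a = ((-1 : ℂ) ^ l.length) • (ι ℂ a * wedge l) := by
  rw [ι_mul_wedge, ← mul_assoc]
  rcases Nat.even_or_odd l.length with h | h <;> simp [h.neg_one_pow]

theorem descList_insert {S : Finset ℕ} {a : ℕ} (h : ∀ b ∈ S, b < a) :
    descList (insert a S) = a :: descList S :=
  Finset.sort_insert _ (fun b hb => (h b hb).le) fun ha => (h a ha).false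

/-- The expansion of `∏ (u_i + (-1)^i w_i)` in decreasing order of `i`. -/
theorem wedge_descList_add (u w : ℕ → M) (n : ℕ) :
    wedge (R := ℂ) ((descList (Finset.Icc 1 n)).map fun i => u i + (-1 : ℂ) ^ i • w i) =
      ∑ S ∈ (Finset.Icc 1 n).powerset, ((-1 : ℂ) ^ (((Finset.Icc 1 n \ S).card + 1) / 2)) •
        (wedge (R := ℂ) ((descList S).map u) * wedge ((descList (Finset.Icc 1 n \ S)).map w)) := by
  induction n with
  | zero => simp [descList]
  | succ n ih =>
    have hI : Finset.Icc 1 (n + 1) = insert (n + 1) (Finset.Icc 1 n) := by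
      ext a
      simp only [Finset.mem_Icc, Finset.mem_insert]
      omega
    have hnot : n + 1 ∉ Finset.Icc 1 n := by simp
    have hlt : ∀ S ⊆ Finset.Icc 1 n, ∀ b ∈ S, b < n + 1 := fun S hS b hb => by
      have := Finset.mem_Icc.1 (hS hb)
      omega
    rw [hI, descList_insert (hlt _ (Finset.Subset.refl _)), List.map_cons, wedge_cons, ih,
      Finset.sum_powerset_insert hnot, map_add, add_mul, Finset.mul_sum, Finset.mul_sum, add_comm]
    congr 1
    · refine Finset.sum_congr rfl fun S hS => ?_
      have hS' := Finset.mem_powerset.1 hS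
      have hd : insert (n + 1) (Finset.Icc 1 n) \ S = insert (n + 1) (Finset.Icc 1 n \ S) :=
        Finset.insert_sdiff_of_notMem _ fun h => hnot (hS' h)
      have hnot' : n + 1 ∉ Finset.Icc 1 n \ S := fun h => hnot (Finset.sdiff_subset h)
      have hc : (Finset.Icc 1 n \ S).card + S.card = n := by
        rw [Finset.card_sdiff_add_card_eq_card hS']
        simp
      rw [hd, descList_insert (hlt _ Finset.sdiff_subset), Finset.card_insert_of_notMem hnot',
        List.map_cons, wedge_cons, ← mul_assoc, wedge_mul_ι, List.length_map, length_descList,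
        map_smul]
      generalize (Finset.Icc 1 n \ S).card = k at hc
      simp only [smul_mul_assoc, mul_smul_comm, smul_smul, mul_assoc]
      congr 1
      -- Moving w_{n+1} past the u-vectors gives the total sign (-1)^{n+1+|S|} = (-1)^{k+1}, which
      -- is the ratio of the exponents ⌊(k+2)/2⌋ and ⌊(k+1)/2⌋.
      subst hc
      rcases Nat.even_or_odd' k with ⟨m, rfl | rfl⟩
      · rw [show (2 * m + 1) / 2 = m by omega, show (2 * m + 1 + 1) / 2 = m + 1 by omega]
        simp only [pow_add, pow_mul, neg_one_sq, one_pow]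
        ring
      · rw [show (2 * m + 1 + 1) / 2 = m + 1 by omega,
          show (2 * m + 1 + 1 + 1) / 2 = m + 1 by omega]
        simp only [pow_add, pow_mul, neg_one_sq, one_pow]
        ring
    · refine Finset.sum_congr rfl fun S hS => ?_
      have hS' := Finset.mem_powerset.1 hS
      have hd : insert (n + 1) (Finset.Icc 1 n) \ insert (n + 1) S = Finset.Icc 1 n \ S := by
        rw [Finset.insert_sdiff_insert, Finset.sdiff_insert_of_notMem hnot]
      rw [hd, descList_insert (hlt _ hS'), List.map_cons, wedge_cons, mul_smul_comm, mul_assoc]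

/-- Basis vectors in three blocks. -/
noncomputable def gen (c : Fin 3) (i : ℕ) : Fin 3 × ℕ →₀ ℂ := Finsupp.single (c, i) 1

/-- The orthogonal sum of `a`, `-b` and an auxiliary symplectic form. -/
noncomputable def dualEntry (a b : ℕ → ℕ → ℂ) (p q : Fin 3 × ℕ) : ℂ :=
  if p.1 = q.1 then
    (![a, fun i j => -b i j, fun i j => (j : ℂ) - i] : Fin 3 → ℕ → ℕ → ℂ) p.1 p.2 q.2
  else 0

theorem dualEntry_skew {a b : ℕ → ℕ → ℂ} (ha : ∀ i j, a i j = -a j i) (hb : ∀ i j, b i j = -b j i)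
    (p q : Fin 3 × ℕ) : dualEntry a b p q = -dualEntry a b q p := by
  obtain ⟨c, i⟩ := p
  obtain ⟨d, j⟩ := q
  unfold dualEntry
  by_cases h : c = d
  · subst h
    simp only [if_true]
    fin_cases c
    · exact ha i j
    · simp [hb i j]
    · simp
  · simp [h, Ne.symm h]

/-- The vectors completing a product of length `n` to even length. -/
noncomputable def dualBorder (n : ℕ) : ExteriorAlgebra ℂ (Fin 3 × ℕ →₀ ℂ) :=
  if Even n then ι ℂ (gen 2 0 + gen 0 0) * ι ℂ (gen 2 1 - gen 1 0) else ι ℂ (gen 0 0 + gen 1 0)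

variable {a b : ℕ → ℕ → ℂ} (ha : ∀ i j, a i j = -a j i) (hb : ∀ i j, b i j = -b j i)

theorem wick_gen (S T U : List ℕ) :
    wick (freeForm_isAlt (dualEntry_skew ha hb))
        (wedge (S.map (gen 0)) * wedge (T.map (gen 1)) * wedge (U.map (gen 2))) =
      listPf a S * listPf (fun i j => -b i j) T * listPf (fun i j : ℕ => (j : ℂ) - i) U := by
  have hpf : ∀ (c : Fin 3) (l : List ℕ), wick (freeForm_isAlt (dualEntry_skew ha hb))
      (wedge (l.map (gen c))) =
      listPf ((![a, fun i j => -b i j, fun i j => (j : ℂ) - i] : Fin 3 → ℕ → ℕ → ℂ) c) l := by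
    intro c l
    have := wick_freeForm (dualEntry_skew ha hb) (l.map fun i => (c, i))
    rw [List.map_map, listPf_map] at this
    refine this.trans (listPf_congr _ fun i j _ => ?_)
    simp [dualEntry]
  have horth : ∀ (c d : Fin 3) (l l' : List ℕ), c ≠ d → ∀ v ∈ l.map (gen c), ∀ v' ∈ l'.map (gen d),
      freeForm (dualEntry a b) v v' = 0 := by
    intro c d l l' hcd v hv v' hv'
    obtain ⟨i, -, rfl⟩ := List.mem_map.1 hv
    obtain ⟨j, -, rfl⟩ := List.mem_map.1 hv'
    rw [gen, gen, freeForm_single, dualEntry, if_neg hcd]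
  rw [← wedge_append, wick_mul_of_orthogonal, wedge_append, wick_mul_of_orthogonal, hpf, hpf, hpf]
  · rfl
  · exact horth 0 1 S T (by decide)
  · intro v hv v' hv'
    rcases List.mem_append.1 hv with hv | hv
    · exact horth 0 2 S U (by decide) v hv v' hv'
    · exact horth 1 2 T U (by decide) v hv v' hv'

theorem wedge_gen_zero (c : Fin 3) (l : List ℕ) :
    wedge (R := ℂ) ((l ++ [0]).map (gen c)) = wedge (l.map (gen c)) * ι ℂ (gen c 0) := by
  rw [List.map_append, wedge_append]
  simp

/-- Scaling every index by the imaginary unit negates the matrix. -/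
theorem listPf_neg (A : ℕ → ℕ → ℂ) (l : List ℕ) {m : ℕ} (hl : l.length = 2 * m) :
    listPf (fun i j => -A i j) l = (-1) ^ m * listPf A l := by
  have h := listPf_scale A (fun _ => Complex.I) l
  simp only [Complex.I_mul_I, neg_mul, one_mul] at h
  rw [h]
  simp [hl, pow_mul]

theorem listPf_neg_padZero (A : ℕ → ℕ → ℂ) (l : List ℕ) :
    listPf (fun i j => -A i j) (padZero l) = (-1) ^ ((l.length + 1) / 2) * listPf A (padZero l) := by
  apply listPf_neg
  unfold padZero
  split_ifs with h
  · obtain ⟨k, hk⟩ := h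
    simp
    omega
  · obtain ⟨k, hk⟩ := Nat.not_even_iff_odd.1 h
    simp
    omega

/-- Only terms with an even number of vectors in each block survive, so the border adds a zero
exactly to the odd lists. For even total length the two lists have the same parity: if both are even
the auxiliary pair is used, with Pfaffian 1; if both are odd each receives a zero. For odd total
length exactly one list receives a zero. -/
theorem wick_mul_dualBorder (S T : List ℕ) :
    wick (freeForm_isAlt (dualEntry_skew ha hb))
        (wedge (S.map (gen 0)) * wedge (T.map (gen 1)) * dualBorder (S.length + T.length)) =
      listPf a (padZero S) * ((-1) ^ ((T.length + 1) / 2) * listPf b (padZero T)) := by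
  have hT : wedge (T.map (gen 1)) * ι ℂ (gen 0 0) =
      ((-1 : ℂ) ^ T.length) • (ι ℂ (gen 0 0) * wedge (T.map (gen 1))) := by
    rw [wedge_mul_ι, List.length_map]
  rw [← listPf_neg_padZero, dualBorder]
  split_ifs with he
  · have hexp : wedge (S.map (gen 0)) * wedge (T.map (gen 1)) *
        (ι ℂ (gen 2 0 + gen 0 0) * ι ℂ (gen 2 1 - gen 1 0)) =
        wedge (S.map (gen 0)) * wedge (T.map (gen 1)) * wedge ([0, 1].map (gen 2)) +
        wedge (S.map (gen 0)) * wedge ((T ++ [0]).map (gen 1)) * wedge ([0].map (gen 2)) +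
        ((-1 : ℂ) ^ T.length) • (wedge ((S ++ [0]).map (gen 0)) * wedge (T.map (gen 1)) *
          wedge ([1].map (gen 2))) -
        ((-1 : ℂ) ^ T.length) • (wedge ((S ++ [0]).map (gen 0)) * wedge ((T ++ [0]).map (gen 1)) *
          wedge (([] : List ℕ).map (gen 2))) := by
      simp only [wedge_gen_zero, List.map_cons, List.map_nil, wedge_cons, wedge_nil, mul_one,
        map_add, map_sub, mul_add, add_mul, mul_sub]
      have h1 : wedge (S.map (gen 0)) * wedge (T.map (gen 1)) * (ι ℂ (gen 0 0) * ι ℂ (gen 2 1)) =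
          ((-1 : ℂ) ^ T.length) • (wedge (S.map (gen 0)) * ι ℂ (gen 0 0) * wedge (T.map (gen 1)) *
            ι ℂ (gen 2 1)) := by
        rw [← mul_assoc, mul_assoc (wedge (S.map (gen 0))), hT, mul_smul_comm, smul_mul_assoc,
          ← mul_assoc (wedge (S.map (gen 0)))]
      have h2 : wedge (S.map (gen 0)) * wedge (T.map (gen 1)) * (ι ℂ (gen 0 0) * ι ℂ (gen 1 0)) =
          ((-1 : ℂ) ^ T.length) • (wedge (S.map (gen 0)) * ι ℂ (gen 0 0) *
            (wedge (T.map (gen 1)) * ι ℂ (gen 1 0))) := by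
        rw [← mul_assoc, mul_assoc (wedge (S.map (gen 0))), hT, mul_smul_comm, smul_mul_assoc,
          ← mul_assoc (wedge (S.map (gen 0))), mul_assoc _ (wedge (T.map (gen 1)))]
      rw [h1, h2, ι_mul_ι_comm (gen 2 0) (gen 1 0)]
      simp only [mul_assoc, mul_neg]
      abel
    have hodd1 : ∀ i : ℕ, listPf (fun i j : ℕ => (j : ℂ) - i) [i] = 0 := fun i =>
      listPf_odd _ _ (by simp)
    have h2 : listPf (fun i j : ℕ => (j : ℂ) - i) [0, 1] = 1 := by
      simp [listPf_cons, listPf_nil]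
    rw [hexp, map_sub, map_add, map_add, map_smul, map_smul, wick_gen ha hb, wick_gen ha hb, wick_gen ha hb, wick_gen ha hb,
      hodd1, hodd1, h2, listPf_nil]
    rcases Nat.even_or_odd T.length with hT' | hT'
    · have hS' : Even S.length := by rwa [Nat.even_add, iff_true_right hT'] at he
      rw [listPf_odd a (S ++ [0]) (by simpa using hS'.add_one)]
      simp [padZero, hS', hT']
    · have hS' : Odd S.length := by
        rw [Nat.even_add] at he
        rw [← Nat.not_even_iff_odd] at hT' ⊢
        tauto
      rw [listPf_odd a S hS']
      simp [padZero, Nat.not_even_iff_odd.2 hS', Nat.not_even_iff_odd.2 hT', hT'.neg_one_pow]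
  · have hexp : wedge (S.map (gen 0)) * wedge (T.map (gen 1)) * ι ℂ (gen 0 0 + gen 1 0) =
        ((-1 : ℂ) ^ T.length) • (wedge ((S ++ [0]).map (gen 0)) * wedge (T.map (gen 1)) *
          wedge (([] : List ℕ).map (gen 2))) +
        wedge (S.map (gen 0)) * wedge ((T ++ [0]).map (gen 1)) *
          wedge (([] : List ℕ).map (gen 2)) := by
      simp only [wedge_gen_zero, List.map_nil, wedge_nil, mul_one, map_add, mul_add]
      congr 1
      · rw [mul_assoc, hT, mul_smul_comm, mul_assoc]
      · rw [mul_assoc]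
    rw [hexp, map_add, map_smul, wick_gen ha hb, wick_gen ha hb, listPf_nil]
    rcases Nat.even_or_odd T.length with hT' | hT'
    · have hS' : Odd S.length := by
        rw [Nat.even_add] at he
        rw [← Nat.not_even_iff_odd]
        tauto
      rw [listPf_odd a S hS']
      simp [padZero, Nat.not_even_iff_odd.2 hS', hT', hT'.neg_one_pow]
    · have hS' : Even S.length := by
        rw [Nat.even_add] at he
        rw [← Nat.not_even_iff_odd] at hT'
        tauto
      rw [listPf_odd a (S ++ [0]) (by simpa using hS'.add_one)]
      simp [padZero, hS', Nat.not_even_iff_odd.2 hT']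

/-- The sign of each term in `wedge_descList_add` cancels the one that comes from using `-b` on the
second block. -/
theorem sum_powerset_listPf (n : ℕ) :
    ∑ S ∈ (Finset.Icc 1 n).powerset, listPf a (padZero (descList S)) *
        listPf b (padZero (descList (Finset.Icc 1 n \ S))) =
      wick (freeForm_isAlt (dualEntry_skew ha hb))
        (wedge ((descList (Finset.Icc 1 n)).map fun i => gen 0 i + (-1 : ℂ) ^ i • gen 1 i) *
          dualBorder n) := by
  rw [wedge_descList_add, Finset.sum_mul, map_sum]
  refine Finset.sum_congr rfl fun S hS => ?_
  have hc : n = (descList S).length + (descList (Finset.Icc 1 n \ S)).length := by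
    rw [length_descList, length_descList, add_comm,
      Finset.card_sdiff_add_card_eq_card (Finset.mem_powerset.1 hS)]
    simp
  have h := wick_mul_dualBorder ha hb (descList S) (descList (Finset.Icc 1 n \ S))
  rw [← hc] at h
  rw [smul_mul_assoc, map_smul, h, smul_eq_mul, length_descList]
  have h1 : ((-1 : ℂ) ^ (((Finset.Icc 1 n \ S).card + 1) / 2)) *
      (-1) ^ (((Finset.Icc 1 n \ S).card + 1) / 2) = 1 := by
    rw [← mul_pow]
    simp
  linear_combination (-listPf a (padZero (descList S)) *
    listPf b (padZero (descList (Finset.Icc 1 n \ S)))) * h1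

end Dual

end QPOrth

namespace QPOrth

open MvPolynomial
open CliffordAlgebra (contractLeft changeForm)
open ExteriorAlgebra (ι)

/-! ### Evaluation of the dual Pfaffian -/

section DualEval

/-- `∑_{i ≤ n} s^i (u_i + (-1)^i w_i)` for the basis vectors `u_i`, `w_i` of the first two blocks. -/
noncomputable def dualPoint (n : ℕ) (s : ℂ) : Fin 3 × ℕ →₀ ℂ :=
  ∑ i ∈ Finset.range (n + 1), s ^ i • (gen 0 i + (-1 : ℂ) ^ i • gen 1 i)

theorem dualPoint_zero (n : ℕ) : dualPoint n 0 = gen 0 0 + gen 1 0 := by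
  simp [dualPoint, Finset.sum_range_succ']

theorem freeForm_dualPoint (a b : ℕ → ℕ → ℂ) (n : ℕ) (s : ℂ) (v : Fin 3 × ℕ →₀ ℂ) :
    freeForm (dualEntry a b) (dualPoint n s) v = ∑ i ∈ Finset.range (n + 1),
      (s ^ i * freeForm (dualEntry a b) (gen 0 i) v +
        (-s) ^ i * freeForm (dualEntry a b) (gen 1 i) v) := by
  rw [dualPoint, map_sum, LinearMap.sum_apply]
  refine Finset.sum_congr rfl fun i _ => ?_
  rw [map_smul, map_add, map_smul, LinearMap.smul_apply, LinearMap.add_apply,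
    LinearMap.smul_apply, neg_pow]
  simp only [smul_eq_mul]
  ring

theorem freeForm_gen (a b : ℕ → ℕ → ℂ) (c d : Fin 3) (i j : ℕ) :
    freeForm (dualEntry a b) (gen c i) (gen d j) = dualEntry a b (c, i) (d, j) :=
  freeForm_single _ _ _

theorem freeForm_dualPoint_dualPoint (a b : ℕ → ℕ → ℂ) (n : ℕ) (s t : ℂ) :
    freeForm (dualEntry a b) (dualPoint n s) (dualPoint n t) =
      (∑ i ∈ Finset.range (n + 1), ∑ j ∈ Finset.range (n + 1), s ^ i * t ^ j * a i j) -
        ∑ i ∈ Finset.range (n + 1), ∑ j ∈ Finset.range (n + 1), (-s) ^ i * (-t) ^ j * b i j := by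
  rw [freeForm_dualPoint, ← Finset.sum_sub_distrib]
  refine Finset.sum_congr rfl fun i _ => ?_
  rw [dualPoint, map_sum, map_sum, Finset.mul_sum, Finset.mul_sum, ← Finset.sum_add_distrib,
    ← Finset.sum_sub_distrib]
  refine Finset.sum_congr rfl fun j _ => ?_
  simp only [map_smul, map_add, freeForm_gen, smul_eq_mul, dualEntry, neg_pow t]
  simp
  ring

/-- Two points with the same squares of coordinates have the same diagonal entries. -/
theorem sum_diag_eq {n : ℕ} {x y : Fin n → ℂ}
    (hxy : ∀ u : ℂ, ∏ i, (1 - x i ^ 2 * u) = ∏ i, (1 - y i ^ 2 * u)) (u : ℂ) :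
    ∑ k ∈ Finset.range (n + 1), u ^ k * qEntry (elem x) k k =
      ∑ k ∈ Finset.range (n + 1), u ^ k * qEntry (elem y) k k := by
  -- With u = -s², `sum_qEntry_diag` expresses both sides through the squares of the coordinates.
  obtain ⟨s, hs⟩ := IsAlgClosed.exists_pow_nat_eq (-u) (n := 2) (by norm_num)
  obtain rfl : u = -(s * s) := by linear_combination hs
  have hz : ∀ z : Fin n → ℂ, (∑ a ∈ Finset.range (n + 1), elem z a * s ^ a) *
      ∑ a ∈ Finset.range (n + 1), elem z a * (-s) ^ a = ∏ i, (1 - z i ^ 2 * s ^ 2) := by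
    intro z
    rw [sum_elem, sum_elem, ← Finset.prod_mul_distrib]
    exact Finset.prod_congr rfl fun i _ => by ring
  rw [sum_qEntry_diag (elem_of_lt x), sum_qEntry_diag (elem_of_lt y), hz, hz, hxy]

variable {n : ℕ} {x y : Fin n → ℂ}

/-- The form whose Pfaffians give the products of `Q̃`-polynomials at two points. -/
noncomputable def dualForm (x y : Fin n → ℂ) : LinearMap.BilinForm ℂ (Fin 3 × ℕ →₀ ℂ) :=
  freeForm (dualEntry (skewEntry (elem x)) (skewEntry (elem y)))

theorem dualForm_isAlt (x y : Fin n → ℂ) : (dualForm x y).IsAlt :=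
  freeForm_isAlt (dualEntry_skew (skewEntry_skew _) (skewEntry_skew _))

theorem dualForm_neg (x y : Fin n → ℂ) (v w : Fin 3 × ℕ →₀ ℂ) :
    dualForm x y v w = -dualForm x y w v := ((dualForm_isAlt x y).neg_eq w v).symm

/-- `∏ (1 - y_l s)`. -/
noncomputable def dualWeight (y : Fin n → ℂ) (s : ℂ) : ℂ := ∏ l, (1 - y l * s)

/-- The pairing is the skew series of x at (s, t) minus that of y at (-s, -t). In the difference of
the two instances of `sum_skewEntry` the equal diagonal series cancel, and E_x(s) = 0 leaves only
the product for y. -/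
theorem dualForm_dualPoint (hxy : ∀ u : ℂ, ∏ i, (1 - x i ^ 2 * u) = ∏ i, (1 - y i ^ 2 * u))
    {s t : ℂ} (hst : s + t ≠ 0) (hs : ∏ i, (1 + x i * s) = 0) :
    dualForm x y (dualPoint n s) (dualPoint n t) =
      -(dualWeight y s * dualWeight y t * schurT s t) := by
  have h1 := sum_skewEntry (elem_of_lt x) s t
  have h2 := sum_skewEntry (elem_of_lt y) (-s) (-t)
  rw [sum_elem, sum_elem, hs, zero_mul, mul_zero, sum_diag_eq hxy] at h1
  rw [sum_elem, sum_elem, neg_mul_neg] at h2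
  have hw : ∀ z : ℂ, ∏ i, (1 + y i * -z) = dualWeight y z := fun z =>
    Finset.prod_congr rfl fun i _ => by ring
  rw [hw, hw] at h2
  rw [dualForm, freeForm_dualPoint_dualPoint, schurT, eq_neg_iff_add_eq_zero]
  field_simp
  linear_combination h1 + h2

/-- Here Q̃_{i,0} = e_i for i > 0 while the skew entry at (0, 0) is 0, so E loses its constant term.
-/
theorem sum_skewEntry_zero (z : Fin n → ℂ) (s : ℂ) :
    ∑ i ∈ Finset.range (n + 1), s ^ i * skewEntry (elem z) i 0 = ∏ i, (1 + z i * s) - 1 := by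
  rw [← sum_elem, Finset.sum_range_succ', Finset.sum_range_succ' (fun a => elem z a * s ^ a)]
  simp only [skewEntry, Nat.zero_lt_succ, if_true, qEntry_zero, elem_zero]
  simp [mul_comm]

theorem dualForm_dualPoint_left {s : ℂ} (hs : ∏ i, (1 + x i * s) = 0) :
    dualForm x y (dualPoint n s) (gen 0 0) = -1 := by
  have h := sum_skewEntry_zero x s
  rw [hs, zero_sub] at h
  rw [dualForm, freeForm_dualPoint, ← h]
  refine Finset.sum_congr rfl fun i _ => ?_
  rw [freeForm_gen, freeForm_gen]
  simp [dualEntry]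

theorem dualForm_dualPoint_right (s : ℂ) :
    dualForm x y (dualPoint n s) (gen 1 0) = 1 - dualWeight y s := by
  have h := sum_skewEntry_zero y (-s)
  have hw : ∏ i, (1 + y i * -s) = dualWeight y s := Finset.prod_congr rfl fun i _ => by ring
  rw [hw] at h
  rw [dualForm, freeForm_dualPoint, ← neg_sub, ← h, ← Finset.sum_neg_distrib]
  refine Finset.sum_congr rfl fun i _ => ?_
  rw [freeForm_gen, freeForm_gen]
  simp [dualEntry]

theorem dualForm_dualPoint_two (s : ℂ) (j : ℕ) : dualForm x y (dualPoint n s) (gen 2 j) = 0 := by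
  rw [dualForm, freeForm_dualPoint]
  refine Finset.sum_eq_zero fun i _ => ?_
  rw [freeForm_gen, freeForm_gen]
  simp [dualEntry]

/-- Vectors orthogonal to the border of even size. -/
noncomputable def shiftedPoint (y : Fin n → ℂ) (s : ℂ) : Fin 3 × ℕ →₀ ℂ :=
  dualPoint n s - dualWeight y s • gen 0 0 + (1 - dualWeight y s) • gen 2 0 - gen 2 1

theorem dualForm_gen (c d : Fin 3) (i j : ℕ) :
    dualForm x y (gen c i) (gen d j) =
      dualEntry (skewEntry (elem x)) (skewEntry (elem y)) (c, i) (d, j) := freeForm_gen _ _ _ _ _ _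

theorem skewEntry_self (e : ℕ → ℂ) (a : ℕ) : skewEntry e a a = 0 := by simp [skewEntry]

/-- With g = `dualWeight y`, the pairings with `gen 0 0` add g(t) - g(s), and the auxiliary block
adds g(s) - g(t). -/
theorem dualForm_shiftedPoint (hxy : ∀ u : ℂ, ∏ i, (1 - x i ^ 2 * u) = ∏ i, (1 - y i ^ 2 * u))
    {s t : ℂ} (hst : s + t ≠ 0) (hs : ∏ i, (1 + x i * s) = 0) (ht : ∏ i, (1 + x i * t) = 0) :
    dualForm x y (shiftedPoint y s) (shiftedPoint y t) =
      -(dualWeight y s * dualWeight y t * schurT s t) := by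
  have h0 := dualForm_dualPoint hxy hst hs
  have h1 := dualForm_dualPoint_left (y := y) hs
  have h2 := dualForm_dualPoint_left (y := y) ht
  have h3 := fun i => dualForm_dualPoint_two (x := x) (y := y) s i
  have h4 := fun i => dualForm_dualPoint_two (x := x) (y := y) t i
  have h5 := dualForm_neg x y (gen 0 0) (dualPoint n t)
  have h6 := fun i => dualForm_neg x y (gen 2 i) (dualPoint n t)
  simp only [shiftedPoint, map_add, map_sub, map_smul, LinearMap.add_apply, LinearMap.sub_apply,
    LinearMap.smul_apply, h0, h1, h2, h3, h4, h5, h6, dualForm_gen, dualEntry, smul_eq_mul]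
  simp [skewEntry_self]
  ring

theorem dualForm_shiftedPoint_left {s : ℂ} (hs : ∏ i, (1 + x i * s) = 0) :
    dualForm x y (shiftedPoint y s) (gen 2 0 + gen 0 0) = 0 := by
  have h1 := dualForm_dualPoint_left (y := y) hs
  have h3 := fun i => dualForm_dualPoint_two (x := x) (y := y) s i
  simp only [shiftedPoint, map_add, map_sub, map_smul, LinearMap.add_apply, LinearMap.sub_apply,
    LinearMap.smul_apply, h1, h3, dualForm_gen, dualEntry, smul_eq_mul]
  simp [skewEntry_self]

theorem dualForm_shiftedPoint_right (s : ℂ) :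
    dualForm x y (shiftedPoint y s) (gen 2 1 - gen 1 0) = 0 := by
  have h1 := dualForm_dualPoint_right (x := x) (y := y) s
  have h3 := fun i => dualForm_dualPoint_two (x := x) (y := y) s i
  simp only [shiftedPoint, map_add, map_sub, map_smul, LinearMap.add_apply, LinearMap.sub_apply,
    LinearMap.smul_apply, h1, h3, dualForm_gen, dualEntry, smul_eq_mul]
  simp

/-- `∑_{1 ≤ i ≤ n} s^i (u_i + (-1)^i w_i)`, as a combination of vectors in decreasing order. -/
noncomputable def truncPoint (n : ℕ) (s : ℂ) : Fin 3 × ℕ →₀ ℂ :=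
  ∑ j : Fin n, s ^ (n - j : ℕ) • (gen 0 (n - j) + (-1 : ℂ) ^ (n - j : ℕ) • gen 1 (n - j))

theorem truncPoint_eq (n : ℕ) (s : ℂ) :
    truncPoint n s = dualPoint n s - (gen 0 0 + gen 1 0) := by
  rw [truncPoint, dualPoint, Finset.sum_range_succ']
  simp only [pow_zero, one_smul, add_sub_cancel_right]
  rw [← Finset.sum_range_reflect, Finset.sum_range]
  refine Finset.sum_congr rfl fun j _ => ?_
  rw [show n - 1 - (j : ℕ) + 1 = n - j by omega]

theorem descList_Icc (n : ℕ) : descList (Finset.Icc 1 n) = List.ofFn fun j : Fin n => n - (j : ℕ) := by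
  symm
  apply eq_descList
  · rw [List.pairwise_ofFn]
    intro i j hij
    have : (i : ℕ) < j := hij
    omega
  · intro a
    rw [List.mem_ofFn, Finset.mem_Icc]
    constructor
    · rintro ⟨j, rfl⟩
      omega
    · rintro ⟨h1, h2⟩
      exact ⟨⟨n - a, by omega⟩, by simp; omega⟩

theorem det_pow_sub (s : Fin n → ℂ) :
    (Matrix.of fun k j : Fin n => s k ^ (n - j : ℕ)).det =
      (∏ k, s k) * ∏ k, ∏ l ∈ Finset.Ioi k, (s k - s l) := by
  have h := Matrix.det_mul_column s (Matrix.projVandermonde 1 s)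
  rw [Matrix.det_projVandermonde] at h
  simp only [Pi.one_apply, one_mul] at h
  rw [← h]
  congr 1
  ext k j
  simp only [Matrix.of_apply, Matrix.projVandermonde_apply, Pi.one_apply, one_pow, one_mul]
  rw [← pow_succ', Fin.val_rev]
  congr 1
  omega

/-- The points are combinations of the `n` vectors on the right with coefficients s_k^{n-j}. An
alternating form changes by the determinant of such a substitution, here a Vandermonde determinant
times ∏ s_k. -/
theorem wick_truncPoint {B : LinearMap.BilinForm ℂ (Fin 3 × ℕ →₀ ℂ)} (hB : B.IsAlt)
    (s : Fin n → ℂ) (z : ExteriorAlgebra ℂ (Fin 3 × ℕ →₀ ℂ)) :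
    wick hB (wedge ((List.ofFn s).map (truncPoint n)) * z) =
      ((∏ k, s k) * ∏ k, ∏ l ∈ Finset.Ioi k, (s k - s l)) *
        wick hB (wedge ((descList (Finset.Icc 1 n)).map
          fun i => gen 0 i + (-1 : ℂ) ^ i • gen 1 i) * z) := by
  set v : Fin n → Fin 3 × ℕ →₀ ℂ :=
    fun j => gen 0 (n - j) + (-1 : ℂ) ^ (n - j : ℕ) • gen 1 (n - j) with hv
  set f : (Fin n → ℂ) [⋀^Fin n]→ₗ[ℂ] ℂ :=
    ((wick hB ∘ₗ LinearMap.mulRight ℂ z).compAlternatingMap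
      (ExteriorAlgebra.ιMulti ℂ n)).compLinearMap (Fintype.linearCombination ℂ v) with hf
  have h := congrArg (fun φ => φ fun k j : Fin n => s k ^ (n - j : ℕ))
    (f.eq_smul_basis_det (Pi.basisFun ℂ (Fin n)))
  have hval : ∀ w : Fin n → Fin n → ℂ, f w =
      wick hB (wedge (List.ofFn fun k => Fintype.linearCombination ℂ v (w k)) * z) := by
    intro w
    rw [wedge_ofFn]
    rfl
  have h1 : (fun k => Fintype.linearCombination ℂ v (Pi.basisFun ℂ (Fin n) k)) = v := by
    funext k
    simp [Fintype.linearCombination_apply, Pi.single_apply]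
  have h2 : (fun k => Fintype.linearCombination ℂ v fun j : Fin n => s k ^ (n - j : ℕ)) =
      truncPoint n ∘ s := by
    funext k
    rw [Fintype.linearCombination_apply]
    rfl
  have h3 : (Pi.basisFun ℂ (Fin n)).det (fun k j : Fin n => s k ^ (n - j : ℕ)) =
      (Matrix.of fun k j : Fin n => s k ^ (n - j : ℕ)).det := by
    rw [Pi.basisFun_det]
    rfl
  simp only [AlternatingMap.smul_apply, smul_eq_mul] at h
  rw [hval, hval, h1, h2, h3, det_pow_sub] at h
  rw [List.map_ofFn, h, descList_Icc, List.map_ofFn, mul_comm]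
  rfl

/-- Scale index `s` by i g(s); the imaginary unit absorbs the minus sign. -/
theorem listPf_weighted (g : ℂ → ℂ) (l : List ℂ) :
    listPf (fun s t => -(g s * g t * schurT s t)) l =
      Complex.I ^ l.length * (l.map g).prod * listPf schurT l := by
  have h := listPf_scale schurT (fun s => Complex.I * g s) l
  rw [List.prod_map_mul] at h
  simp only [List.map_const', List.prod_replicate] at h
  rw [← h]
  refine listPf_congr _ fun s t _ => ?_
  linear_combination (-g s * g t * schurT s t) * Complex.I_mul_I

end DualEval

end QPOrth

/-! ### The sum over complementary strict partitions -/

namespace QPOrth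

open MvPolynomial
open CliffordAlgebra (contractLeft changeForm)
open ExteriorAlgebra (ι)

section DualSum

variable {n : ℕ} {x y : Fin n → ℂ}

/-- The zeros of `∏ (1 + x_i s)`. -/
noncomputable def negInv (x : Fin n → ℂ) (k : Fin n) : ℂ := -(x k)⁻¹

theorem GoodPoint.negInv (hx : GoodPoint x) : GoodPoint (negInv x) := by
  refine ⟨fun i j h => hx.inj (inv_injective (neg_injective h)), fun i j h => ?_⟩
  have h1 := hx.ne_zero i
  have h2 := hx.ne_zero j
  have h3 := hx.add_ne j i
  change -(x i)⁻¹ + -(x j)⁻¹ = 0 at h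
  apply h3
  field_simp at h
  linear_combination -h

theorem GoodPoint.prod_one_add_negInv (hx : GoodPoint x) (k : Fin n) :
    ∏ i, (1 + x i * QPOrth.negInv x k) = 0 := by
  refine Finset.prod_eq_zero (Finset.mem_univ k) ?_
  have := hx.ne_zero k
  rw [QPOrth.negInv]
  field_simp
  ring

theorem I_pow_two_mul (m : ℕ) : Complex.I ^ (2 * m) = (-1) ^ m := by
  rw [pow_mul, Complex.I_sq]

/-- Vectors of the border may be added to the truncated points for free. This makes the Gram matrix
computable, and Schur's Pfaffian at the points -1/x_k applies. -/
theorem wick_dualBorder (hx : GoodPoint x)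
    (hxy : ∀ u : ℂ, ∏ i, (1 - x i ^ 2 * u) = ∏ i, (1 - y i ^ 2 * u)) :
    wick (dualForm_isAlt x y) (wedge ((List.ofFn (negInv x)).map (truncPoint n)) * dualBorder n) =
      (-1) ^ ((n + 1) / 2) * (∏ k, dualWeight y (negInv x k)) * schurProd (negInv x) := by
  have hs := hx.negInv
  have hmem : ∀ s ∈ List.ofFn (negInv x), ∃ k, negInv x k = s := fun s => by
    rw [List.mem_ofFn]
    exact id
  have hschur := listPf_schurT hs.schurList (fun s h => by
    obtain ⟨k, rfl⟩ := hmem s h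
    exact hs.ne_zero k)
  rw [List.length_ofFn, pairProd_ofFn] at hschur
  change _ = schurProd (negInv x) at hschur
  have hprod : ((List.ofFn (negInv x)).map (dualWeight y)).prod =
      ∏ k, dualWeight y (negInv x k) := by
    rw [List.map_ofFn, List.prod_ofFn]
    rfl
  rw [dualBorder]
  by_cases he : Even n
  -- The shifted points are orthogonal to both border vectors, so the border splits off with
  -- Pfaffian 1.
  · rw [if_pos he, ← wedge_map_mul_congr (truncPoint n) (shiftedPoint y)]
    · have hb : ι ℂ (gen 2 0 + gen 0 0) * ι ℂ (gen 2 1 - gen 1 0) =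
          wedge (R := ℂ) [gen 2 0 + gen 0 0, gen 2 1 - gen 1 0] := by simp
      have hb1 : wick (dualForm_isAlt x y)
          (wedge [gen 2 0 + gen 0 0, gen 2 1 - gen 1 0]) = 1 := by
        rw [wick_wedge]
        simp only [listPf_cons, map_add, LinearMap.add_apply, List.length_cons, List.length_nil]
        simp [dualForm_gen, dualEntry, listPf_nil]
      rw [hb, wick_mul_of_orthogonal, hb1, mul_one, wick_wedge, listPf_map]
      · have hc : listPf (fun s t => dualForm x y (shiftedPoint y s) (shiftedPoint y t))
            (List.ofFn (negInv x)) = listPf (fun s t => -(dualWeight y s * dualWeight y t *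
              schurT s t)) (List.ofFn (negInv x)) := by
          refine listPf_congr _ fun s t hst => ?_
          obtain ⟨k, rfl⟩ := hmem s (hst.subset (by simp))
          obtain ⟨l, rfl⟩ := hmem t (hst.subset (by simp))
          exact dualForm_shiftedPoint hxy (hs.add_ne k l) (hx.prod_one_add_negInv k)
            (hx.prod_one_add_negInv l)
        rw [if_pos he, List.append_nil] at hschur
        have hI : Complex.I ^ n = (-1) ^ ((n + 1) / 2) := by
          obtain ⟨m, hm⟩ := he
          rw [← I_pow_two_mul]
          congr 1
          omega
        rw [hc, listPf_weighted, hschur, hprod, List.length_ofFn, hI]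
      · intro v hv w hw
        obtain ⟨s, hs', rfl⟩ := List.mem_map.1 hv
        obtain ⟨k, rfl⟩ := hmem s hs'
        simp only [List.mem_cons, List.not_mem_nil, or_false] at hw
        rcases hw with rfl | rfl
        · exact dualForm_shiftedPoint_left (hx.prod_one_add_negInv k)
        · exact dualForm_shiftedPoint_right _
    · intro s _
      have hd : shiftedPoint y s - truncPoint n s =
          (1 - dualWeight y s) • (gen 2 0 + gen 0 0) - (gen 2 1 - gen 1 0) := by
        rw [truncPoint_eq, shiftedPoint]
        module
      rw [hd, map_sub, map_smul, sub_mul, smul_mul_assoc, ← mul_assoc, ExteriorAlgebra.ι_sq_zero,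
        zero_mul, smul_zero, ← mul_assoc, ι_mul_ι_comm, neg_mul, mul_assoc,
        ExteriorAlgebra.ι_sq_zero, mul_zero, neg_zero, sub_zero]
  -- The border is itself `dualPoint n 0`, hence the bordering point 0 of Schur's Pfaffian, with
  -- weight 1.
  · rw [if_neg he, ← wedge_map_mul_congr (truncPoint n) (dualPoint n)]
    · have hb : wedge (R := ℂ) ((List.ofFn (negInv x)).map (dualPoint n)) *
          ι ℂ (gen 0 0 + gen 1 0) = wedge ((List.ofFn (negInv x) ++ [0]).map (dualPoint n)) := by
        rw [List.map_append, wedge_append, List.map_singleton, wedge_singleton, dualPoint_zero]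
      rw [if_neg he] at hschur
      have hc : listPf (fun s t => dualForm x y (dualPoint n s) (dualPoint n t))
          (List.ofFn (negInv x) ++ [0]) = listPf (fun s t => -(dualWeight y s * dualWeight y t *
            schurT s t)) (List.ofFn (negInv x) ++ [0]) := by
        refine listPf_congr _ fun s t hst => ?_
        have hs1 : s ∈ List.ofFn (negInv x) ++ [0] := hst.subset (by simp)
        have ht1 : t ∈ List.ofFn (negInv x) ++ [0] := hst.subset (by simp)
        rw [List.mem_append, List.mem_singleton] at hs1 ht1
        rcases hs1 with hs1 | rfl
        · obtain ⟨k, rfl⟩ := hmem s hs1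
          refine dualForm_dualPoint hxy ?_ (hx.prod_one_add_negInv k)
          rcases ht1 with ht1 | rfl
          · obtain ⟨l, rfl⟩ := hmem t ht1
            exact hs.add_ne k l
          · rw [add_zero]
            exact hs.ne_zero k
        · rcases ht1 with ht1 | rfl
          · obtain ⟨l, rfl⟩ := hmem t ht1
            rw [dualForm_neg, dualForm_dualPoint hxy (by rw [add_zero]; exact hs.ne_zero l)
              (hx.prod_one_add_negInv l), schurT_skew]
            ring
          · rw [dualForm_isAlt x y]
            simp [schurT]
      have hw0 : dualWeight y 0 = 1 := by simp [dualWeight]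
      rw [hb, wick_wedge, listPf_map, hc, listPf_weighted, hschur, List.map_append, List.prod_append,
        hprod, List.length_append, List.length_ofFn, List.map_singleton, List.prod_singleton, hw0,
        mul_one, List.length_singleton]
      obtain ⟨m, rfl⟩ := Nat.not_even_iff_odd.1 he
      rw [show 2 * m + 1 + 1 = 2 * (m + 1) by ring, I_pow_two_mul,
        Nat.mul_div_cancel_left _ (by norm_num)]
    · intro s _
      have hd : dualPoint n s - truncPoint n s = gen 0 0 + gen 1 0 := by
        rw [truncPoint_eq]
        abel
      rw [hd, ExteriorAlgebra.ι_sq_zero]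

/-- The sum over complementary pairs of strict partitions, up to explicit factors. -/
theorem sum_strictPartitions_eq (hx : GoodPoint x)
    (hxy : ∀ u : ℂ, ∏ i, (1 - x i ^ 2 * u) = ∏ i, (1 - y i ^ 2 * u)) :
    ((∏ k, negInv x k) * ∏ k, ∏ l ∈ Finset.Ioi k, (negInv x k - negInv x l)) *
        (2 ^ n * ∑ lam ∈ strictPartitions n,
          eval x (Ptilde lam) * eval y (Ptilde (hatPartition lam))) =
      (-1) ^ ((n + 1) / 2) * (∏ k, dualWeight y (negInv x k)) * schurProd (negInv x) := by
  rw [sum_strictPartitions, sum_powerset_listPf (skewEntry_skew _) (skewEntry_skew _),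
    ← wick_dualBorder hx hxy, wick_truncPoint]
  rfl

theorem GoodPoint.det_ne_zero (hx : GoodPoint x) :
    (∏ k, QPOrth.negInv x k) *
      ∏ k, ∏ l ∈ Finset.Ioi k, (QPOrth.negInv x k - QPOrth.negInv x l) ≠ 0 :=
  mul_ne_zero (Finset.prod_ne_zero_iff.2 fun k _ => hx.negInv.ne_zero k)
    (vand_ne_zero hx.negInv.inj)

/-- At s = -1/x_k the weight ∏ (1 - y_l s) has the factor 1 + y_l/x_k = 0. -/
theorem sum_strictPartitions_eq_zero (hx : GoodPoint x)
    (hxy : ∀ u : ℂ, ∏ i, (1 - x i ^ 2 * u) = ∏ i, (1 - y i ^ 2 * u)) {k l : Fin n}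
    (hkl : x k + y l = 0) :
    ∑ lam ∈ strictPartitions n, eval x (Ptilde lam) * eval y (Ptilde (hatPartition lam)) = 0 := by
  have h := sum_strictPartitions_eq hx hxy
  have h0 : dualWeight y (negInv x k) = 0 := by
    refine Finset.prod_eq_zero (Finset.mem_univ l) ?_
    have := hx.ne_zero k
    rw [negInv]
    field_simp
    linear_combination hkl
  rw [Finset.prod_eq_zero (f := fun k => dualWeight y (negInv x k)) (Finset.mem_univ k) h0, mul_zero, zero_mul] at h
  have h2 := (mul_eq_zero.1 h).resolve_left hx.det_ne_zero
  exact (mul_eq_zero.1 h2).resolve_left (pow_ne_zero n two_ne_zero)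

theorem prod_neg_one_pow_sub (n : ℕ) :
    ∏ k : Fin n, (-1 : ℂ) ^ (n - k : ℕ) = (-1) ^ ((n + 1) / 2) := by
  induction n with
  | zero => simp
  | succ n ih =>
    rw [Fin.prod_univ_succ]
    have h1 : ∏ i : Fin n, (-1 : ℂ) ^ (n + 1 - (i.succ : Fin (n + 1)) : ℕ) =
        ∏ k : Fin n, (-1 : ℂ) ^ (n - k : ℕ) :=
      Finset.prod_congr rfl fun i _ => by
        congr 1
        simp
    rw [h1, ih]
    rcases Nat.even_or_odd' n with ⟨m, rfl | rfl⟩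
    · rw [show (2 * m + 1) / 2 = m by omega, show (2 * m + 1 + 1) / 2 = m + 1 by omega]
      simp [pow_succ, pow_mul]
    · rw [show (2 * m + 1 + 1) / 2 = m + 1 by omega, show (2 * m + 1 + 1 + 1) / 2 = m + 1 by omega]
      simp [pow_succ, pow_mul]

/-- For y = x the diagonal weights 1 + x_k/x_k give 2^n. Each pair k < l contributes the
off-diagonal factors (x_k + x_l)² s_k s_l, which combine with (s_k - s_l)/(s_k + s_l) through (x_k +
x_l) s_k s_l = -(s_k + s_l), where s_k = -1/x_k. -/
theorem sum_strictPartitions_self (hx : GoodPoint x) :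
    ∑ lam ∈ strictPartitions n, eval x (Ptilde lam) * eval x (Ptilde (hatPartition lam)) =
      (∏ k, x k) * ∏ k, ∏ l ∈ Finset.Ioi k, (x k + x l) := by
  have h := sum_strictPartitions_eq hx fun _ => rfl
  have hs := hx.negInv
  have h0 := hx.ne_zero
  have hg : ∏ k, dualWeight x (negInv x k) =
      2 ^ n * ∏ k, ∏ l ∈ Finset.Ioi k, ((x k + x l) ^ 2 * (negInv x k * negInv x l)) := by
    have h1 : ∀ k, dualWeight x (negInv x k) =
        2 * ∏ l, if k = l then 1 else (x k + x l) * -negInv x k := by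
      intro k
      rw [dualWeight, ← Finset.mul_prod_erase _ _ (Finset.mem_univ k),
        ← Finset.mul_prod_erase _ (fun l => if k = l then 1 else _) (Finset.mem_univ k), if_pos rfl,
        one_mul]
      congr 1
      · have := h0 k
        rw [negInv]
        field_simp
        norm_num
      · refine Finset.prod_congr rfl fun l hl => ?_
        have := h0 k
        rw [if_neg (Finset.ne_of_mem_erase hl).symm, negInv]
        field_simp
        ring
    rw [Finset.prod_congr rfl fun k _ => h1 k, Finset.prod_mul_distrib, Finset.prod_const,
      Finset.card_univ, Fintype.card_fin, prod_prod_eq_prod_Ioi _ (by simp)]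
    congr 1
    refine Finset.prod_congr rfl fun k _ => Finset.prod_congr rfl fun l hl => ?_
    have hkl : k ≠ l := (Finset.mem_Ioi.1 hl).ne
    rw [if_neg hkl, if_neg hkl.symm]
    ring
  have hmain : (-1) ^ ((n + 1) / 2) * (∏ k, dualWeight x (negInv x k)) * schurProd (negInv x) =
      ((∏ k, negInv x k) * ∏ k, ∏ l ∈ Finset.Ioi k, (negInv x k - negInv x l)) *
        (2 ^ n * ((∏ k, x k) * ∏ k, ∏ l ∈ Finset.Ioi k, (x k + x l))) := by
    -- The sign is split into one factor -1 for each coordinate and one for each pair, n(n+1)/2 in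
    -- all.
    have h2 : (-1 : ℂ) ^ ((n + 1) / 2) = (∏ k, (x k * negInv x k)) *
        ∏ k : Fin n, ∏ l ∈ Finset.Ioi k, (-1 : ℂ) := by
      rw [← prod_neg_one_pow_sub, ← Finset.prod_mul_distrib]
      refine Finset.prod_congr rfl fun k _ => ?_
      rw [Finset.prod_const, Fin.card_Ioi, negInv, mul_neg, mul_inv_cancel₀ (h0 k), ← pow_succ']
      congr 1
      omega
    have h3 : (∏ k : Fin n, ∏ l ∈ Finset.Ioi k, (-1 : ℂ)) *
        (∏ k, ∏ l ∈ Finset.Ioi k, ((x k + x l) ^ 2 * (negInv x k * negInv x l))) *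
          schurProd (negInv x) =
        (∏ k, ∏ l ∈ Finset.Ioi k, (negInv x k - negInv x l)) *
          ∏ k, ∏ l ∈ Finset.Ioi k, (x k + x l) := by
      simp only [schurProd, ← Finset.prod_mul_distrib]
      refine Finset.prod_congr rfl fun k _ => Finset.prod_congr rfl fun l _ => ?_
      have h4 : (x k + x l) * (negInv x k * negInv x l) = -(negInv x k + negInv x l) := by
        have := h0 k
        have := h0 l
        simp only [negInv]
        field_simp
        ring
      have h5 := hs.add_ne k l
      rw [schurT]
      field_simp
      linear_combination (-(x k + x l) * (negInv x k - negInv x l)) * h4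
    rw [h2, hg, Finset.prod_mul_distrib]
    linear_combination ((∏ k, x k) * (∏ k, negInv x k) * 2 ^ n) * h3
  rw [hmain] at h
  exact mul_left_cancel₀ (pow_ne_zero n two_ne_zero) (mul_left_cancel₀ hx.det_ne_zero h)

end DualSum

end QPOrth

namespace QPOrth

open MvPolynomial

/-! ### The bialternant formula -/

section Bialternant

variable {n : ℕ}

/-- `(-1)^d e_d` of the coordinates other than the `k`-th. -/
noncomputable def coelem (x : Fin n → ℂ) (k : Fin n) (d : ℕ) : ℂ :=
  (∏ l ∈ Finset.univ.erase k, (1 - Polynomial.C (x l) * Polynomial.X) : Polynomial ℂ).coeff d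

theorem coelem_eq_zero (x : Fin n → ℂ) (k : Fin n) {d : ℕ} (hd : n ≤ d) : coelem x k d = 0 := by
  apply Polynomial.coeff_eq_zero_of_natDegree_lt
  have h1 : ∀ l : Fin n, (1 - Polynomial.C (x l) * Polynomial.X : Polynomial ℂ).natDegree ≤ 1 := by
    intro l
    compute_degree
  have h2 := Polynomial.natDegree_prod_le (Finset.univ.erase k)
    fun l => (1 - Polynomial.C (x l) * Polynomial.X : Polynomial ℂ)
  have h3 := Finset.sum_le_card_nsmul (Finset.univ.erase k) _ 1 fun l _ => h1 l
  have hk := k.2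
  rw [Finset.card_erase_of_mem (Finset.mem_univ k), Finset.card_univ, Fintype.card_fin,
    smul_eq_mul] at h3
  omega

/-- Multiplying ∏ 1/(1 - x_l s) by the factors with l ≠ k leaves the geometric series 1/(1 - x_k s).
-/
theorem sum_antidiagonal_complete (x : Fin n → ℂ) (k : Fin n) (m : ℕ) :
    ∑ p ∈ Finset.HasAntidiagonal.antidiagonal m, complete x p.1 * coelem x k p.2 = x k ^ m := by
  have h := mk_complete_mul x
  rw [← Finset.mul_prod_erase _ _ (Finset.mem_univ k), Polynomial.coe_mul, mul_left_comm] at h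
  set F : PowerSeries ℂ := PowerSeries.mk (complete x) *
    ((∏ l ∈ Finset.univ.erase k, (1 - Polynomial.C (x l) * Polynomial.X) : Polynomial ℂ) :
      PowerSeries ℂ) with hF
  have hc : ∀ m, PowerSeries.coeff m F =
      ∑ p ∈ Finset.HasAntidiagonal.antidiagonal m, complete x p.1 * coelem x k p.2 := by
    intro m
    rw [hF, PowerSeries.coeff_mul]
    refine Finset.sum_congr rfl fun p _ => ?_
    rw [PowerSeries.coeff_mk, Polynomial.coeff_coe, coelem]
  rw [← hc]
  have h' : F = 1 + PowerSeries.C (x k) * (PowerSeries.X * F) := by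
    rw [← h, Polynomial.coe_sub, Polynomial.coe_mul, Polynomial.coe_C, Polynomial.coe_X,
      Polynomial.coe_one]
    ring
  induction m with
  | zero =>
    rw [h', map_add, PowerSeries.coeff_C_mul]
    simp
  | succ m ih =>
    rw [h', map_add, PowerSeries.coeff_C_mul, PowerSeries.coeff_succ_X_mul, ih,
      PowerSeries.coeff_one, if_neg (by omega), zero_add, pow_succ']

theorem eval_completeSymm (x : Fin n → ℂ) (k : ℤ) :
    eval x (completeSymm n k) = if 0 ≤ k then complete x k.toNat else 0 := by
  unfold completeSymm
  split_ifs <;> simp [complete]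

/-- The same convolution in matrix form: terms beyond the antidiagonal vanish because H has negative
index, and those missing from it because `coelem` vanishes from degree `n` on. -/
theorem sum_completeSymm_mul_coelem (x : Fin n → ℂ) (k : Fin n) (m : ℕ) :
    ∑ j : Fin n, eval x (completeSymm n ((m : ℤ) - (n - 1 : ℕ) + (j : ℕ))) *
      coelem x k (n - 1 - j) = x k ^ m := by
  set G : ℕ → ℂ := fun d => if d ≤ m then complete x (m - d) * coelem x k d else 0 with hG
  have h1 : ∑ j : Fin n, eval x (completeSymm n ((m : ℤ) - (n - 1 : ℕ) + (j : ℕ))) *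
      coelem x k (n - 1 - j) = ∑ d ∈ Finset.range n, G d := by
    rw [← Finset.sum_range_reflect, Finset.sum_range]
    refine Finset.sum_congr rfl fun j _ => ?_
    have hj := j.2
    rw [eval_completeSymm, hG, ite_mul, zero_mul]
    refine if_congr (by omega) ?_ rfl
    congr 2
    omega
  have h2 : ∑ d ∈ Finset.range n, G d = ∑ d ∈ Finset.range (n + m + 1), G d := by
    refine Finset.sum_subset (Finset.range_subset_range.2 (by omega)) fun d _ hd => ?_
    rw [hG]
    simp only
    rw [coelem_eq_zero x k (by simpa using hd), mul_zero, ite_self]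
  have h3 : ∑ d ∈ Finset.range (m + 1), G d = ∑ d ∈ Finset.range (n + m + 1), G d := by
    refine Finset.sum_subset (Finset.range_subset_range.2 (by omega)) fun d _ hd => ?_
    rw [Finset.mem_range] at hd
    exact if_neg (by omega)
  rw [h1, h2, ← h3, ← sum_antidiagonal_complete, ← Finset.Nat.sum_antidiagonal_swap,
    Finset.Nat.sum_antidiagonal_eq_sum_range_succ_mk]
  refine Finset.sum_congr rfl fun d hd => ?_
  rw [Finset.mem_range] at hd
  exact if_pos (by omega)

/-- The Jacobi–Trudi matrix times the matrix of the `coelem` is the alternant matrix, row by row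
from `sum_completeSymm_mul_coelem`. -/
theorem eval_schur_mul_vand (x : Fin n → ℂ) (lam : Fin n → ℕ) :
    eval x (schur lam) * (Matrix.of fun j k : Fin n => coelem x k (n - 1 - j)).det =
      (Matrix.of fun i k : Fin n => x k ^ (lam i + (n - 1 - i))).det := by
  rw [schur, RingHom.map_det, ← Matrix.det_mul]
  congr 1
  ext i k
  rw [Matrix.mul_apply]
  simp only [Matrix.of_apply, RingHom.mapMatrix_apply, Matrix.map_apply]
  rw [← sum_completeSymm_mul_coelem x k]
  refine Finset.sum_congr rfl fun j _ => ?_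
  congr 3
  have := i.2
  omega

theorem schur_zero : schur (fun _ : Fin n => 0) = 1 := by
  rw [schur, Matrix.det_of_isUpperTriangular]
  · refine Finset.prod_eq_one fun i _ => ?_
    simp [completeSymm]
  · intro i j hij
    have : (j : ℕ) < i := hij
    simp only [Matrix.of_apply, completeSymm]
    rw [if_neg]
    push_cast
    omega

theorem det_pow_eq_vand (x : Fin n → ℂ) :
    (Matrix.of fun i k : Fin n => x k ^ (n - 1 - i : ℕ)).det = vand x := by
  rw [← Matrix.det_transpose]
  have h := Matrix.det_projVandermonde 1 x
  simp only [Pi.one_apply, one_mul] at h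
  rw [vand, ← h]
  congr 1
  ext k j
  simp only [Matrix.transpose_apply, Matrix.of_apply, Matrix.projVandermonde_apply, Pi.one_apply,
    one_pow, one_mul]
  rw [Fin.val_rev]
  congr 1
  omega

/-- For λ = 0 the Jacobi–Trudi matrix is unitriangular, which isolates this determinant. -/
theorem det_coelem (x : Fin n → ℂ) :
    (Matrix.of fun j k : Fin n => coelem x k (n - 1 - j)).det = vand x := by
  have h := eval_schur_mul_vand x fun _ => 0
  rw [schur_zero, map_one, one_mul] at h
  rw [h, ← det_pow_eq_vand]
  simp only [zero_add]

/-- The exponents ρ_i + n - 1 - i, with i counted from 0, are 2(n - 1 - i) + 1. The alternant is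
thus ∏ x_k times the Vandermonde product of the squares. -/
theorem eval_schur_rho {x : Fin n → ℂ} (hx : Function.Injective x) :
    eval x (schur (rho n)) = (∏ k, x k) * ∏ k, ∏ l ∈ Finset.Ioi k, (x k + x l) := by
  have h := eval_schur_mul_vand x (rho n)
  rw [det_coelem] at h
  refine mul_right_cancel₀ (vand_ne_zero hx) (h.trans ?_)
  have h1 := Matrix.det_mul_row x
    (Matrix.of fun i k : Fin n => (fun k => x k ^ 2) k ^ (n - 1 - i : ℕ))
  rw [det_pow_eq_vand] at h1
  have h2 : vand (fun k => x k ^ 2) = vand x * ∏ k, ∏ l ∈ Finset.Ioi k, (x k + x l) := by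
    simp only [vand, ← Finset.prod_mul_distrib]
    exact Finset.prod_congr rfl fun k _ => Finset.prod_congr rfl fun l _ => by ring
  rw [mul_assoc, mul_comm _ (vand x), ← h2, ← h1]
  congr 1
  ext i k
  simp only [Matrix.of_apply, rho]
  rw [← pow_mul, ← pow_succ']
  congr 1
  omega

theorem sum_dual_eq (hn : 0 < n) (I J : exclusiveTuples n) :
    ∑ lam ∈ strictPartitions n, eval (zetaTuple I.1) (Ptilde lam) *
        eval (zetaTuple J.1) (Ptilde (hatPartition lam)) =
      if I = J then eval (zetaTuple I.1) (schur (rho n)) else 0 := by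
  have hI := goodPoint_zetaTuple I
  split_ifs with h
  · subst h
    rw [sum_strictPartitions_self hI, eval_schur_rho hI.inj]
  · have : ∃ k l, zetaTuple I.1 k + zetaTuple J.1 l = 0 := by
      by_contra! hc
      exact h (eq_of_forall_add_ne hn hc)
    obtain ⟨k, l, hkl⟩ := this
    refine sum_strictPartitions_eq_zero hI (fun u => ?_) hkl
    rw [prod_one_sub_sq_mul hn I, prod_one_sub_sq_mul hn J]

end Bialternant

end QPOrth

/-! ### The four identities -/

theorem mainTheorem9 (n : ℕ) (hn : 0 < n) (I J : QPOrth.exclusiveTuples n) :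
    (∀ z : Fin n → ℂ,
      ∑ lam ∈ QPOrth.boxPartitions n,
          MvPolynomial.eval (QPOrth.zetaTuple (QPOrth.starTuple hn J)) (QPOrth.HLP lam).1 *
            MvPolynomial.eval z (QPOrth.Qtilde lam) =
        ∏ k, ∏ l, (1 - z k * QPOrth.zetaPow n (-(QPOrth.hatTuple hn J l)))) ∧
    (∑ lam ∈ QPOrth.boxPartitions n,
        MvPolynomial.eval (QPOrth.zetaTuple (QPOrth.starTuple hn J)) (QPOrth.HLP lam).1 *
          MvPolynomial.eval (QPOrth.zetaTuple I.1) (QPOrth.Qtilde lam) =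
      if I = J then (2 * (n : ℂ)) ^ n / (‖QPOrth.vand (QPOrth.zetaTuple I.1)‖ : ℂ) ^ 2 else 0) ∧
    (∑ lam ∈ QPOrth.boxPartitions n,
        (starRingEnd ℂ) (MvPolynomial.eval (QPOrth.zetaTuple J.1)
            (QPOrth.omega n (QPOrth.HLP lam)).1) *
          MvPolynomial.eval (QPOrth.zetaTuple I.1) (QPOrth.Qtilde lam) =
      if I = J then (2 * (n : ℂ)) ^ n / (‖QPOrth.vand (QPOrth.zetaTuple I.1)‖ : ℂ) ^ 2 else 0) ∧
    (∑ lam ∈ QPOrth.strictPartitions n,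
        MvPolynomial.eval (QPOrth.zetaTuple I.1) (QPOrth.Ptilde lam) *
          MvPolynomial.eval (QPOrth.zetaTuple J.1) (QPOrth.Ptilde (QPOrth.hatPartition lam)) =
      if I = J then
        MvPolynomial.eval (QPOrth.zetaTuple I.1) (QPOrth.schur (QPOrth.rho n))
      else 0) := by
  exact ⟨fun z => (QPOrth.sum_star_eq hn J z).trans (QPOrth.prod_hat_eq hn J z).symm,
    (QPOrth.sum_star_eq hn J _).trans (QPOrth.prod_one_add_eq hn I J),
    (QPOrth.sum_conj_omega_eq hn J _).trans (QPOrth.prod_one_add_eq hn I J),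
    QPOrth.sum_dual_eq hn I J⟩
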